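/- **Definitions.** A $d$-pseudomanifold is a finite regular CW-complex that is simplicial (the faces of every face form a Boolean poset), pure of dimension $d$, and in which every $(d-1)$-face lies in at most two $d$-faces; it need not be a simplicial complex. For a face $\sigma$ of a complex $K$, $\mathrm{link}(\sigma,K)$ is the subcomplex of those faces $\tau$ with $\tau\cap\sigma=\emptyset$ for which some face of $K$ contains both $\sigma$ and $\tau$. The boundary $\partial L$ of the 2-dimensional link $L$ of a $(d-3)$-face is the smallest subcomplex containing all edges of $L$ that lie in exactly one triangle of $L$; faces of $L$ outside $\partial L$ are interior. A tree of $d$-simplices is a triangulated $d$-ball, glued from $d$-simplices along facets, whose dual graph is a tree. A 2-LC gluing in a pseudomanifold $K$ is the identification of two different boundary $(d-1)$-faces $E_1,E_2$ of $K$ with $\dim(E_1\cap E_2)\ge d-3$, such that the result $K'$ is again a pseudomanifold. A $2$-LC $d$-quasimanifold is a pseudomanifold $P$ that can be obtained from a tree of $d$-simplices by successive 2-LC gluings $K\to K'$, each of which satisfies the following. 1. (Orientable) For every $(d-3)$-face $\delta$ of $K'$ contained in the glued facet, $\mathrm{link}(\delta,K')$ is orientable: its triangles can be oriented so that any two distinct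 triangles with a common edge induce opposite directions on this edge. 2. (Planar) For every such $\delta$, $\mathrm{link}(\delta,K')$ is planar: its triangles can be drawn without overlap as triangles of a triangulated 2-sphere, so that common edges of triangles are preserved (triangles meeting only in a vertex may be pulled apart there). 3. (Boundary-only) If $\delta,\delta'$ are $(d-3)$-faces of $K$ that are equal or become equal in $K'$, and $x\in\mathrm{link}(\delta,K)$ and $y\in\mathrm{link}(\delta',K)$ have the same image in $K'$, where $(\delta,x)\neq(\delta',y)$, then $x\in\partial\,\mathrm{link}(\delta,K)$ and $y\in\partial\,\mathrm{link}(\delta',K)$. 4. (Component-respecting) If $\delta$ is a $(d-3)$-face of $K$, then two faces of $\partial\,\mathrm{link}(\delta,K)$ that have the same image in $K'$ lie in the same connected component of $\partial\,\mathrm{link}(\delta,K)$. Moreover, in the final complex $P$, whenever $\delta$ is a $(d-3)$-face and $e$ is an interior edge of $\mathrm{link}(\delta,P)$, any two $(d-1)$-faces of $P$ that contain both $\delta$ and $e$ are required to coincide. Two such complexes are combinatorially equivalent if their face posets are isomorphic. **Theorem.** For every integer $d\ge 3$ there is an $N_0$ such that for all $N\ge N_0$ the number of combinatorial equivalence classes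 of $2$-LC $d$-quasimanifolds with $N$ facets is finite and smaller than $$2^{\frac{d^3}{2}N}.$$ -/

import Mathlib

open Filter

/-! ### Simplicial regular CW-complexes, through their face posets

A finite simplicial regular CW-complex is recorded by the poset of its nonempty faces, in which the
faces of any face form a Boolean poset. The dimension of a face is its height in the poset, so
vertices, edges and triangles have heights 0, 1 and 2. -/

/-- `P` is the poset of nonempty faces of a finite simplicial regular CW-complex. -/
def IsSimplicial (P : Type) [PartialOrder P] : Prop :=
  Finite P ∧ ∀ x : P, ∃ n : ℕ, Nonempty (Set.Iic x ≃o {S : Finset (Fin n) // S.Nonempty})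

/-- `d`-dimensional pseudomanifolds: simplicial, pure of dimension `d`, and every `(d-1)`-face lies
in at most two `d`-faces. -/
structure IsPseudomanifold (d : ℕ) (P : Type) [PartialOrder P] : Prop where
  simplicial : IsSimplicial P
  height_le : ∀ x : P, Order.height x ≤ d
  pure : ∀ x : P, ∃ t : P, x ≤ t ∧ Order.height t = d
  thin : ∀ x : P, Order.height x + 1 = d → {t : P | Order.height t = d ∧ x ≤ t}.encard ≤ 2

section Complex

variable {P : Type} [PartialOrder P]

/-- The link of `σ`: the faces of the star of `σ` that are disjoint from `σ`. -/
def link (σ : P) : Set P :=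
  {τ | (∃ ρ, σ ≤ ρ ∧ τ ≤ ρ) ∧ ¬ ∃ v, v ≤ σ ∧ v ≤ τ}

/-- The boundary of a 2-dimensional subcomplex `L`: the smallest subcomplex that contains all edges
of `L` belonging to exactly one triangle of `L`. -/
def boundary (L : Set P) : Set P :=
  {x | ∃ e ∈ L, x ≤ e ∧ Order.height e = 1 ∧ ∃! t, t ∈ L ∧ Order.height t = 2 ∧ e ≤ t}

/-- `x` and `y` lie in the same connected component of the subcomplex `B`. -/
def SameComponent (B : Set P) (x y : P) : Prop :=
  Relation.EqvGen (fun u v => u ∈ B ∧ v ∈ B ∧ u ≤ v) x y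

/-- Orientability of a 2-dimensional subcomplex `L`. Here `o t u v` says that the chosen cyclic
order of the three vertices of the triangle `t` runs from `u` to `v`; two triangles with a common
edge must induce opposite directions on it. -/
def Orientable (L : Set P) : Prop :=
  ∃ o : P → P → P → Prop,
    (∀ t ∈ L, Order.height t = 2 → ∀ u v w : P, IsMin u → IsMin v → IsMin w →
      u ≤ t → v ≤ t → w ≤ t → u ≠ v → v ≠ w → u ≠ w →
        (o t u v ↔ ¬ o t v u) ∧ (o t u v → o t v w)) ∧
    (∀ t ∈ L, ∀ t' ∈ L, ∀ e ∈ L, Order.height t = 2 → Order.height t' = 2 → Order.height e = 1 →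
      t ≠ t' → e ≤ t → e ≤ t' →
        ∀ u v : P, IsMin u → IsMin v → u ≠ v → u ≤ e → v ≤ e → (o t u v ↔ o t' v u))

end Complex

/-- Triangulated 2-spheres: connected closed surfaces (each edge is in two triangles, the triangles
around each vertex form one cycle) of Euler characteristic 2. -/
structure IsTriangulatedSphere (Q : Type) [PartialOrder Q] : Prop where
  simplicial : IsSimplicial Q
  height_le : ∀ x : Q, Order.height x ≤ 2
  pure : ∀ x : Q, ∃ t : Q, x ≤ t ∧ Order.height t = 2
  two_triangles : ∀ e : Q, Order.height e = 1 → {t : Q | Order.height t = 2 ∧ e ≤ t}.ncard = 2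
  vertex_link : ∀ v : Q, Order.height v = 0 → ∀ t t' : Q, Order.height t = 2 → Order.height t' = 2 →
    v ≤ t → v ≤ t' →
      Relation.EqvGen (fun s s' => ∃ e, Order.height e = 1 ∧ v ≤ e ∧ e ≤ s ∧ e ≤ s') t t'
  connected : ∀ x y : Q, Relation.EqvGen (fun u v => u ≤ v) x y
  euler : {v : Q | Order.height v = 0}.ncard + {t : Q | Order.height t = 2}.ncard =
    {e : Q | Order.height e = 1}.ncard + 2

/-- Planarity of a 2-dimensional subcomplex `L`: its triangles can be drawn, without overlap, as
triangles of some triangulated 2-sphere `Q`, so that triangles with a common edge still have that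
edge (with its endpoints) in common. Here `φ t x` is the position in `Q` of the face `x` of the
triangle `t`. Triangles that meet in a vertex only may be pulled apart there. -/
def Planar {P : Type} [PartialOrder P] (L : Set P) : Prop :=
  ∃ (Q : Type) (_ : PartialOrder Q), IsTriangulatedSphere Q ∧ ∃ φ : P → P → Q,
    (∀ t ∈ L, Order.height t = 2 → Order.height (φ t t) = 2 ∧
      ∀ x ≤ t, ∀ y ≤ t, (φ t x ≤ φ t y ↔ x ≤ y)) ∧
    (∀ t ∈ L, ∀ t' ∈ L, Order.height t = 2 → Order.height t' = 2 → t ≠ t' →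
      φ t t ≠ φ t' t' ∧
      ∀ e ∈ L, Order.height e = 1 → e ≤ t → e ≤ t' → ∀ x ≤ e, φ t x = φ t' x)

/-! ### Complexes glued from simplices -/

/-- A gluing among `N` disjoint `d`-simplices, each with vertex set `Fin (d + 1)`: the facet of
simplex `i` opposite to its vertex `a` is identified with the facet of simplex `j` opposite to its
vertex `π a`, where the vertex `v ≠ a` of the first goes to the vertex `π v` of the second. -/
structure Gluing (d N : ℕ) where
  i : Fin N
  j : Fin N
  a : Fin (d + 1)
  π : Equiv.Perm (Fin (d + 1))

/-- The two facets that are glued; `(k, c)` is the facet of simplex `k` opposite to vertex `c`. -/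
def Gluing.facets {d N : ℕ} (g : Gluing d N) : Set (Fin N × Fin (d + 1)) :=
  {(g.i, g.a), (g.j, g.π g.a)}

/-- The nonempty faces of the disjoint union of `N` `d`-simplices. -/
abbrev RawFace (d N : ℕ) : Type := Fin N × {S : Finset (Fin (d + 1)) // S.Nonempty}

/-- `y` is the face with which the raw face `x` is identified by a gluing in the list `L`. -/
def Step {d N : ℕ} (L : List (Gluing d N)) (x y : RawFace d N) : Prop :=
  ∃ g ∈ L, x.1 = g.i ∧ g.a ∉ x.2.1 ∧ y.1 = g.j ∧ y.2.1 = x.2.1.map g.π.toEmbedding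

/-- The faces of the complex obtained from `N` disjoint `d`-simplices by the gluings in `L`. -/
def Face {d N : ℕ} (L : List (Gluing d N)) : Type :=
  Quotient (Relation.EqvGen.setoid (Step L))

namespace Face

variable {d N : ℕ} {L : List (Gluing d N)}

/-- The face of the glued complex that is represented by a raw face. -/
def mk (L : List (Gluing d N)) (x : RawFace d N) : Face L :=
  Quotient.mk (Relation.EqvGen.setoid (Step L)) x

theorem mk_eq_iff {x y : RawFace d N} : mk L x = mk L y ↔ Relation.EqvGen (Step L) x y :=
  Quotient.eq (r := Relation.EqvGen.setoid (Step L))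

theorem card_eq {x y : RawFace d N} (h : Relation.EqvGen (Step L) x y) :
    x.2.1.card = y.2.1.card := by
  induction h with
  | rel x y h =>
    obtain ⟨g, -, -, -, -, h⟩ := h
    rw [h, Finset.card_map]
  | refl => rfl
  | symm _ _ _ ih => exact ih.symm
  | trans _ _ _ _ _ ih₁ ih₂ => exact ih₁.trans ih₂

theorem transport {x y : RawFace d N} (h : Relation.EqvGen (Step L) x y) :
    (∀ S : {S : Finset (Fin (d + 1)) // S.Nonempty}, S.1 ⊆ x.2.1 →
      ∃ T : {S : Finset (Fin (d + 1)) // S.Nonempty}, T.1 ⊆ y.2.1 ∧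
        Relation.EqvGen (Step L) (x.1, S) (y.1, T)) ∧
    (∀ T : {S : Finset (Fin (d + 1)) // S.Nonempty}, T.1 ⊆ y.2.1 →
      ∃ S : {S : Finset (Fin (d + 1)) // S.Nonempty}, S.1 ⊆ x.2.1 ∧
        Relation.EqvGen (Step L) (x.1, S) (y.1, T)) := by
  induction h with
  | rel x y h =>
    obtain ⟨g, hg, hi, ha, hj, hy⟩ := h
    refine ⟨fun S hS => ?_, fun T hT => ?_⟩
    · refine ⟨⟨S.1.map g.π.toEmbedding, S.2.map⟩, ?_, ?_⟩
      · rw [hy]; exact Finset.map_subset_map.2 hS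
      · exact .rel _ _ ⟨g, hg, hi, fun h => ha (hS h), hj, rfl⟩
    · have hT' : (T.1.map g.π.symm.toEmbedding).map g.π.toEmbedding = T.1 := by
        ext v; simp
      have hsub : T.1.map g.π.symm.toEmbedding ⊆ x.2.1 := by
        rw [← Finset.map_subset_map (f := g.π.toEmbedding), hT', ← hy]; exact hT
      exact ⟨⟨T.1.map g.π.symm.toEmbedding, T.2.map⟩, hsub,
        .rel _ _ ⟨g, hg, hi, fun h => ha (hsub h), hj, hT'.symm⟩⟩
  | refl x => exact ⟨fun S hS => ⟨S, hS, .refl _⟩, fun T hT => ⟨T, hT, .refl _⟩⟩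
  | symm x y _ ih =>
    refine ⟨fun S hS => ?_, fun T hT => ?_⟩
    · obtain ⟨T, hT, h⟩ := ih.2 S hS
      exact ⟨T, hT, h.symm⟩
    · obtain ⟨S, hS, h⟩ := ih.1 T hT
      exact ⟨S, hS, h.symm⟩
  | trans x y z _ _ ih₁ ih₂ =>
    refine ⟨fun S hS => ?_, fun T hT => ?_⟩
    · obtain ⟨T, hT, h⟩ := ih₁.1 S hS
      obtain ⟨U, hU, h'⟩ := ih₂.1 T hT
      exact ⟨U, hU, h.trans _ _ _ h'⟩
    · obtain ⟨S, hS, h⟩ := ih₂.2 T hT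
      obtain ⟨U, hU, h'⟩ := ih₁.2 S hS
      exact ⟨U, hU, h'.trans _ _ _ h⟩

/-- The face poset: `x ≤ y` if some simplex has faces `S ⊆ T` that represent `x` and `y`. -/
instance : PartialOrder (Face L) where
  le x y := ∃ (k : Fin N) (S T : {S : Finset (Fin (d + 1)) // S.Nonempty}),
    S.1 ⊆ T.1 ∧ mk L (k, S) = x ∧ mk L (k, T) = y
  le_refl x := by
    induction x using Quotient.inductionOn with
    | h x => exact ⟨x.1, x.2, x.2, subset_rfl, rfl, rfl⟩
  le_trans := by
    rintro x y z ⟨k, S, T, hST, rfl, rfl⟩ ⟨l, U, V, hUV, hy, rfl⟩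
    obtain ⟨S', hS', h⟩ := (transport (mk_eq_iff.1 hy)).2 S hST
    exact ⟨l, S', V, hS'.trans hUV, mk_eq_iff.2 h, rfl⟩
  le_antisymm := by
    rintro x y ⟨k, S, T, hST, rfl, rfl⟩ ⟨l, U, V, hUV, hy, hx⟩
    have h₁ := card_eq (mk_eq_iff.1 hy)
    have h₂ := card_eq (mk_eq_iff.1 hx)
    have h₃ := Finset.card_le_card hUV
    have h : S = T := Subtype.ext (Finset.eq_of_subset_of_card_le hST (by simp_all))
    rw [h]

/-- The quotient map from a complex to the one obtained from it by one more gluing. -/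
def push (g : Gluing d N) : Face L → Face (g :: L) :=
  Quotient.lift (mk (g :: L)) fun x y (h : Relation.EqvGen (Step L) x y) => mk_eq_iff.2 <|
    Relation.EqvGen.mono (r := Step L) (p := Step (g :: L))
      (fun _ _ ⟨f, hf, h⟩ => ⟨f, List.mem_cons_of_mem g hf, h⟩) x y h

end Face

/-- The faces, in the glued complex, of the facet of simplex `k` opposite to its vertex `c`. -/
def facetFaces {d N : ℕ} (L : List (Gluing d N)) (k : Fin N) (c : Fin (d + 1)) : Set (Face L) :=
  {x | ∃ S : {S : Finset (Fin (d + 1)) // S.Nonempty}, c ∉ S.1 ∧ Face.mk L (k, S) = x}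

/-- A tree of `N` `d`-simplices: each facet is glued at most once, and the dual graph is a tree,
that is, connected with `N - 1` edges. -/
def IsTreeOfSimplices {d N : ℕ} (T : List (Gluing d N)) : Prop :=
  T.length + 1 = N ∧ T.Pairwise (fun g h => Disjoint g.facets h.facets) ∧
    (SimpleGraph.fromRel fun k l : Fin N => ∃ g ∈ T, g.i = k ∧ g.j = l).Connected

/-- The gluing `g` is a 2-LC gluing in the boundary of the complex given by `L`: it identifies two
different facets, not used by earlier gluings, whose intersection has dimension at least `d - 3`,
and the result is again a pseudomanifold. -/
structure IsTwoLCGluing {d N : ℕ} (L : List (Gluing d N)) (g : Gluing d N) : Prop where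
  ne : (g.i, g.a) ≠ (g.j, g.π g.a)
  free : ∀ h ∈ L, Disjoint g.facets h.facets
  meet : ∃ δ ∈ facetFaces L g.i g.a ∩ facetFaces L g.j (g.π g.a), Order.height δ + 3 = d
  pseudomanifold : IsPseudomanifold d (Face (g :: L))

/-- The 2-LC gluings that are allowed for quasimanifolds. -/
structure IsQuasiGluing {d N : ℕ} (L : List (Gluing d N)) (g : Gluing d N) : Prop
    extends IsTwoLCGluing L g where
  /-- orientable with respect to the involved links of `(d-3)`-faces -/
  orientable : ∀ δ ∈ facetFaces (g :: L) g.i g.a, Order.height δ + 3 = d → Orientable (link δ)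
  /-- planar with respect to the involved links of `(d-3)`-faces -/
  planar : ∀ δ ∈ facetFaces (g :: L) g.i g.a, Order.height δ + 3 = d → Planar (link δ)
  /-- Impact only on the boundaries of links: if `δ` and `δ'` are equal or become equal, then the
  map from the disjoint union of their links to the link in the new complex identifies two different
  elements only when both are boundary faces of their links. -/
  boundary_only : ∀ δ δ' x y : Face L, Order.height δ + 3 = d → Order.height δ' + 3 = d →
    x ∈ link δ → y ∈ link δ' → Face.push g δ = Face.push g δ' → Face.push g x = Face.push g y →
      (δ, x) ≠ (δ', y) → x ∈ boundary (link δ) ∧ y ∈ boundary (link δ')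
  /-- no identification between distinct connected components of the boundary of a link -/
  component : ∀ δ x y : Face L, Order.height δ + 3 = d →
    x ∈ boundary (link δ) → y ∈ boundary (link δ) → Face.push g x = Face.push g y →
      SameComponent (boundary (link δ)) x y

/-- The complexes obtainable from a tree of simplices by successive allowed gluings. -/
inductive QuasiConstructible {d N : ℕ} : List (Gluing d N) → Prop
  | tree {T : List (Gluing d N)} : IsTreeOfSimplices T → QuasiConstructible T
  | glue {L : List (Gluing d N)} {g : Gluing d N} :
      QuasiConstructible L → IsQuasiGluing L g → QuasiConstructible (g :: L)

/-- `L` presents a 2-LC `d`-quasimanifold with `N` facets: moreover, any two `(d-1)`-faces that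
share an interior edge of the link of a `(d-3)`-face are glued together. -/
structure IsTwoLCQuasimanifold {d N : ℕ} (L : List (Gluing d N)) : Prop where
  constructible : QuasiConstructible L
  glued : ∀ δ e F F' : Face L, Order.height δ + 3 = d →
    e ∈ link δ → Order.height e = 1 → e ∉ boundary (link δ) →
    Order.height F + 1 = d → Order.height F' + 1 = d →
    δ ≤ F → e ≤ F → δ ≤ F' → e ≤ F' → F = F'

/-- Two quasimanifolds are combinatorially isomorphic if their face posets are isomorphic. -/
def combinatorialIso (d N : ℕ) : Setoid {L : List (Gluing d N) // IsTwoLCQuasimanifold L} where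
  r L L' := Nonempty (Face L.1 ≃o Face L'.1)
  iseqv :=
    { refl := fun _ => ⟨OrderIso.refl _⟩
      symm := fun ⟨f⟩ => ⟨f.symm⟩
      trans := fun ⟨f⟩ ⟨g⟩ => ⟨f.trans g⟩ }

/-- The combinatorially distinct 2-LC `d`-quasimanifolds with `N` facets. -/
def QuasimanifoldType (d N : ℕ) : Type := Quotient (combinatorialIso d N)

/-!
The gluings of a 2-LC quasimanifold can be recovered from little data. Let `T` be the gluings of the
tree of simplices. Every other gluing `g` is made when its two facets share a `(d-3)`-face `δ`;
in the link of `δ` the two facets are two sides of triangles, and `g` is determined by this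
pair of sides. The side is *marked* in both facets. What has to be counted is, for a given tree
and given marks, the number of sets of gluings, the *completions*, that agree with them
(`Good`, `card_good_le`).

Consider the links of all `(d-3)`-faces at once, as a set of triangles, three sides each, of which
some have been glued. The boundary of a component of this partially glued surface is a collection of
*contours*, cyclic lists of sides. When a known gluing joins two components, two contours merge into
one (`exists_merge`). When two marked sides in one contour are glued, the contour splits into two,
by orientability (`Fits.exists_innermost`, `Describes.split`). Sides in different contours of one
component are never glued, so pairs in a contour are not linked: the link can be drawn on a sphere,
on which every cycle modulo 2 bounds (`IsTriangulatedSphere.exists_filling`), so a contour separates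
the two triangles at every glued pair that it passes through just once (`exists_linkModel`,
`Fits.eq_of_resolved`). After a merger of two resolved contours, the only pairs still to be found
are those that join the two arcs of the new contour. They are nested, and revealing the innermost
pair splits off a resolved contour and leaves two shorter arcs.

In this way the possible completions form a branching process, and their number is bounded by
a weight that is the product of `8 ^ n * 8 / (n + 2) ^ 3` for every contour with `n` marked sides
and of `3 / 2 * (m + 2) ^ 3 / 8` for every component with `m > 0` marked sides. This weight does not
increase under mergers (`merge_weight_le`) and it pays for all choices of an innermost pair
(`arcWeight_ge`), so it bounds the number of completions (`card_completions_le`). In the beginning,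
when the components are single triangles, it is at most `12` to the power of the number of marks.

It remains to count the trees and the marks. After a relabelling of simplices and vertices, which
does not change the face poset, the simplices of a tree are numbered breadth first, and the tree is
determined by the set of facets to which simplices are attached, a subset of `d * N + 1` facets
(`IsTreeOfSimplices.exists_code`). The tree uses `2 * (N - 1)` facets; every other facet is unmarked
or has one of `d.choose 2` marks, which accounts for a factor `1 + 12 * d.choose 2`. Hence there are
at most `2 ^ (d * N + 1) * (1 + 12 * d.choose 2) ^ ((d - 1) * N + 2)` classes
(`card_quasimanifoldType_le`), which is eventually less than the bound. For `d = 3` the margin is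
narrow: `2 ^ 3 * 37 ^ 2 = 10952`, while `2 ^ 13.5` is about `11585`.
-/

/-! ### Weights of contours and components -/

/-- The weight of a contour with `n` marked sides. The factor `8 / (n + 2) ^ 3` makes the weights
decrease, relative to `8 ^ n`, so fast that the convolution in `sum_contourWeight_le` is small. -/
noncomputable def contourWeight (n : ℕ) : ℝ := 8 ^ n * (8 / ((n : ℝ) + 2) ^ 3)

/-- The weight of a component with `m` marked sides. It compensates the cubic factor in
`contourWeight` and the factor `3 / 2` in `arcWeight`, which are lost when two components merge. -/
noncomputable def componentWeight (m : ℕ) : ℝ :=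
  if m = 0 then 1 else 3 / 2 * (((m : ℝ) + 2) ^ 3 / 8)

/-- The weight of a contour that consists of two arcs with `a` and `b` marked sides, where
pairs joining the two arcs are still to be determined. -/
noncomputable def arcWeight (a b : ℕ) : ℝ :=
  if a = 0 ∨ b = 0 then contourWeight (a + b) else 3 / 2 * contourWeight (a + b)

theorem contourWeight_pos (n : ℕ) : 0 < contourWeight n := by
  unfold contourWeight; positivity

theorem one_le_contourWeight (n : ℕ) : 1 ≤ contourWeight n := by
  have h : ∀ n : ℕ, n + 2 ≤ 2 ^ (n + 1) := by
    intro n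
    induction n with
    | zero => norm_num
    | succ n ih => rw [pow_succ]; omega
  have h1 : ((n : ℝ) + 2) ≤ 2 ^ (n + 1) := by exact_mod_cast h n
  have h2 : ((n : ℝ) + 2) ^ 3 ≤ 8 ^ n * 8 := by
    calc ((n : ℝ) + 2) ^ 3 ≤ (2 ^ (n + 1)) ^ 3 := by gcongr
      _ = 8 ^ n * 8 := by rw [← pow_mul, mul_comm, pow_mul]; norm_num [pow_succ]
  unfold contourWeight
  rw [mul_div_assoc', le_div_iff₀ (by positivity)]
  linarith

theorem one_le_componentWeight (m : ℕ) : 1 ≤ componentWeight m := by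
  unfold componentWeight
  split_ifs
  · exact le_rfl
  · have : (8 : ℝ) ≤ ((m : ℝ) + 2) ^ 3 := by
      have h : (2 : ℝ) ≤ (m : ℝ) + 2 := by simp
      calc (8 : ℝ) = 2 ^ 3 := by norm_num
        _ ≤ _ := by gcongr
    linarith

theorem arcWeight_pos (a b : ℕ) : 0 < arcWeight a b := by
  have := contourWeight_pos (a + b)
  unfold arcWeight; split_ifs <;> positivity

theorem arcWeight_le (a b : ℕ) : arcWeight a b ≤ 3 / 2 * contourWeight (a + b) := by
  have := contourWeight_pos (a + b)
  unfold arcWeight; split_ifs <;> linarith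

/-- A component with a single contour, such as a triangle, weighs at most `12 ^ n`, where `n` is the
number of its marked sides. -/
theorem contourWeight_mul_componentWeight_le (n : ℕ) :
    contourWeight n * componentWeight n ≤ 12 ^ n := by
  unfold contourWeight componentWeight
  split_ifs with h
  · subst h; norm_num
  · have h1 : (8 : ℝ) ^ n * (8 / ((n : ℝ) + 2) ^ 3) * (3 / 2 * (((n : ℝ) + 2) ^ 3 / 8)) =
        3 / 2 * 8 ^ n := by field_simp
    have h2 : (3 / 2 : ℝ) ≤ (3 / 2) ^ n := le_self_pow₀ (by norm_num) h
    rw [h1]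
    calc (3 / 2 : ℝ) * 8 ^ n ≤ (3 / 2) ^ n * 8 ^ n := by gcongr
      _ = 12 ^ n := by rw [← mul_pow]; norm_num

/-- Two contours with `a` and `b` marked sides, in components with `m₁` and `m₂` marked sides, can
be merged into a contour with two arcs without increasing the weight. -/
theorem merge_weight_le {a b m₁ m₂ : ℕ} (ha : a ≤ m₁) (hb : b ≤ m₂) :
    arcWeight a b * componentWeight (m₁ + m₂) ≤
      contourWeight a * contourWeight b * (componentWeight m₁ * componentWeight m₂) := by
  have hsub : componentWeight (m₁ + m₂) ≤ componentWeight m₁ * componentWeight m₂ := by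
    rcases Nat.eq_zero_or_pos m₁ with h | h₁
    · subst h; simp [componentWeight]
    rcases Nat.eq_zero_or_pos m₂ with h | h₂
    · subst h; simp [componentWeight]
    unfold componentWeight
    rw [if_neg (by omega), if_neg (by omega), if_neg (by omega)]
    have hp : (m₁ : ℝ) + m₂ + 2 ≤ (m₁ + 2) * (m₂ + 2) / 2 := by
      nlinarith [Nat.cast_nonneg (α := ℝ) m₁, Nat.cast_nonneg (α := ℝ) m₂,
        mul_nonneg (Nat.cast_nonneg (α := ℝ) m₁) (Nat.cast_nonneg (α := ℝ) m₂)]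
    have hp3 : ((m₁ : ℝ) + m₂ + 2) ^ 3 ≤ ((m₁ + 2) * (m₂ + 2) / 2) ^ 3 := by gcongr
    have : (0 : ℝ) ≤ ((m₁ : ℝ) + 2) ^ 3 * ((m₂ : ℝ) + 2) ^ 3 := by positivity
    push_cast
    have e : (((m₁ : ℝ) + 2) * (m₂ + 2) / 2) ^ 3 =
        ((m₁ : ℝ) + 2) ^ 3 * ((m₂ : ℝ) + 2) ^ 3 / 8 := by ring
    nlinarith
  have hmul : ∀ x y : ℕ, x = 0 ∨ y = 0 →
      contourWeight (x + y) = contourWeight x * contourWeight y := by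
    rintro x y (rfl | rfl) <;> norm_num [contourWeight]
  by_cases h : a = 0 ∨ b = 0
  · rw [arcWeight, if_pos h, hmul a b h]
    have := contourWeight_pos a
    have := contourWeight_pos b
    gcongr
  · rw [arcWeight, if_neg h]
    push Not at h
    unfold contourWeight componentWeight
    rw [if_neg (by omega), if_neg (by omega), if_neg (by omega)]
    push_cast
    have hA : (a : ℝ) ≤ m₁ := by exact_mod_cast ha
    have hB : (b : ℝ) ≤ m₂ := by exact_mod_cast hb
    have ha0 : (0 : ℝ) ≤ a := by positivity
    have hb0 : (0 : ℝ) ≤ b := by positivity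
    -- the quotient `(x + y + 2) / ((x + 2) * (y + 2))` decreases in `x` and in `y`
    have key : ((m₁ : ℝ) + m₂ + 2) * ((a + 2) * (b + 2)) ≤
        ((a : ℝ) + b + 2) * ((m₁ + 2) * (m₂ + 2)) := by
      have h1 : ((m₁ : ℝ) + m₂ + 2) * (a + 2) ≤ ((a : ℝ) + m₂ + 2) * (m₁ + 2) := by
        nlinarith [mul_nonneg (sub_nonneg.2 hA) (hb0.trans hB)]
      have h2 : ((a : ℝ) + m₂ + 2) * (b + 2) ≤ ((a : ℝ) + b + 2) * (m₂ + 2) := by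
        nlinarith [mul_nonneg (sub_nonneg.2 hB) ha0]
      calc ((m₁ : ℝ) + m₂ + 2) * ((a + 2) * (b + 2))
          = (((m₁ : ℝ) + m₂ + 2) * (a + 2)) * (b + 2) := by ring
        _ ≤ (((a : ℝ) + m₂ + 2) * (m₁ + 2)) * (b + 2) := by gcongr
        _ = (((a : ℝ) + m₂ + 2) * (b + 2)) * (m₁ + 2) := by ring
        _ ≤ (((a : ℝ) + b + 2) * (m₂ + 2)) * (m₁ + 2) := by gcongr
        _ = _ := by ring
    have key3 : (((m₁ : ℝ) + m₂ + 2) * ((a + 2) * (b + 2))) ^ 3 ≤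
        (((a : ℝ) + b + 2) * ((m₁ + 2) * (m₂ + 2))) ^ 3 := by gcongr
    have e1 : 3 / 2 * ((8 : ℝ) ^ (a + b) * (8 / ((a : ℝ) + b + 2) ^ 3)) *
        (3 / 2 * (((m₁ : ℝ) + m₂ + 2) ^ 3 / 8)) =
        9 / 4 * 8 ^ (a + b) * (((m₁ : ℝ) + m₂ + 2) ^ 3 / ((a : ℝ) + b + 2) ^ 3) := by
      field_simp; norm_num
    have e2 : (8 : ℝ) ^ a * (8 / ((a : ℝ) + 2) ^ 3) * (8 ^ b * (8 / ((b : ℝ) + 2) ^ 3)) *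
        (3 / 2 * (((m₁ : ℝ) + 2) ^ 3 / 8) * (3 / 2 * (((m₂ : ℝ) + 2) ^ 3 / 8))) =
        9 / 4 * 8 ^ (a + b) *
          ((((m₁ : ℝ) + 2) * (m₂ + 2)) ^ 3 / (((a : ℝ) + 2) * (b + 2)) ^ 3) := by
      rw [pow_add]; field_simp; norm_num
    rw [e1, e2]
    refine mul_le_mul_of_nonneg_left ?_ (by positivity)
    rw [div_le_div_iff₀ (by positivity) (by positivity), ← mul_pow, ← mul_pow]
    calc _ ≤ _ := key3
      _ = _ := by ring

theorem sum_range_range_add_le (g : ℕ → ℝ) (hg : ∀ k, 0 ≤ g k) (a b : ℕ) :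
    ∑ i ∈ Finset.range a, ∑ j ∈ Finset.range b, g (i + j) ≤
      ∑ k ∈ Finset.range (a + b - 1), ((k : ℝ) + 1) * g k := by
  rw [← Finset.sum_product',
    ← Finset.sum_fiberwise_of_maps_to (t := Finset.range (a + b - 1)) (g := fun p => p.1 + p.2)]
  · refine Finset.sum_le_sum fun k _ => ?_
    have hsub : (Finset.range a ×ˢ Finset.range b).filter (fun p => p.1 + p.2 = k) ⊆
        Finset.HasAntidiagonal.antidiagonal k := by
      intro p hp
      exact Finset.HasAntidiagonal.mem_antidiagonal.2 (Finset.mem_filter.1 hp).2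
    calc _ = ∑ p ∈ (Finset.range a ×ˢ Finset.range b).filter (fun p => p.1 + p.2 = k), g k :=
          Finset.sum_congr rfl fun p hp => by rw [(Finset.mem_filter.1 hp).2]
      _ ≤ ∑ p ∈ Finset.HasAntidiagonal.antidiagonal k, g k :=
          Finset.sum_le_sum_of_subset_of_nonneg hsub fun _ _ _ => hg k
      _ = _ := by rw [Finset.sum_const, Finset.Nat.card_antidiagonal, nsmul_eq_mul]; push_cast; ring
  · intro p hp
    simp only [Finset.mem_product, Finset.mem_range] at hp ⊢
    omega

/-- The contribution of `1 / u` to the expansion of `(1 / u + 1 / u') ^ 3` when `u + u' = s`. -/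
noncomputable def cubePart (s u : ℝ) : ℝ := 1 / u ^ 3 + 3 / s / u ^ 2 + 6 / s ^ 2 / u

/-- The three summands of `cubePart` contribute at most `1 / 2`, `21 / 50` and `1 / 3`. -/
theorem sum_cubePart_le (m : ℕ) :
    ∑ k ∈ Finset.range m, ((k : ℝ) + 1) * cubePart ((m : ℝ) + 3) ((k : ℝ) + 2) ≤ 4 / 3 := by
  have hA : ∀ m : ℕ, ∑ k ∈ Finset.range m, ((k : ℝ) + 1) / ((k : ℝ) + 2) ^ 3 ≤
      1 / 2 - 1 / ((m : ℝ) + 2) := by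
    intro m
    induction m with
    | zero => norm_num
    | succ m ih =>
      rw [Finset.sum_range_succ]
      have : ((m : ℝ) + 1) / ((m : ℝ) + 2) ^ 3 ≤ 1 / ((m : ℝ) + 2) - 1 / ((m : ℝ) + 1 + 2) := by
        rw [div_sub_div _ _ (by positivity) (by positivity),
          div_le_div_iff₀ (by positivity) (by positivity)]
        nlinarith [Nat.cast_nonneg (α := ℝ) m, sq_nonneg ((m : ℝ) + 2)]
      push_cast
      linarith
  have hB : ∀ m : ℕ, ∑ k ∈ Finset.range m, ((k : ℝ) + 1) / ((k : ℝ) + 2) ^ 2 ≤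
      7 / 50 * ((m : ℝ) + 3) := by
    intro m
    induction m with
    | zero => norm_num
    | succ m ih =>
      by_cases hm : m < 4
      · interval_cases m <;> norm_num [Finset.sum_range_succ]
      · rw [Finset.sum_range_succ]
        have h4 : (4 : ℝ) ≤ m := by exact_mod_cast not_lt.1 hm
        have : ((m : ℝ) + 1) / ((m : ℝ) + 2) ^ 2 ≤ 7 / 50 := by
          rw [div_le_div_iff₀ (by positivity) (by positivity)]
          nlinarith
        push_cast
        linarith
  have hC : ∀ m : ℕ, ∑ k ∈ Finset.range m, ((k : ℝ) + 1) / ((k : ℝ) + 2) ≤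
      ((m : ℝ) + 3) ^ 2 / 18 := by
    intro m
    induction m with
    | zero => norm_num
    | succ m ih =>
      by_cases hm : m < 6
      · interval_cases m <;> norm_num [Finset.sum_range_succ]
      · rw [Finset.sum_range_succ]
        have h6 : (6 : ℝ) ≤ m := by exact_mod_cast not_lt.1 hm
        have : ((m : ℝ) + 1) / ((m : ℝ) + 2) ≤ 1 := by
          rw [div_le_one (by positivity)]; linarith
        push_cast
        nlinarith
  have hs : (0 : ℝ) < (m : ℝ) + 3 := by positivity
  have e : ∑ k ∈ Finset.range m, ((k : ℝ) + 1) * cubePart ((m : ℝ) + 3) ((k : ℝ) + 2) =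
      ∑ k ∈ Finset.range m, ((k : ℝ) + 1) / ((k : ℝ) + 2) ^ 3 +
      3 / ((m : ℝ) + 3) * ∑ k ∈ Finset.range m, ((k : ℝ) + 1) / ((k : ℝ) + 2) ^ 2 +
      6 / ((m : ℝ) + 3) ^ 2 * ∑ k ∈ Finset.range m, ((k : ℝ) + 1) / ((k : ℝ) + 2) := by
    rw [Finset.mul_sum, Finset.mul_sum, ← Finset.sum_add_distrib, ← Finset.sum_add_distrib]
    refine Finset.sum_congr rfl fun k _ => ?_
    unfold cubePart
    field_simp
  rw [e]
  have h1 : ∑ k ∈ Finset.range m, ((k : ℝ) + 1) / ((k : ℝ) + 2) ^ 3 ≤ 1 / 2 :=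
    (hA m).trans (by simp; positivity)
  have h2 : 3 / ((m : ℝ) + 3) * ∑ k ∈ Finset.range m, ((k : ℝ) + 1) / ((k : ℝ) + 2) ^ 2 ≤
      21 / 50 := by
    calc _ ≤ 3 / ((m : ℝ) + 3) * (7 / 50 * ((m : ℝ) + 3)) := by gcongr; exact hB m
      _ = _ := by field_simp; norm_num
  have h3 : 6 / ((m : ℝ) + 3) ^ 2 * ∑ k ∈ Finset.range m, ((k : ℝ) + 1) / ((k : ℝ) + 2) ≤
      1 / 3 := by
    calc _ ≤ 6 / ((m : ℝ) + 3) ^ 2 * (((m : ℝ) + 3) ^ 2 / 18) := by gcongr; exact hC m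
      _ = _ := by field_simp; norm_num
  linarith

theorem cube_add_inv {u v s : ℝ} (hu : 0 < u) (hv : 0 < v) (hs : u + v = s) :
    s ^ 3 / (u ^ 3 * v ^ 3) = cubePart s u + cubePart s v := by
  subst hs
  unfold cubePart
  have : u + v ≠ 0 := by positivity
  field_simp
  ring

/-- The choices of a pair that joins two arcs with `a` and `b` marked sides weigh at most a third of
the contour itself: the pair cuts off a contour with `i + j` marked sides. -/
theorem sum_contourWeight_le (a b : ℕ) :
    ∑ i ∈ Finset.range a, ∑ j ∈ Finset.range b,
      contourWeight (i + j) * contourWeight (a - 1 - i + (b - 1 - j)) ≤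
        1 / 3 * contourWeight (a + b) := by
  set s : ℝ := (a : ℝ) + b + 2 with hs
  have hs0 : 0 < s := by positivity
  -- with `u = i + j + 2` and `v = s - u`, the term is `8 ^ (a + b) / (u * v) ^ 3`, as the two sides
  -- of the pair themselves are no longer counted
  have hterm : ∀ i ∈ Finset.range a, ∀ j ∈ Finset.range b,
      contourWeight (i + j) * contourWeight (a - 1 - i + (b - 1 - j)) =
        8 ^ (a + b) / s ^ 3 * (cubePart s ((i + j : ℕ) + 2) +
          cubePart s ((a - 1 - i + (b - 1 - j) : ℕ) + 2)) := by
    intro i hi j hj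
    rw [Finset.mem_range] at hi hj
    have hsum : i + j + (a - 1 - i + (b - 1 - j)) + 2 = a + b := by omega
    rw [← cube_add_inv (by positivity) (by positivity)]
    · unfold contourWeight
      rw [← hsum]
      field_simp
      rw [pow_add, pow_add]
      norm_num [pow_add]
      ring
    · rw [hs]
      have : ((i + j + (a - 1 - i + (b - 1 - j)) + 2 : ℕ) : ℝ) = ((a + b : ℕ) : ℝ) := by rw [hsum]
      push_cast at this ⊢
      linarith
  rw [Finset.sum_congr rfl fun i hi => Finset.sum_congr rfl fun j hj => hterm i hi j hj]
  simp_rw [← Finset.mul_sum, Finset.sum_add_distrib]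
  -- the two parts have the same sum, by the symmetry between the two new contours
  have hrefl : ∑ i ∈ Finset.range a, ∑ j ∈ Finset.range b,
      cubePart s ((a - 1 - i + (b - 1 - j) : ℕ) + 2) =
      ∑ i ∈ Finset.range a, ∑ j ∈ Finset.range b, cubePart s ((i + j : ℕ) + 2) := by
    rw [Finset.sum_range_reflect
      (fun i => ∑ j ∈ Finset.range b, cubePart s ((i + (b - 1 - j) : ℕ) + 2)) a]
    exact Finset.sum_congr rfl fun i _ =>
      Finset.sum_range_reflect (fun j => cubePart s ((i + j : ℕ) + 2)) b
  rw [hrefl]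
  have hle : ∑ i ∈ Finset.range a, ∑ j ∈ Finset.range b, cubePart s ((i + j : ℕ) + 2) ≤ 4 / 3 := by
    rcases Nat.eq_zero_or_pos a with rfl | ha
    · norm_num
    refine (sum_range_range_add_le (fun k => cubePart s ((k : ℕ) + 2))
      (fun k => by unfold cubePart; positivity) a b).trans ?_
    have := sum_cubePart_le (a + b - 1)
    have e : ((a + b - 1 : ℕ) : ℝ) + 3 = s := by
      rw [Nat.cast_sub (by omega)]; push_cast; rw [hs]; ring
    rwa [e] at this
  calc _ ≤ 8 ^ (a + b) / s ^ 3 * (4 / 3 + 4 / 3) := by gcongr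
    _ = 1 / 3 * contourWeight (a + b) := by
      unfold contourWeight; rw [hs]; push_cast; field_simp; norm_num

/-- The weight of two arcs pays for the case that no pair joins them, and for every choice of the
innermost pair that does. -/
theorem arcWeight_ge (a b : ℕ) :
    contourWeight (a + b) + ∑ i ∈ Finset.range a, ∑ j ∈ Finset.range b,
      contourWeight (i + j) * arcWeight (a - 1 - i) (b - 1 - j) ≤ arcWeight a b := by
  by_cases h : a = 0 ∨ b = 0
  · rw [arcWeight, if_pos h]
    rcases h with rfl | rfl <;> simp
  · have h1 : ∑ i ∈ Finset.range a, ∑ j ∈ Finset.range b,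
        contourWeight (i + j) * arcWeight (a - 1 - i) (b - 1 - j) ≤
        ∑ i ∈ Finset.range a, ∑ j ∈ Finset.range b,
        3 / 2 * (contourWeight (i + j) * contourWeight (a - 1 - i + (b - 1 - j))) := by
      refine Finset.sum_le_sum fun i _ => Finset.sum_le_sum fun j _ => ?_
      have := arcWeight_le (a - 1 - i) (b - 1 - j)
      have := contourWeight_pos (i + j)
      nlinarith
    simp_rw [← Finset.mul_sum] at h1
    have := sum_contourWeight_le a b
    rw [arcWeight, if_neg h]
    linarith

/-! ### Sides of link triangles -/

/-- An oriented side of a triangle in the link of a `(d-3)`-face of the simplex `k`. The triangle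
has the vertices `a`, `b`, `c`, the `(d-3)`-face is spanned by the other vertices, and the side runs
from `b` to `c`. The face of the simplex that is opposite to `a` contains it. -/
@[ext]
structure Side (d N : ℕ) where
  k : Fin N
  a : Fin (d + 1)
  b : Fin (d + 1)
  c : Fin (d + 1)
  hab : a ≠ b
  hac : a ≠ c
  hbc : b ≠ c

namespace Side

variable {d N : ℕ}

/-- The facet of the simplex that contains the `(d-3)`-face and the side. -/
def facet (s : Side d N) : Fin N × Fin (d + 1) := (s.k, s.a)

/-- The triangle, given by its simplex and its vertices. -/
def tri (s : Side d N) : Fin N × Finset (Fin (d + 1)) := (s.k, {s.a, s.b, s.c})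

/-- The side without its orientation. -/
def edge (s : Side d N) : Fin N × Fin (d + 1) × Finset (Fin (d + 1)) := (s.k, s.a, {s.b, s.c})

/-- The side with the opposite orientation. -/
def rev (s : Side d N) : Side d N := ⟨s.k, s.a, s.c, s.b, s.hac, s.hab, s.hbc.symm⟩

/-- The next side of the same triangle. -/
def rot (s : Side d N) : Side d N := ⟨s.k, s.b, s.c, s.a, s.hbc, s.hab.symm, s.hac.symm⟩

@[simp] theorem rev_rev (s : Side d N) : s.rev.rev = s := rfl
@[simp] theorem facet_rev (s : Side d N) : s.rev.facet = s.facet := rfl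

@[simp] theorem tri_rev (s : Side d N) : s.rev.tri = s.tri := by
  simp only [tri, rev, Prod.mk.injEq, true_and]
  rw [Finset.pair_comm]

@[simp] theorem edge_rev (s : Side d N) : s.rev.edge = s.edge := by
  simp only [edge, rev, Prod.mk.injEq, true_and]
  rw [Finset.pair_comm]

@[simp] theorem tri_rot (s : Side d N) : s.rot.tri = s.tri := by
  simp only [tri, rot, Prod.mk.injEq, true_and]
  ext x; simp; tauto

theorem edge_eq_iff {s t : Side d N} : s.edge = t.edge ↔ s = t ∨ s = t.rev := by
  constructor
  · intro h
    simp only [edge, Prod.mk.injEq] at h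
    obtain ⟨hk, ha, h⟩ := h
    have h' : ({s.b, s.c} : Set (Fin (d + 1))) = {t.b, t.c} := by
      have := congrArg (fun F : Finset (Fin (d + 1)) => (F : Set (Fin (d + 1)))) h
      simpa using this
    rw [Set.pair_eq_pair_iff] at h'
    rcases h' with ⟨hb, hc⟩ | ⟨hb, hc⟩
    · exact .inl (Side.ext hk ha hb hc)
    · exact .inr (Side.ext hk ha hb hc)
  · rintro (rfl | rfl) <;> simp

theorem tri_eq_of_edge_eq {s t : Side d N} (h : s.edge = t.edge) : s.tri = t.tri := by
  rcases edge_eq_iff.1 h with rfl | rfl <;> simp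

theorem facet_eq_of_edge_eq {s t : Side d N} (h : s.edge = t.edge) : s.facet = t.facet := by
  rcases edge_eq_iff.1 h with rfl | rfl <;> simp

end Side

namespace Gluing

variable {d N : ℕ}

/-- The same gluing, read from the second facet to the first. -/
def symm (g : Gluing d N) : Gluing d N := ⟨g.j, g.i, g.π g.a, g.π.symm⟩

/-- The first of the two glued facets. -/
def src (g : Gluing d N) : Fin N × Fin (d + 1) := (g.i, g.a)

/-- The side with which a gluing identifies a side in its first facet. -/
def map (g : Gluing d N) (s : Side d N) : Side d N :=
  ⟨g.j, g.π s.a, g.π s.b, g.π s.c, g.π.injective.ne s.hab, g.π.injective.ne s.hac,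
    g.π.injective.ne s.hbc⟩

@[simp] theorem symm_symm (g : Gluing d N) : g.symm.symm = g := by
  simp [symm]

@[simp] theorem map_rev (g : Gluing d N) (s : Side d N) : g.map s.rev = (g.map s).rev := rfl

theorem facet_map {g : Gluing d N} {s : Side d N} (h : s.facet = g.src) :
    (g.map s).facet = g.symm.src := by
  simp only [Side.facet, src, Prod.mk.injEq] at h
  simp [Side.facet, map, src, symm, h.2]

theorem symm_map_map {g : Gluing d N} {s : Side d N} (h : s.facet = g.src) :
    g.symm.map (g.map s) = s := by
  simp only [Side.facet, src, Prod.mk.injEq] at h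
  ext <;> simp [map, symm, h.1]

theorem edge_map_congr {g : Gluing d N} {s t : Side d N} (h : s.edge = t.edge) :
    (g.map s).edge = (g.map t).edge := by
  rcases Side.edge_eq_iff.1 h with rfl | rfl <;> simp

theorem tri_map_congr {g : Gluing d N} {s t : Side d N} (h : s.tri = t.tri) :
    (g.map s).tri = (g.map t).tri := by
  have h' : ({s.a, s.b, s.c} : Finset (Fin (d + 1))) = {t.a, t.b, t.c} := congrArg Prod.snd h
  have := congrArg (Finset.image g.π) h'
  simp only [Finset.image_insert, Finset.image_singleton] at this
  simp [Side.tri, map, this]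

end Gluing

section Core

variable {d N : ℕ}

/-- The side `s` is marked if `M` selects it (up to orientation) among the sides in its facet. -/
def Marked (M : Fin N × Fin (d + 1) → Option (Finset (Fin (d + 1)))) (s : Side d N) : Prop :=
  M s.facet = some {s.b, s.c}

theorem marked_congr {M : Fin N × Fin (d + 1) → Option (Finset (Fin (d + 1)))} {s t : Side d N}
    (h : s.edge = t.edge) : Marked M s ↔ Marked M t := by
  have h1 := Side.facet_eq_of_edge_eq h
  have h2 : ({s.b, s.c} : Finset (Fin (d + 1))) = {t.b, t.c} :=
    congrArg (fun e => e.2.2) h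
  rw [Marked, Marked, h1, h2]

theorem edge_eq_of_marked {M : Fin N × Fin (d + 1) → Option (Finset (Fin (d + 1)))}
    {s t : Side d N} (hs : Marked M s) (ht : Marked M t) (h : s.facet = t.facet) :
    s.edge = t.edge := by
  have h2 : ({s.b, s.c} : Finset (Fin (d + 1))) = {t.b, t.c} := by
    rw [Marked, h] at hs
    exact Option.some_injective _ (hs.symm.trans ht)
  simp only [Side.facet, Prod.mk.injEq] at h
  simp [Side.edge, h.1, h.2, h2]

/-- Two triangles with a common side that is glued by a gluing in `𝒦`. -/
def Adj (𝒦 : Set (Gluing d N)) (t t' : Fin N × Finset (Fin (d + 1))) : Prop :=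
  ∃ g ∈ 𝒦, ∃ s : Side d N, s.facet = g.src ∧ s.tri = t ∧ (g.map s).tri = t'

/-- A gluing in `𝒦` identifies the vertices `x` and `y`. -/
def VertexStep (𝒦 : Set (Gluing d N)) (x y : Fin N × Fin (d + 1)) : Prop :=
  ∃ g ∈ 𝒦, x.1 = g.i ∧ x.2 ≠ g.a ∧ y.1 = g.j ∧ y.2 = g.π x.2

/-- The list of sides is a walk from `p` to `q`, where `f` is the starting point of a side. -/
def Walk {V : Type} (f : Side d N → V) : V → List (Side d N) → V → Prop
  | p, [], q => p = q
  | p, s :: K, q => f s = p ∧ Walk f (f s.rev) K q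

theorem walk_append {V : Type} {f : Side d N → V} {K L : List (Side d N)} {p q : V} :
    Walk f p (K ++ L) q ↔ ∃ r, Walk f p K r ∧ Walk f r L q := by
  induction K generalizing p with
  | nil => simp [Walk]
  | cons s K ih => simp [Walk, ih, and_assoc]

theorem Walk.reverse {V : Type} {f : Side d N → V} {K : List (Side d N)} {p q : V}
    (h : Walk f p K q) : Walk f q (K.reverse.map Side.rev) p := by
  induction K generalizing p with
  | nil => exact h.symm
  | cons s K ih =>
    rw [List.reverse_cons, List.map_append, walk_append]
    exact ⟨_, ih h.2, rfl, h.1⟩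

open Classical in
/-- A planar oriented model of the link of a `(d-3)`-face: `C` is the set of triangles of the link,
`start` sends a side to its first endpoint, and `sgn` records whether the side runs along
the orientation of its triangle. Planarity enters through `jordan`: a closed walk separates
the triangles into two classes, and the triangles at a pair of glued sides are in different classes
exactly if the walk passes through one side of the pair but not through both. -/
structure LinkModel (G : Set (Gluing d N)) (C : Set (Fin N × Finset (Fin (d + 1)))) where
  V : Type
  start : Side d N → V
  sgn : Side d N → Prop
  closed : ∀ g ∈ G, ∀ s : Side d N, s.facet = g.src → s.tri ∈ C → (g.map s).tri ∈ C
  start_map : ∀ g ∈ G, ∀ s : Side d N, s.facet = g.src → s.tri ∈ C → start (g.map s) = start s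
  start_rot : ∀ s : Side d N, s.tri ∈ C → start s.rot = start s.rev
  sgn_rev : ∀ s : Side d N, s.tri ∈ C → (sgn s.rev ↔ ¬ sgn s)
  sgn_rot : ∀ s : Side d N, s.tri ∈ C → sgn s → sgn s.rot
  sgn_map : ∀ g ∈ G, ∀ s : Side d N, s.facet = g.src → s.tri ∈ C → (sgn (g.map s) ↔ ¬ sgn s)
  jordan : ∀ K : List (Side d N), (∀ s ∈ K, s.tri ∈ C) → (K.map Side.edge).Nodup →
    (∃ p, Walk start p K p) → ∃ A : Fin N × Finset (Fin (d + 1)) → ZMod 2,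
      ∀ g ∈ G, ∀ s : Side d N, s.facet = g.src → s.tri ∈ C →
        A s.tri + A (g.map s).tri =
          (if s.edge ∈ K.map Side.edge then 1 else 0) +
            (if (g.map s).edge ∈ K.map Side.edge then 1 else 0)

/-- The combinatorial properties of the set `G` of gluings of a 2-LC quasimanifold that are used for
counting. The gluings in `T` are those of the tree of simplices, and `M` marks, in both facets of
every other gluing, a side of the link of a `(d-3)`-face that the two facets share when they are
glued. The condition `local_gluing` replaces the order of construction: if `𝒦` contains `T` but not
all gluings, then some gluing outside `𝒦` joins two marked sides of triangles that are already
connected, within one link, by gluings in `𝒦`. -/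
structure Good (T : Set (Gluing d N)) (M : Fin N × Fin (d + 1) → Option (Finset (Fin (d + 1))))
    (G : Set (Gluing d N)) : Prop where
  symm : ∀ g ∈ G, g.symm ∈ G
  src_inj : ∀ g ∈ G, ∀ h ∈ G, g.src = h.src → g = h
  tree : T ⊆ G
  ne : ∀ g ∈ G, g.i ≠ g.j
  vertex_inj : ∀ k v w, Relation.EqvGen (VertexStep G) (k, v) (k, w) → v = w
  marked_map : ∀ g ∈ G, ∀ s : Side d N, s.facet = g.src → Marked M s → Marked M (g.map s)
  model : ∀ g ∈ G, ∀ s : Side d N, s.facet = g.src → Marked M s →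
    ∃ C, s.tri ∈ C ∧ Nonempty (LinkModel G C)
  local_gluing : ∀ 𝒦 ⊆ G, T ⊆ 𝒦 → (∀ g ∈ 𝒦, g.symm ∈ 𝒦) → 𝒦 ≠ G →
    ∃ g ∈ G, g ∉ 𝒦 ∧ ∃ s : Side d N, s.facet = g.src ∧ Marked M s ∧
      Relation.EqvGen (Adj 𝒦) s.tri (g.map s).tri

/-- The vertices of a `(d-3)`-face can be followed along its link: every vertex in the complement of
one triangle is identified with one in the complement of the other. -/
theorem Adj.transport {𝒦 : Set (Gluing d N)} {t t' : Fin N × Finset (Fin (d + 1))}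
    (h : Relation.EqvGen (Adj 𝒦) t t') :
    (∀ v ∉ t.2, ∃ w ∉ t'.2, Relation.EqvGen (VertexStep 𝒦) (t.1, v) (t'.1, w)) ∧
    (∀ w ∉ t'.2, ∃ v ∉ t.2, Relation.EqvGen (VertexStep 𝒦) (t.1, v) (t'.1, w)) := by
  induction h with
  | rel t t' h =>
    obtain ⟨g, hg, s, hs, rfl, rfl⟩ := h
    simp only [Side.facet, Gluing.src, Prod.mk.injEq] at hs
    refine ⟨fun v hv => ?_, fun w hw => ?_⟩
    · refine ⟨g.π v, ?_, .rel _ _ ⟨g, hg, hs.1, ?_, rfl, rfl⟩⟩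
      · simpa [Side.tri, Gluing.map] using hv
      · rintro rfl; simp [Side.tri, hs.2] at hv
    · refine ⟨g.π.symm w, ?_, .rel _ _ ⟨g, hg, hs.1, ?_, rfl, by simp⟩⟩
      · simpa [Side.tri, Gluing.map, Equiv.symm_apply_eq] using hw
      · intro h
        rw [Equiv.symm_apply_eq] at h
        simp [Side.tri, Gluing.map, hs.2, h] at hw
  | refl t => exact ⟨fun v hv => ⟨v, hv, .refl _⟩, fun v hv => ⟨v, hv, .refl _⟩⟩
  | symm t t' _ ih =>
    refine ⟨fun v hv => ?_, fun w hw => ?_⟩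
    · obtain ⟨w, hw, h⟩ := ih.2 v hv
      exact ⟨w, hw, h.symm⟩
    · obtain ⟨v, hv, h⟩ := ih.1 w hw
      exact ⟨v, hv, h.symm⟩
  | trans t t' t'' _ _ ih₁ ih₂ =>
    refine ⟨fun v hv => ?_, fun w hw => ?_⟩
    · obtain ⟨w, hw, h⟩ := ih₁.1 v hv
      obtain ⟨x, hx, h'⟩ := ih₂.1 w hw
      exact ⟨x, hx, h.trans _ _ _ h'⟩
    · obtain ⟨v, hv, h⟩ := ih₂.2 w hw
      obtain ⟨x, hx, h'⟩ := ih₁.2 v hv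
      exact ⟨x, hx, h'.trans _ _ _ h⟩

theorem eqvGen_vertexStep_mono {𝒦 G : Set (Gluing d N)} (h : 𝒦 ⊆ G) {x y : Fin N × Fin (d + 1)}
    (hxy : Relation.EqvGen (VertexStep 𝒦) x y) : Relation.EqvGen (VertexStep G) x y :=
  Relation.EqvGen.mono (fun _ _ ⟨g, hg, h'⟩ => ⟨g, h hg, h'⟩) x y hxy

theorem eqvGen_adj_mono {𝒦 G : Set (Gluing d N)} (h : 𝒦 ⊆ G)
    {x y : Fin N × Finset (Fin (d + 1))}
    (hxy : Relation.EqvGen (Adj 𝒦) x y) : Relation.EqvGen (Adj G) x y :=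
  Relation.EqvGen.mono (fun _ _ ⟨g, hg, h'⟩ => ⟨g, h hg, h'⟩) x y hxy

theorem LinkModel.mem_iff {G : Set (Gluing d N)} {C : Set (Fin N × Finset (Fin (d + 1)))}
    (m : LinkModel G C) (hG : ∀ g ∈ G, g.symm ∈ G) {t t' : Fin N × Finset (Fin (d + 1))}
    (h : Relation.EqvGen (Adj G) t t') : t ∈ C ↔ t' ∈ C := by
  induction h with
  | rel t t' h =>
    obtain ⟨g, hg, s, hs, rfl, rfl⟩ := h
    refine ⟨m.closed g hg s hs, fun h => ?_⟩
    have := m.closed _ (hG g hg) (g.map s) (Gluing.facet_map hs) h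
    rwa [Gluing.symm_map_map hs] at this
  | refl => exact Iff.rfl
  | symm _ _ _ ih => exact ih.symm
  | trans _ _ _ _ _ ih₁ ih₂ => exact ih₁.trans ih₂

/-- A gluing is determined by its effect on one side, if the `(d-3)`-faces whose links contain
the two glued sides have been identified before. -/
theorem Good.gluing_unique {T 𝒦 G G' : Set (Gluing d N)}
    {M : Fin N × Fin (d + 1) → Option (Finset (Fin (d + 1)))}
    (hG : Good T M G) (hG' : Good T M G') (h : 𝒦 ⊆ G) (h' : 𝒦 ⊆ G') {g g' : Gluing d N}
    (hg : g ∈ G) (hg' : g' ∈ G') {s s' : Side d N} (hs : s.facet = g.src) (hs' : s.facet = g'.src)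
    (hm : g.map s = s') (hm' : g'.map s = s') (hc : Relation.EqvGen (Adj 𝒦) s.tri s'.tri) :
    g = g' := by
  simp only [Side.facet, Gluing.src, Prod.mk.injEq] at hs hs'
  -- on the triangle the two gluings agree by assumption, and the remaining vertices are
  -- identified by earlier gluings
  have hπ : g.π = g'.π := by
    ext v
    by_cases hv : v ∈ s.tri.2
    · have h1 := hm.trans hm'.symm
      simp only [Gluing.map, Side.mk.injEq] at h1
      simp only [Side.tri, Finset.mem_insert, Finset.mem_singleton] at hv
      rcases hv with rfl | rfl | rfl
      · rw [h1.2.1]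
      · rw [h1.2.2.1]
      · rw [h1.2.2.2]
    · obtain ⟨w, -, hw⟩ := (Adj.transport hc).1 v hv
      have key : ∀ {H : Set (Gluing d N)} {f : Gluing d N}, Good T M H → 𝒦 ⊆ H → f ∈ H →
          s.k = f.i ∧ s.a = f.a → f.map s = s' → f.π v = w := by
        intro H f hH hsub hf hsf hmf
        apply hH.vertex_inj s'.k
        refine .trans _ (s.k, v) _ (.symm _ _ (.rel _ _ ⟨f, hf, hsf.1, ?_, ?_, rfl⟩))
          (eqvGen_vertexStep_mono hsub hw)
        · rintro rfl
          exact hv (by simp [Side.tri, hsf.2])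
        · rw [← hmf]; rfl
      rw [key hG h hg hs hm, key hG' h' hg' hs' hm']
  have hj : g.j = g'.j := by
    have := congrArg Side.k (hm.trans hm'.symm)
    exact this
  cases g; cases g'
  simp_all

end Core

/-! ### Contours of partially glued links -/

section Core

variable {d N : ℕ}

/-- A component of the partially glued links: its triangles, the number of marked sides of its
triangles (used only as a bound for the number of marked sides in each contour), and its contours,
that is, the cyclic lists of sides along its boundary. A cyclic list is encoded by a list with
an arbitrary starting point and direction. -/
structure Component (d N : ℕ) where
  tris : Set (Fin N × Finset (Fin (d + 1)))
  size : ℕ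
  contours : Multiset (List (Side d N))

/-- The unoriented sides in a multiset of contours. -/
def contourSides (C : Multiset (List (Side d N))) :
    Multiset (Fin N × Fin (d + 1) × Finset (Fin (d + 1))) :=
  C.bind fun K => (K.map Side.edge : List _)

/-- The unoriented sides in the contours of all components. -/
def sideSet (S : Multiset (Component d N)) :
    Multiset (Fin N × Fin (d + 1) × Finset (Fin (d + 1))) :=
  S.bind fun X => contourSides X.contours

@[simp] theorem contourSides_cons (K : List (Side d N)) (C : Multiset (List (Side d N))) :
    contourSides (K ::ₘ C) = (K.map Side.edge : List _) + contourSides C :=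
  Multiset.cons_bind _ _ _

@[simp] theorem contourSides_add (C C' : Multiset (List (Side d N))) :
    contourSides (C + C') = contourSides C + contourSides C' :=
  Multiset.add_bind _ _ _

@[simp] theorem sideSet_cons (X : Component d N) (S : Multiset (Component d N)) :
    sideSet (X ::ₘ S) = contourSides X.contours + sideSet S :=
  Multiset.cons_bind _ _ _

theorem mem_contourSides {C : Multiset (List (Side d N))}
    {e : Fin N × Fin (d + 1) × Finset (Fin (d + 1))} :
    e ∈ contourSides C ↔ ∃ K ∈ C, e ∈ K.map Side.edge := by
  simp [contourSides]

theorem mem_sideSet {S : Multiset (Component d N)}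
    {e : Fin N × Fin (d + 1) × Finset (Fin (d + 1))} :
    e ∈ sideSet S ↔ ∃ X ∈ S, ∃ K ∈ X.contours, e ∈ K.map Side.edge := by
  simp [sideSet, mem_contourSides]

open Classical in
/-- The number of marked sides in a contour. -/
noncomputable def markCount (M : Fin N × Fin (d + 1) → Option (Finset (Fin (d + 1))))
    (K : List (Side d N)) : ℕ :=
  (K.map Side.edge).countP fun e => M (e.1, e.2.1) = some e.2.2

variable {M : Fin N × Fin (d + 1) → Option (Finset (Fin (d + 1)))}

theorem markCount_append (K L : List (Side d N)) :
    markCount M (K ++ L) = markCount M K + markCount M L := by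
  simp [markCount]

theorem markCount_cons_of_marked {s : Side d N} (h : Marked M s) (K : List (Side d N)) :
    markCount M (s :: K) = markCount M K + 1 := by
  classical
  have h' : M (s.edge.1, s.edge.2.1) = some s.edge.2.2 := h
  rw [markCount, List.map_cons, List.countP_cons_of_pos (by simpa using h')]
  rfl

theorem markCount_cons_of_not {s : Side d N} (h : ¬ Marked M s) (K : List (Side d N)) :
    markCount M (s :: K) = markCount M K := by
  classical
  have h' : ¬ M (s.edge.1, s.edge.2.1) = some s.edge.2.2 := h
  rw [markCount, List.map_cons, List.countP_cons_of_neg (by simpa using h')]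
  rfl

theorem markCount_perm {K L : List (Side d N)} (h : (K.map Side.edge).Perm (L.map Side.edge)) :
    markCount M K = markCount M L := h.countP_eq _

/-- A marked side in a list is determined by the number of marked sides after it. -/
theorem splitting_unique {A₁ A₂ A₁' A₂' : List (Side d N)} {c c' : Side d N}
    (h : A₁ ++ c :: A₂ = A₁' ++ c' :: A₂') (hc : Marked M c) (hc' : Marked M c')
    (hA : markCount M A₂ = markCount M A₂') : A₁ = A₁' ∧ c = c' ∧ A₂ = A₂' := by
  induction A₁ generalizing A₁' with
  | nil =>
    cases A₁' with
    | nil => simpa using h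
    | cons x A₁' =>
      simp only [List.nil_append, List.cons_append, List.cons.injEq] at h
      rw [h.2, markCount_append, markCount_cons_of_marked hc'] at hA
      omega
  | cons x A₁ ih =>
    cases A₁' with
    | nil =>
      simp only [List.nil_append, List.cons_append, List.cons.injEq] at h
      rw [← h.2, markCount_append, markCount_cons_of_marked hc] at hA
      omega
    | cons y A₁' =>
      simp only [List.cons_append, List.cons.injEq] at h
      obtain ⟨h1, h2, h3⟩ := ih h.2
      exact ⟨by rw [h.1, h1], h2, h3⟩

theorem exists_last_of_exists {α : Type} {P : α → Prop} {A : List α} (h : ∃ x ∈ A, P x) :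
    ∃ A₁ c A₂, A = A₁ ++ c :: A₂ ∧ P c ∧ ∀ x ∈ A₂, ¬ P x := by
  induction A with
  | nil => simp at h
  | cons s K ih =>
    by_cases hK : ∃ x ∈ K, P x
    · obtain ⟨A₁, c, A₂, rfl, h1, h2⟩ := ih hK
      exact ⟨s :: A₁, c, A₂, rfl, h1, h2⟩
    · push Not at hK
      obtain ⟨x, hx, hP⟩ := h
      rcases List.mem_cons.1 hx with rfl | hx
      · exact ⟨[], x, K, rfl, hP, hK⟩
      · exact absurd hP (hK x hx)

/-- The weight of a component. -/
noncomputable def Component.weight (M : Fin N × Fin (d + 1) → Option (Finset (Fin (d + 1))))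
    (X : Component d N) : ℝ :=
  (X.contours.map fun K => contourWeight (markCount M K)).prod * componentWeight X.size

/-- The weight of a partially glued complex, an upper bound for the number of its completions. -/
noncomputable def totalWeight (M : Fin N × Fin (d + 1) → Option (Finset (Fin (d + 1))))
    (S : Multiset (Component d N)) : ℝ :=
  (S.map (Component.weight M)).prod

theorem one_le_prod_map {α : Type} (f : α → ℝ) (h : ∀ a, 1 ≤ f a) (s : Multiset α) :
    1 ≤ (s.map f).prod := by
  induction s using Multiset.induction with
  | empty => simp
  | cons a s ih =>
    rw [Multiset.map_cons, Multiset.prod_cons]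
    exact one_le_mul_of_one_le_of_one_le (h a) ih

theorem one_le_contours_prod (C : Multiset (List (Side d N))) :
    1 ≤ (C.map fun K => contourWeight (markCount M K)).prod :=
  one_le_prod_map _ (fun _ => one_le_contourWeight _) C

theorem one_le_totalWeight (S : Multiset (Component d N)) : 1 ≤ totalWeight M S :=
  one_le_prod_map _ (fun _ => one_le_mul_of_one_le_of_one_le (one_le_contours_prod _)
    (one_le_componentWeight _)) S

/-- Two triangles with a common side that is glued by a gluing in `𝒦` and has been removed from
all contours. -/
def Crossed (𝒦 : Set (Gluing d N)) (E : Multiset (Fin N × Fin (d + 1) × Finset (Fin (d + 1))))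
    (t t' : Fin N × Finset (Fin (d + 1))) : Prop :=
  ∃ g ∈ 𝒦, ∃ s : Side d N, s.facet = g.src ∧ s.tri = t ∧ (g.map s).tri = t' ∧
    s.edge ∉ E ∧ (g.map s).edge ∉ E

theorem Crossed.mono {𝒦 𝒦' : Set (Gluing d N)}
    {E E' : Multiset (Fin N × Fin (d + 1) × Finset (Fin (d + 1)))} (h : 𝒦 ⊆ 𝒦') (hE : E' ⊆ E)
    {t t' : Fin N × Finset (Fin (d + 1))} (ht : Relation.EqvGen (Crossed 𝒦 E) t t') :
    Relation.EqvGen (Crossed 𝒦' E') t t' :=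
  Relation.EqvGen.mono (fun _ _ ⟨g, hg, s, h1, h2, h3, h4, h5⟩ =>
    ⟨g, h hg, s, h1, h2, h3, fun h' => h4 (hE h'), fun h' => h5 (hE h')⟩) _ _ ht

theorem Crossed.adj {𝒦 : Set (Gluing d N)}
    {E : Multiset (Fin N × Fin (d + 1) × Finset (Fin (d + 1)))}
    {t t' : Fin N × Finset (Fin (d + 1))} (ht : Relation.EqvGen (Crossed 𝒦 E) t t') :
    Relation.EqvGen (Adj 𝒦) t t' :=
  Relation.EqvGen.mono (fun _ _ ⟨g, hg, s, h1, h2, h3, _, _⟩ => ⟨g, hg, s, h1, h2, h3⟩) _ _ ht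

/-- `S` describes the links of the complex obtained by the gluings in `𝒦`, where some sides
that are known to be glued may still be present in the contours. By `present`, a side is missing
from the contours only after it has been glued within its component. -/
structure Describes (M : Fin N × Fin (d + 1) → Option (Finset (Fin (d + 1))))
    (𝒦 : Set (Gluing d N)) (S : Multiset (Component d N)) : Prop where
  symm : ∀ g ∈ 𝒦, g.symm ∈ 𝒦
  nodup : (sideSet S).Nodup
  cover : ∀ s : Side d N, ∃ X ∈ S, s.tri ∈ X.tris
  present : ∀ s : Side d N, s.edge ∈ sideSet S ∨
    ∃ g ∈ 𝒦, s.facet = g.src ∧ ∃ X ∈ S, s.tri ∈ X.tris ∧ (g.map s).tri ∈ X.tris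
  tri_mem : ∀ X ∈ S, ∀ K ∈ X.contours, ∀ s : Side d N, s.edge ∈ K.map Side.edge → s.tri ∈ X.tris
  connected : ∀ X ∈ S, ∀ t ∈ X.tris, ∀ t' ∈ X.tris, Relation.EqvGen (Crossed 𝒦 (sideSet S)) t t'
  size : ∀ X ∈ S, ∀ K ∈ X.contours, markCount M K ≤ X.size
  unmarked : ∀ g ∈ 𝒦, ∀ s : Side d N, s.facet = g.src → s.edge ∈ sideSet S → ¬ Marked M s

/-- A contour is a closed walk whose sides all run along, or all against, the orientation. -/
def Coherent {G : Set (Gluing d N)} {C : Set (Fin N × Finset (Fin (d + 1)))} (m : LinkModel G C)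
    (K : List (Side d N)) : Prop :=
  (∃ p, Walk m.start p K p) ∧ ∃ ε : Prop, ∀ s ∈ K, m.sgn s ↔ ε

/-- `G` is a possible completion of the partially glued complex given by `𝒦` and `S`. -/
structure Fits (T : Set (Gluing d N)) (M : Fin N × Fin (d + 1) → Option (Finset (Fin (d + 1))))
    (𝒦 : Set (Gluing d N)) (S : Multiset (Component d N)) (G : Set (Gluing d N)) : Prop where
  good : Good T M G
  sub : 𝒦 ⊆ G
  coherent : ∀ (C : Set (Fin N × Finset (Fin (d + 1)))) (m : LinkModel G C), ∀ X ∈ S,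
    X.tris ⊆ C → ∀ K ∈ X.contours, Coherent m K

/-- No gluing in `G` identifies a marked side in `A` with a side in `B`. -/
def NoPair (M : Fin N × Fin (d + 1) → Option (Finset (Fin (d + 1)))) (G : Set (Gluing d N))
    (A B : List (Side d N)) : Prop :=
  ∀ s : Side d N, s.edge ∈ A.map Side.edge → Marked M s → ∀ g ∈ G, s.facet = g.src →
    (g.map s).edge ∉ B.map Side.edge

theorem NoPair.mono {G : Set (Gluing d N)} {A B A' B' : List (Side d N)} (h : NoPair M G A B)
    (hA : A'.map Side.edge ⊆ A.map Side.edge) (hB : B'.map Side.edge ⊆ B.map Side.edge) :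
    NoPair M G A' B' :=
  fun s hs hm g hg hf hB' => h s (hA hs) hm g hg hf (hB hB')

theorem NoPair.symm {T G : Set (Gluing d N)} (hG : Good T M G) {A B : List (Side d N)}
    (h : NoPair M G A B) : NoPair M G B A := by
  intro s hs hm g hg hf hA
  refine h (g.map s) hA (hG.marked_map g hg s hf hm) g.symm (hG.symm g hg)
    (Gluing.facet_map hf) ?_
  rwa [Gluing.symm_map_map hf]

theorem noPair_append {G : Set (Gluing d N)} {A B A' B' : List (Side d N)} :
    NoPair M G (A ++ B) (A' ++ B') ↔
      NoPair M G A A' ∧ NoPair M G A B' ∧ NoPair M G B A' ∧ NoPair M G B B' := by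
  constructor
  · intro h
    refine ⟨h.mono ?_ ?_, h.mono ?_ ?_, h.mono ?_ ?_, h.mono ?_ ?_⟩ <;> simp
  · rintro ⟨h1, h2, h3, h4⟩ s hs hm g hg hf hB
    rw [List.map_append, List.mem_append] at hs hB
    rcases hs with hs | hs <;> rcases hB with hB | hB
    exacts [h1 s hs hm g hg hf hB, h2 s hs hm g hg hf hB, h3 s hs hm g hg hf hB,
      h4 s hs hm g hg hf hB]

/-- A link that contains one triangle of a component contains the whole component. -/
theorem Fits.subset_of_mem {T 𝒦 G : Set (Gluing d N)} {S : Multiset (Component d N)}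
    (hS : Describes M 𝒦 S) (h : Fits T M 𝒦 S G) {C : Set (Fin N × Finset (Fin (d + 1)))}
    (m : LinkModel G C) {X : Component d N} (hX : X ∈ S) {t : Fin N × Finset (Fin (d + 1))}
    (ht : t ∈ X.tris) (hC : t ∈ C) : X.tris ⊆ C := fun t' ht' =>
  (m.mem_iff h.good.symm (eqvGen_adj_mono h.sub (Crossed.adj (hS.connected X hX t ht t' ht')))).1 hC

/-- A contour can be cut open at any of its sides, and reversed if necessary, so that it begins with
this side in a prescribed direction. -/
theorem exists_cut {K : List (Side d N)} {y : Side d N} (hy : y.edge ∈ K.map Side.edge) :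
    ∃ B : List (Side d N), ((y :: B).map Side.edge).Perm (K.map Side.edge) ∧
      ∀ (G : Set (Gluing d N)) (C : Set (Fin N × Finset (Fin (d + 1)))) (m : LinkModel G C),
        (∀ s : Side d N, s.edge ∈ K.map Side.edge → s.tri ∈ C) → Coherent m K →
          Coherent m (y :: B) := by
  have rotate : ∀ (G : Set (Gluing d N)) (C : Set (Fin N × Finset (Fin (d + 1))))
      (m : LinkModel G C) (A B : List (Side d N)), Coherent m (A ++ B) → Coherent m (B ++ A) := by
    rintro G C m A B ⟨⟨p, hp⟩, ε, hε⟩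
    obtain ⟨r, h1, h2⟩ := walk_append.1 hp
    exact ⟨⟨r, walk_append.2 ⟨p, h2, h1⟩⟩, ε, fun s hs => hε s (by
      rw [List.mem_append] at hs ⊢; exact hs.symm)⟩
  obtain ⟨z, hz, hzy⟩ := List.mem_map.1 hy
  obtain ⟨l₁, l₂, rfl⟩ := List.append_of_mem hz
  rcases Side.edge_eq_iff.1 hzy with rfl | rfl
  · refine ⟨l₂ ++ l₁, ?_, fun G C m _ h => ?_⟩
    · rw [← List.cons_append]
      exact (List.perm_append_comm).map _
    · simpa using rotate G C m _ _ h
  · refine ⟨l₁.reverse.map Side.rev ++ l₂.reverse.map Side.rev, ?_, fun G C m hC h => ?_⟩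
    · have e : ∀ l : List (Side d N), (l.reverse.map Side.rev).map Side.edge =
          (l.map Side.edge).reverse := by
        intro l
        rw [List.map_map, ← List.map_reverse]
        exact List.map_congr_left fun s _ => Side.edge_rev s
      rw [List.map_cons, List.map_append, List.map_append, e, e, List.map_cons, Side.edge_rev]
      refine List.Perm.trans ?_ List.perm_middle.symm
      exact (((List.reverse_perm _).append (List.reverse_perm _))).cons _
    · have h' : Coherent m ((l₁ ++ y.rev :: l₂).reverse.map Side.rev) := by
        obtain ⟨⟨p, hp⟩, ε, hε⟩ := h
        refine ⟨⟨p, hp.reverse⟩, ¬ ε, fun s hs => ?_⟩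
        obtain ⟨s', hs', rfl⟩ := List.mem_map.1 hs
        rw [List.mem_reverse] at hs'
        rw [m.sgn_rev s' (hC s' (List.mem_map_of_mem hs')), hε s' hs']
      rw [List.reverse_append, List.reverse_cons, List.map_append, List.map_append] at h'
      have h'' := rotate G C m _ _ h'
      simp only [List.map_cons, List.map_nil, Side.rev_rev] at h''
      have h6 : Coherent m ((l₁.reverse.map Side.rev ++ l₂.reverse.map Side.rev) ++ [y]) := by
        simpa [List.append_assoc] using h''
      simpa using rotate G C m _ _ h6

end Core

/-! ### Counting completions -/

section Core

variable {d N : ℕ} {M : Fin N × Fin (d + 1) → Option (Finset (Fin (d + 1)))}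

/-- `S` is resolved for the completion `G` if no gluing in `G` identifies a marked side with a side
in the same contour. -/
def Resolved (M : Fin N × Fin (d + 1) → Option (Finset (Fin (d + 1)))) (G : Set (Gluing d N))
    (S : Multiset (Component d N)) : Prop :=
  ∀ X ∈ S, ∀ K ∈ X.contours, NoPair M G K K

theorem resolved_cons {G : Set (Gluing d N)} {S : Multiset (Component d N)} {X : Component d N} :
    Resolved M G (X ::ₘ S) ↔ (∀ K ∈ X.contours, NoPair M G K K) ∧ Resolved M G S := by
  simp [Resolved, Multiset.mem_cons]

/-- If nothing is left to be merged and all contours are resolved, then nothing is left to be glued: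
by the Jordan property, the two sides of a gluing in one component would be in one contour. -/
theorem Fits.eq_of_resolved {T 𝒦 G : Set (Gluing d N)} {S : Multiset (Component d N)}
    (hS : Describes M 𝒦 S) (hT : T ⊆ 𝒦) (h : Fits T M 𝒦 S G) (hR : Resolved M G S)
    (hm : ∀ g ∈ 𝒦, ∀ s : Side d N, s.facet = g.src →
      ∃ X ∈ S, s.tri ∈ X.tris ∧ (g.map s).tri ∈ X.tris) : 𝒦 = G := by
  by_contra hne
  obtain ⟨g, hg, hgK, s, hs, hM, hadj⟩ := h.good.local_gluing 𝒦 h.sub hT hS.symm hne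
  obtain ⟨C, hC, ⟨m⟩⟩ := h.good.model g hg s hs hM
  have hmem : s.edge ∈ sideSet S := by
    rcases hS.present s with h1 | ⟨g', hg', hs', -⟩
    · exact h1
    · exact absurd (h.good.src_inj g hg g' (h.sub hg') (hs.symm.trans hs') ▸ hg') hgK
  obtain ⟨X, hX, K, hK, hsK⟩ := mem_sideSet.1 hmem
  have hXC : X.tris ⊆ C := h.subset_of_mem hS m hX (hS.tri_mem X hX K hK s hsK) hC
  have hnodup : (K.map Side.edge).Nodup := by
    have h1 : ((K.map Side.edge : List _) : Multiset _) ≤ sideSet S := by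
      obtain ⟨R, rfl⟩ := Multiset.exists_cons_of_mem hX
      obtain ⟨D, hD⟩ := Multiset.exists_cons_of_mem hK
      rw [sideSet_cons, hD, contourSides_cons, add_assoc]
      exact Multiset.le_add_right _ _
    exact Multiset.coe_nodup.1 (Multiset.nodup_of_le h1 hS.nodup)
  obtain ⟨A, hA⟩ := m.jordan K
    (fun s' hs' => hXC (hS.tri_mem X hX K hK s' (List.mem_map_of_mem hs'))) hnodup
    (h.coherent C m X hX hXC K hK).1
  -- crossing a glued side outside of `K` does not change `A`, so `A` is constant on components
  have hcross : ∀ t t', Relation.EqvGen (Crossed 𝒦 (sideSet S)) t t' → t ∈ C → A t = A t' := by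
    intro t t' htt
    have key : (t ∈ C ↔ t' ∈ C) ∧ (t ∈ C → A t = A t') := by
      refine ⟨m.mem_iff h.good.symm (eqvGen_adj_mono h.sub (Crossed.adj htt)), ?_⟩
      induction htt with
      | rel t t' h' =>
        obtain ⟨g', hg', s', hs', rfl, rfl, h1, h2⟩ := h'
        intro hC'
        have := hA g' (h.sub hg') s' hs' hC'
        rw [if_neg fun h' => h1 (mem_sideSet.2 ⟨X, hX, K, hK, h'⟩),
          if_neg fun h' => h2 (mem_sideSet.2 ⟨X, hX, K, hK, h'⟩), add_zero] at this
        exact CharTwo.add_eq_zero.1 this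
      | refl => intro _; rfl
      | symm t t' htt ih =>
        intro hC'
        exact (ih ((m.mem_iff h.good.symm (eqvGen_adj_mono h.sub (Crossed.adj htt))).2 hC')).symm
      | trans t t' t'' htt _ ih₁ ih₂ =>
        intro hC'
        exact (ih₁ hC').trans
          (ih₂ ((m.mem_iff h.good.symm (eqvGen_adj_mono h.sub (Crossed.adj htt))).1 hC'))
    exact key.2
  have hconst : ∀ t t', Relation.EqvGen (Adj 𝒦) t t' → t ∈ C → A t = A t' := by
    intro t t' htt
    induction htt with
    | rel t t' h' =>
      obtain ⟨g', hg', s', hs', rfl, rfl⟩ := h'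
      obtain ⟨Y, hY, h1, h2⟩ := hm g' hg' s' hs'
      exact hcross _ _ (hS.connected Y hY _ h1 _ h2)
    | refl => intro _; rfl
    | symm t t' htt ih =>
      intro hC'
      exact (ih ((m.mem_iff h.good.symm (eqvGen_adj_mono h.sub htt)).2 hC')).symm
    | trans t t' t'' htt _ ih₁ ih₂ =>
      intro hC'
      exact (ih₁ hC').trans
        (ih₂ ((m.mem_iff h.good.symm (eqvGen_adj_mono h.sub htt)).1 hC'))
  -- but `K` passes through the pair given by `g` exactly once
  have h1 := hA g hg s hs hC
  rw [if_pos hsK, if_neg (hR X hX K hK s hsK hM g hg hs), hconst _ _ hadj hC,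
    CharTwo.add_self_eq_zero] at h1
  simp at h1

/-- Merging two components along a gluing that is known. The two sides are removed from their
contours, which become the two arcs `A` and `B` of one contour. Both contours had been resolved, so
only pairs that join `A` to `B` can be left in the new one. -/
theorem exists_merge {𝒦 : Set (Gluing d N)} {S : Multiset (Component d N)}
    (hS : Describes M 𝒦 S) (hinj : ∀ g ∈ 𝒦, ∀ h ∈ 𝒦, g.src = h.src → g = h) {g : Gluing d N}
    (hg : g ∈ 𝒦) {s : Side d N} (hs : s.facet = g.src)
    (hno : ¬ ∃ X ∈ S, s.tri ∈ X.tris ∧ (g.map s).tri ∈ X.tris) :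
    ∃ (tris : Set (Fin N × Finset (Fin (d + 1)))) (m : ℕ) (A B : List (Side d N))
      (C : Multiset (List (Side d N))) (R : Multiset (Component d N)),
      Describes M 𝒦 (⟨tris, m, (A ++ B) ::ₘ C⟩ ::ₘ R) ∧
      (sideSet (⟨tris, m, (A ++ B) ::ₘ C⟩ ::ₘ R)).card < (sideSet S).card ∧
      arcWeight (markCount M A) (markCount M B) *
        (C.map fun K => contourWeight (markCount M K)).prod * componentWeight m * totalWeight M R ≤
          totalWeight M S ∧
      ∀ (T G : Set (Gluing d N)), Fits T M 𝒦 S G → Resolved M G S →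
        Fits T M 𝒦 (⟨tris, m, (A ++ B) ::ₘ C⟩ ::ₘ R) G ∧ NoPair M G A A ∧ NoPair M G B B ∧
          (∀ K ∈ C, NoPair M G K K) ∧ Resolved M G R := by
  have hsym := Gluing.facet_map hs
  -- both sides are still present in contours, as no other known gluing involves their facets
  have hmem₁ : s.edge ∈ sideSet S := by
    rcases hS.present s with h1 | ⟨g', hg', hs', h'⟩
    · exact h1
    · rw [← hinj g hg g' hg' (hs.symm.trans hs')] at h'
      exact absurd h' hno
  have hmem₂ : (g.map s).edge ∈ sideSet S := by
    rcases hS.present (g.map s) with h1 | ⟨g', hg', hs', X, hX, h1, h2⟩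
    · exact h1
    · rw [← hinj _ (hS.symm g hg) g' hg' (hsym.symm.trans hs'), Gluing.symm_map_map hs] at h2
      exact absurd ⟨X, hX, h2, h1⟩ hno
  obtain ⟨X, hX, K, hK, hsK⟩ := mem_sideSet.1 hmem₁
  obtain ⟨Y, hY, L, hL, hsL⟩ := mem_sideSet.1 hmem₂
  have htX := hS.tri_mem X hX K hK s hsK
  have htY := hS.tri_mem Y hY L hL _ hsL
  have hXY : Y ≠ X := by
    rintro rfl
    exact hno ⟨Y, hY, htX, htY⟩
  have hMs : ¬ Marked M s := hS.unmarked g hg s hs hmem₁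
  have hMs' : ¬ Marked M (g.map s) := hS.unmarked _ (hS.symm g hg) _ hsym hmem₂
  obtain ⟨S', rfl⟩ := Multiset.exists_cons_of_mem hX
  obtain ⟨R, rfl⟩ := Multiset.exists_cons_of_mem ((Multiset.mem_cons.1 hY).resolve_left hXY)
  obtain ⟨CX, hCX⟩ := Multiset.exists_cons_of_mem hK
  obtain ⟨CY, hCY⟩ := Multiset.exists_cons_of_mem hL
  obtain ⟨A, hA, hAc⟩ := exists_cut hsK
  obtain ⟨B, hB, hBc⟩ := exists_cut (K := L) (y := (g.map s).rev) (by simpa using hsL)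
  set Z : Component d N := ⟨X.tris ∪ Y.tris, X.size + Y.size, (A ++ B) ::ₘ (CX + CY)⟩ with hZ
  have hside : sideSet (X ::ₘ Y ::ₘ R) = s.edge ::ₘ (g.map s).edge ::ₘ sideSet (Z ::ₘ R) := by
    have h1 : ((K.map Side.edge : List _) : Multiset _) =
        s.edge ::ₘ ((A.map Side.edge : List _) : Multiset _) := by
      rw [Multiset.cons_coe]; exact (Multiset.coe_eq_coe.2 hA).symm
    have h2 : ((L.map Side.edge : List _) : Multiset _) =
        (g.map s).edge ::ₘ ((B.map Side.edge : List _) : Multiset _) := by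
      rw [Multiset.cons_coe, ← Side.edge_rev]; exact (Multiset.coe_eq_coe.2 hB).symm
    simp only [sideSet_cons, hCX, hCY, hZ, contourSides_cons, contourSides_add, h1, h2,
      List.map_append, ← Multiset.coe_add]
    simp only [← Multiset.singleton_add]
    abel
  have hsub : sideSet (Z ::ₘ R) ⊆ sideSet (X ::ₘ Y ::ₘ R) := by
    rw [hside]
    exact fun e he => Multiset.mem_cons_of_mem (Multiset.mem_cons_of_mem he)
  have hnd : (s.edge ::ₘ (g.map s).edge ::ₘ sideSet (Z ::ₘ R)).Nodup := hside ▸ hS.nodup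
  have hn₁ : s.edge ∉ sideSet (Z ::ₘ R) := fun h =>
    (Multiset.nodup_cons.1 hnd).1 (Multiset.mem_cons_of_mem h)
  have hn₂ : (g.map s).edge ∉ sideSet (Z ::ₘ R) :=
    (Multiset.nodup_cons.1 (Multiset.nodup_cons.1 hnd).2).1
  have hinto : ∀ W ∈ X ::ₘ Y ::ₘ R, ∃ W' ∈ Z ::ₘ R, W.tris ⊆ W'.tris := by
    intro W hW
    rcases Multiset.mem_cons.1 hW with rfl | hW
    · exact ⟨Z, Multiset.mem_cons_self _ _, Set.subset_union_left⟩
    rcases Multiset.mem_cons.1 hW with rfl | hW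
    · exact ⟨Z, Multiset.mem_cons_self _ _, Set.subset_union_right⟩
    · exact ⟨W, Multiset.mem_cons_of_mem hW, subset_rfl⟩
  have hRS : ∀ W ∈ R, W ∈ X ::ₘ Y ::ₘ R := fun W hW =>
    Multiset.mem_cons_of_mem (Multiset.mem_cons_of_mem hW)
  have hAK : A.map Side.edge ⊆ K.map Side.edge := fun e he =>
    hA.subset (List.mem_cons_of_mem _ he)
  have hBL : B.map Side.edge ⊆ L.map Side.edge := fun e he =>
    hB.subset (List.mem_cons_of_mem _ he)
  have hmA : markCount M A = markCount M K := by
    rw [← markCount_perm hA, markCount_cons_of_not hMs]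
  have hmB : markCount M B = markCount M L := by
    rw [← markCount_perm hB, markCount_cons_of_not]
    rwa [marked_congr (Side.edge_rev _)]
  have hCXm : ∀ J ∈ CX, J ∈ X.contours := fun J hJ => hCX ▸ Multiset.mem_cons_of_mem hJ
  have hCYm : ∀ J ∈ CY, J ∈ Y.contours := fun J hJ => hCY ▸ Multiset.mem_cons_of_mem hJ
  refine ⟨X.tris ∪ Y.tris, X.size + Y.size, A, B, CX + CY, R, ?_, ?_, ?_, ?_⟩
  · refine ⟨hS.symm, (Multiset.nodup_cons.1 (Multiset.nodup_cons.1 hnd).2).2, ?_, ?_, ?_, ?_, ?_,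
      ?_⟩
    · intro s'
      obtain ⟨W, hW, h⟩ := hS.cover s'
      obtain ⟨W', hW', h'⟩ := hinto W hW
      exact ⟨W', hW', h' h⟩
    · intro s'
      rcases hS.present s' with h | ⟨g', hg', hs', W, hW, h1, h2⟩
      · rw [hside, Multiset.mem_cons, Multiset.mem_cons] at h
        rcases h with h | h | h
        · refine .inr ⟨g, hg, (Side.facet_eq_of_edge_eq h).trans hs, Z, Multiset.mem_cons_self _ _,
            .inl ?_, .inr ?_⟩
          · rwa [Side.tri_eq_of_edge_eq h]
          · rwa [Gluing.tri_map_congr (Side.tri_eq_of_edge_eq h)]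
        · refine .inr ⟨g.symm, hS.symm g hg, (Side.facet_eq_of_edge_eq h).trans hsym, Z,
            Multiset.mem_cons_self _ _, .inr ?_, .inl ?_⟩
          · rwa [Side.tri_eq_of_edge_eq h]
          · rwa [Gluing.tri_map_congr (Side.tri_eq_of_edge_eq h), Gluing.symm_map_map hs]
        · exact .inl h
      · obtain ⟨W', hW', h'⟩ := hinto W hW
        exact .inr ⟨g', hg', hs', W', hW', h' h1, h' h2⟩
    · intro W hW J hJ s' hs'
      rcases Multiset.mem_cons.1 hW with rfl | hW
      · rcases Multiset.mem_cons.1 hJ with rfl | hJ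
        · rw [List.map_append, List.mem_append] at hs'
          rcases hs' with h | h
          · exact .inl (hS.tri_mem X hX K hK s' (hAK h))
          · exact .inr (hS.tri_mem Y hY L hL s' (hBL h))
        · rcases Multiset.mem_add.1 hJ with hJ | hJ
          · exact .inl (hS.tri_mem X hX J (hCXm J hJ) s' hs')
          · exact .inr (hS.tri_mem Y hY J (hCYm J hJ) s' hs')
      · exact hS.tri_mem W (hRS W hW) J hJ s' hs'
    · intro W hW t ht t' ht'
      rcases Multiset.mem_cons.1 hW with rfl | hW
      · have hst : Relation.EqvGen (Crossed 𝒦 (sideSet (Z ::ₘ R))) s.tri (g.map s).tri :=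
          .rel _ _ ⟨g, hg, s, hs, rfl, rfl, hn₁, hn₂⟩
        have toS : ∀ t ∈ X.tris ∪ Y.tris,
            Relation.EqvGen (Crossed 𝒦 (sideSet (Z ::ₘ R))) t s.tri := by
          rintro t (ht | ht)
          · exact Crossed.mono subset_rfl hsub (hS.connected X hX t ht _ htX)
          · exact (Crossed.mono subset_rfl hsub (hS.connected Y hY t ht _ htY)).trans _ _ _
              (hst.symm _ _)
        exact (toS t ht).trans _ _ _ ((toS t' ht').symm _ _)
      · exact Crossed.mono subset_rfl hsub (hS.connected W (hRS W hW) t ht t' ht')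
    · intro W hW J hJ
      rcases Multiset.mem_cons.1 hW with rfl | hW
      · have hX' := hS.size X hX
        have hY' := hS.size Y hY
        rcases Multiset.mem_cons.1 hJ with rfl | hJ
        · rw [markCount_append, hmA, hmB]
          exact add_le_add (hX' K hK) (hY' L hL)
        · rcases Multiset.mem_add.1 hJ with hJ | hJ
          · exact (hX' J (hCXm J hJ)).trans (Nat.le_add_right _ _)
          · exact (hY' J (hCYm J hJ)).trans (Nat.le_add_left _ _)
      · exact hS.size W (hRS W hW) J hJ
    · intro g' hg' s' hs' h
      exact hS.unmarked g' hg' s' hs' (hsub h)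
  · change (sideSet (Z ::ₘ R)).card < _
    rw [hside, Multiset.card_cons, Multiset.card_cons]
    omega
  · simp only [totalWeight, Multiset.map_cons, Multiset.prod_cons, Component.weight, hCX, hCY,
      Multiset.map_add, Multiset.prod_add, hmA, hmB]
    have hw := merge_weight_le (hS.size X hX K hK) (hS.size Y hY L hL)
    have h1 := one_le_contours_prod (M := M) CX
    have h2 := one_le_contours_prod (M := M) CY
    have h3 := one_le_totalWeight (M := M) R
    rw [totalWeight] at h3
    calc _ = (arcWeight (markCount M K) (markCount M L) * componentWeight (X.size + Y.size)) *
          ((CX.map fun K => contourWeight (markCount M K)).prod *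
            (CY.map fun K => contourWeight (markCount M K)).prod *
            (R.map (Component.weight M)).prod) := by ring
      _ ≤ _ := mul_le_mul_of_nonneg_right hw (by positivity)
      _ = _ := by ring
  · intro T G hF hR
    refine ⟨⟨hF.good, hF.sub, ?_⟩, (hR X hX K hK).mono hAK hAK, (hR Y hY L hL).mono hBL hBL, ?_,
      fun W hW => hR W (hRS W hW)⟩
    · intro D m W hW hWD J hJ
      rcases Multiset.mem_cons.1 hW with rfl | hW
      · have hXD : X.tris ⊆ D := Set.subset_union_left.trans hWD
        have hYD : Y.tris ⊆ D := Set.subset_union_right.trans hWD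
        rcases Multiset.mem_cons.1 hJ with rfl | hJ
        · have hgG := hF.sub hg
          obtain ⟨⟨p, hp⟩, ε, hε⟩ := hAc G D m (fun s' h => hXD (hS.tri_mem X hX K hK s' h))
            (hF.coherent D m X hX hXD K hK)
          obtain ⟨⟨q, hq⟩, η, hη⟩ := hBc G D m (fun s' h => hYD (hS.tri_mem Y hY L hL s' h))
            (hF.coherent D m Y hY hYD L hL)
          have e1 : m.start (g.map s).rev = m.start s.rev := by
            rw [← Gluing.map_rev, m.start_map g hgG s.rev hs (by simpa using hXD htX)]
          have e2 : m.start (g.map s) = m.start s := m.start_map g hgG s hs (hXD htX)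
          have e3 : (η ↔ ε) := by
            rw [← hη _ (List.mem_cons_self ..), m.sgn_rev _ (hYD htY),
              m.sgn_map g hgG s hs (hXD htX), not_not, hε _ (List.mem_cons_self ..)]
          refine ⟨⟨m.start s.rev, walk_append.2 ⟨m.start s, ?_, ?_⟩⟩, ε, ?_⟩
          · rw [hp.1]; exact hp.2
          · have := hq.2
            rwa [Side.rev_rev, e2, ← hq.1, e1] at this
          · intro s' hs'
            rcases List.mem_append.1 hs' with h | h
            · exact hε s' (List.mem_cons_of_mem _ h)
            · exact (hη s' (List.mem_cons_of_mem _ h)).trans e3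
        · rcases Multiset.mem_add.1 hJ with hJ | hJ
          · exact hF.coherent D m X hX hXD J (hCXm J hJ)
          · exact hF.coherent D m Y hY hYD J (hCYm J hJ)
      · exact hF.coherent D m W (hRS W hW) hWD J hJ
    · intro J hJ
      rcases Multiset.mem_add.1 hJ with hJ | hJ
      · exact hR X hX J (hCXm J hJ)
      · exact hR Y hY J (hCYm J hJ)

end Core

section Core

variable {d N : ℕ} {M : Fin N × Fin (d + 1) → Option (Finset (Fin (d + 1)))}

theorem sideSet_split (tris : Set (Fin N × Finset (Fin (d + 1)))) (m : ℕ)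
    (A₁ A₂ B₁ B₂ : List (Side d N)) (c₁ c₂ : Side d N) (C : Multiset (List (Side d N)))
    (R : Multiset (Component d N)) :
    sideSet (⟨tris, m, ((A₁ ++ c₁ :: A₂) ++ (B₁ ++ c₂ :: B₂)) ::ₘ C⟩ ::ₘ R) =
      c₁.edge ::ₘ c₂.edge ::ₘ sideSet (⟨tris, m, (A₁ ++ B₂) ::ₘ (A₂ ++ B₁) ::ₘ C⟩ ::ₘ R) := by
  simp only [sideSet_cons, contourSides_cons, List.map_append, List.map_cons, ← Multiset.coe_add,
    ← Multiset.cons_coe]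
  simp only [← Multiset.singleton_add]
  abel

/-- Gluing two marked sides of one contour splits this contour: the sides between the two are cut
off from the sides beyond them. -/
theorem Describes.split {𝒦 : Set (Gluing d N)} {tris : Set (Fin N × Finset (Fin (d + 1)))} {m : ℕ}
    {A₁ A₂ B₁ B₂ : List (Side d N)} {c₁ c₂ : Side d N} {C : Multiset (List (Side d N))}
    {R : Multiset (Component d N)}
    (hS : Describes M 𝒦 (⟨tris, m, ((A₁ ++ c₁ :: A₂) ++ (B₁ ++ c₂ :: B₂)) ::ₘ C⟩ ::ₘ R))
    (h₁ : Marked M c₁) (h₂ : Marked M c₂) {g : Gluing d N} (hg : c₁.facet = g.src)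
    (hm : g.map c₁ = c₂.rev) :
    Describes M (𝒦 ∪ {g, g.symm}) (⟨tris, m, (A₁ ++ B₂) ::ₘ (A₂ ++ B₁) ::ₘ C⟩ ::ₘ R) := by
  set X : Component d N := ⟨tris, m, ((A₁ ++ c₁ :: A₂) ++ (B₁ ++ c₂ :: B₂)) ::ₘ C⟩ with hX
  set Z : Component d N := ⟨tris, m, (A₁ ++ B₂) ::ₘ (A₂ ++ B₁) ::ₘ C⟩ with hZ
  have hside : sideSet (X ::ₘ R) = c₁.edge ::ₘ c₂.edge ::ₘ sideSet (Z ::ₘ R) :=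
    sideSet_split ..
  have hsub : sideSet (Z ::ₘ R) ⊆ sideSet (X ::ₘ R) := by
    rw [hside]
    exact fun e he => Multiset.mem_cons_of_mem (Multiset.mem_cons_of_mem he)
  have hnd : (c₁.edge ::ₘ c₂.edge ::ₘ sideSet (Z ::ₘ R)).Nodup := hside ▸ hS.nodup
  have hn₁ : c₁.edge ∉ sideSet (Z ::ₘ R) := fun h =>
    (Multiset.nodup_cons.1 hnd).1 (Multiset.mem_cons_of_mem h)
  have hn₂ : c₂.edge ∉ sideSet (Z ::ₘ R) :=
    (Multiset.nodup_cons.1 (Multiset.nodup_cons.1 hnd).2).1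
  have hXm : X ∈ X ::ₘ R := Multiset.mem_cons_self _ _
  have hZm : Z ∈ Z ::ₘ R := Multiset.mem_cons_self _ _
  have hsym : c₂.facet = g.symm.src := by rw [← Gluing.facet_map hg, hm, Side.facet_rev]
  have hm' : g.symm.map c₂ = c₁.rev := by
    have := Gluing.symm_map_map hg
    rw [hm, Gluing.map_rev] at this
    rw [← this, Side.rev_rev]
  have hK : ((A₁ ++ c₁ :: A₂) ++ (B₁ ++ c₂ :: B₂)) ∈ X.contours := Multiset.mem_cons_self _ _
  have ht₁ : c₁.tri ∈ tris := hS.tri_mem X hXm _ hK c₁ (by simp)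
  have ht₂ : c₂.tri ∈ tris := hS.tri_mem X hXm _ hK c₂ (by simp)
  refine ⟨?_, (Multiset.nodup_cons.1 (Multiset.nodup_cons.1 hnd).2).2, ?_, ?_, ?_, ?_, ?_, ?_⟩
  · rintro f (hf | rfl | rfl)
    · exact .inl (hS.symm f hf)
    · exact .inr (.inr rfl)
    · exact .inr (.inl (Gluing.symm_symm _))
  · intro s
    obtain ⟨W, hW, h⟩ := hS.cover s
    rcases Multiset.mem_cons.1 hW with rfl | hW
    · exact ⟨Z, hZm, h⟩
    · exact ⟨W, Multiset.mem_cons_of_mem hW, h⟩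
  · intro s
    rcases hS.present s with h | ⟨g', hg', hs', W, hW, h1, h2⟩
    · rw [hside, Multiset.mem_cons, Multiset.mem_cons] at h
      rcases h with h | h | h
      · refine .inr ⟨g, .inr (.inl rfl), (Side.facet_eq_of_edge_eq h).trans hg, Z, hZm, ?_, ?_⟩
        · rwa [Side.tri_eq_of_edge_eq h]
        · rwa [Gluing.tri_map_congr (Side.tri_eq_of_edge_eq h), hm, Side.tri_rev]
      · refine .inr ⟨g.symm, .inr (.inr rfl), (Side.facet_eq_of_edge_eq h).trans hsym, Z, hZm,
          ?_, ?_⟩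
        · rwa [Side.tri_eq_of_edge_eq h]
        · rwa [Gluing.tri_map_congr (Side.tri_eq_of_edge_eq h), hm', Side.tri_rev]
      · exact .inl h
    · rcases Multiset.mem_cons.1 hW with rfl | hW
      · exact .inr ⟨g', .inl hg', hs', Z, hZm, h1, h2⟩
      · exact .inr ⟨g', .inl hg', hs', W, Multiset.mem_cons_of_mem hW, h1, h2⟩
  · intro W hW J hJ s hs
    rcases Multiset.mem_cons.1 hW with rfl | hW
    · rcases Multiset.mem_cons.1 hJ with rfl | hJ
      · refine hS.tri_mem X hXm _ hK s ?_
        rw [List.map_append, List.mem_append] at hs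
        rcases hs with hs | hs <;> simp only [List.map_append, List.map_cons, List.mem_append,
          List.mem_cons, hs, or_true, true_or]
      rcases Multiset.mem_cons.1 hJ with rfl | hJ
      · refine hS.tri_mem X hXm _ hK s ?_
        rw [List.map_append, List.mem_append] at hs
        rcases hs with hs | hs <;> simp only [List.map_append, List.map_cons, List.mem_append,
          List.mem_cons, hs, or_true, true_or]
      · exact hS.tri_mem X hXm J (Multiset.mem_cons_of_mem hJ) s hs
    · exact hS.tri_mem W (Multiset.mem_cons_of_mem hW) J hJ s hs
  · intro W hW t ht t' ht'
    rcases Multiset.mem_cons.1 hW with rfl | hW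
    · exact Crossed.mono Set.subset_union_left hsub (hS.connected X hXm t ht t' ht')
    · exact Crossed.mono Set.subset_union_left hsub
        (hS.connected W (Multiset.mem_cons_of_mem hW) t ht t' ht')
  · intro W hW J hJ
    rcases Multiset.mem_cons.1 hW with rfl | hW
    · have h0 := hS.size X hXm _ hK
      have e₁ := markCount_cons_of_marked h₁ A₂
      have e₂ := markCount_cons_of_marked h₂ B₂
      simp only [markCount_append] at h0
      rcases Multiset.mem_cons.1 hJ with rfl | hJ
      · rw [markCount_append]
        change _ ≤ m
        change _ ≤ m at h0
        omega
      rcases Multiset.mem_cons.1 hJ with rfl | hJ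
      · rw [markCount_append]
        change _ ≤ m
        change _ ≤ m at h0
        omega
      · exact hS.size X hXm J (Multiset.mem_cons_of_mem hJ)
    · exact hS.size W (Multiset.mem_cons_of_mem hW) J hJ
  · rintro f (hf | rfl | rfl) s hs he hM
    · exact hS.unmarked f hf s hs (hsub he) hM
    · exact hn₁ (edge_eq_of_marked hM h₁ (hs.trans hg.symm) ▸ he)
    · exact hn₂ (edge_eq_of_marked hM h₂ (hs.trans hsym.symm) ▸ he)

theorem Fits.split {T 𝒦 G : Set (Gluing d N)} {tris : Set (Fin N × Finset (Fin (d + 1)))} {m : ℕ}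
    {A₁ A₂ B₁ B₂ : List (Side d N)} {c₁ c₂ : Side d N} {C : Multiset (List (Side d N))}
    {R : Multiset (Component d N)}
    (hS : Describes M 𝒦 (⟨tris, m, ((A₁ ++ c₁ :: A₂) ++ (B₁ ++ c₂ :: B₂)) ::ₘ C⟩ ::ₘ R))
    (hF : Fits T M 𝒦 (⟨tris, m, ((A₁ ++ c₁ :: A₂) ++ (B₁ ++ c₂ :: B₂)) ::ₘ C⟩ ::ₘ R) G)
    {g : Gluing d N} (hgG : g ∈ G) (hg : c₁.facet = g.src) (hm : g.map c₁ = c₂.rev) :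
    Fits T M (𝒦 ∪ {g, g.symm}) (⟨tris, m, (A₁ ++ B₂) ::ₘ (A₂ ++ B₁) ::ₘ C⟩ ::ₘ R) G := by
  refine ⟨hF.good, ?_, ?_⟩
  · rintro f (hf | rfl | rfl)
    exacts [hF.sub hf, hgG, hF.good.symm _ hgG]
  · intro D μ W hW hWD J hJ
    rcases Multiset.mem_cons.1 hW with rfl | hW
    · have hD : tris ⊆ D := hWD
      have ht₁ : c₁.tri ∈ D :=
        hD (hS.tri_mem _ (Multiset.mem_cons_self _ _) _ (Multiset.mem_cons_self _ _) c₁ (by simp))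
      obtain ⟨⟨p, hp⟩, ε, hε⟩ := hF.coherent D μ _ (Multiset.mem_cons_self _ _) hWD _
        (Multiset.mem_cons_self _ _)
      obtain ⟨u, hu₁, hu₂⟩ := walk_append.1 hp
      obtain ⟨r, hr₁, hr₂, hr₃⟩ := walk_append.1 hu₁
      obtain ⟨v, hv₁, hv₂, hv₃⟩ := walk_append.1 hu₂
      have e1 := μ.start_map g hgG c₁ hg ht₁
      have e2 := μ.start_map g hgG c₁.rev hg (by simpa using ht₁)
      rw [hm] at e1
      rw [Gluing.map_rev, hm, Side.rev_rev] at e2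
      rcases Multiset.mem_cons.1 hJ with rfl | hJ
      · refine ⟨⟨p, walk_append.2 ⟨r, hr₁, ?_⟩⟩, ε, fun s hs => hε s ?_⟩
        · rwa [e1, hr₂] at hv₃
        · simp only [List.mem_append, List.mem_cons] at hs ⊢
          tauto
      rcases Multiset.mem_cons.1 hJ with rfl | hJ
      · refine ⟨⟨_, walk_append.2 ⟨u, hr₃, ?_⟩⟩, ε, fun s hs => hε s ?_⟩
        · rwa [← e2, hv₂]
        · simp only [List.mem_append, List.mem_cons] at hs ⊢
          tauto
      · exact hF.coherent D μ _ (Multiset.mem_cons_self _ _) hWD J (Multiset.mem_cons_of_mem hJ)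
    · exact hF.coherent D μ W (Multiset.mem_cons_of_mem hW) hWD J hJ

/-- If some pair joins the two arcs of a contour, then there is an innermost one; its two sides are
glued with opposite directions, by orientability. -/
theorem Fits.exists_innermost {T 𝒦 G : Set (Gluing d N)}
    {tris : Set (Fin N × Finset (Fin (d + 1)))} {m : ℕ} {A B : List (Side d N)}
    {C : Multiset (List (Side d N))} {R : Multiset (Component d N)}
    (hS : Describes M 𝒦 (⟨tris, m, (A ++ B) ::ₘ C⟩ ::ₘ R))
    (hF : Fits T M 𝒦 (⟨tris, m, (A ++ B) ::ₘ C⟩ ::ₘ R) G) (hAB : ¬ NoPair M G A B) :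
    ∃ A₁ c₁ A₂ B₁ c₂ B₂, A = A₁ ++ c₁ :: A₂ ∧ B = B₁ ++ c₂ :: B₂ ∧ Marked M c₁ ∧ Marked M c₂ ∧
      NoPair M G A₂ B ∧ ∃ g ∈ G, c₁.facet = g.src ∧ g.map c₁ = c₂.rev := by
  have hex : ∃ c ∈ A, Marked M c ∧ ∃ g ∈ G, c.facet = g.src ∧ (g.map c).edge ∈ B.map Side.edge := by
    simp only [NoPair, not_forall, not_not] at hAB
    obtain ⟨s, hs, hM, g, hg, hf, hB⟩ := hAB
    obtain ⟨c, hc, hcs⟩ := List.mem_map.1 hs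
    refine ⟨c, hc, (marked_congr hcs).2 hM, g, hg, (Side.facet_eq_of_edge_eq hcs).trans hf, ?_⟩
    rwa [Gluing.edge_map_congr hcs]
  obtain ⟨A₁, c₁, A₂, rfl, ⟨hM, g, hg, hf, hB⟩, hlast⟩ := exists_last_of_exists hex
  obtain ⟨c₂, hc₂, he⟩ := List.mem_map.1 hB
  obtain ⟨B₁, B₂, rfl⟩ := List.append_of_mem hc₂
  refine ⟨A₁, c₁, A₂, B₁, c₂, B₂, rfl, rfl, hM,
    (marked_congr he).2 (hF.good.marked_map g hg c₁ hf hM), ?_, g, hg, hf, ?_⟩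
  · intro s hs hM' g' hg' hf' hB'
    obtain ⟨c, hc, hcs⟩ := List.mem_map.1 hs
    refine hlast c hc ⟨(marked_congr hcs).2 hM', g', hg',
      (Side.facet_eq_of_edge_eq hcs).trans hf', ?_⟩
    rwa [Gluing.edge_map_congr hcs]
  · rcases Side.edge_eq_iff.1 he.symm with h | h
    · exfalso
      obtain ⟨D, hD, ⟨μ⟩⟩ := hF.good.model g hg c₁ hf hM
      have hX := Multiset.mem_cons_self
        (⟨tris, m, ((A₁ ++ c₁ :: A₂) ++ (B₁ ++ c₂ :: B₂)) ::ₘ C⟩ : Component d N) R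
      have hXD := hF.subset_of_mem hS μ hX
        (hS.tri_mem _ hX _ (Multiset.mem_cons_self _ _) c₁ (by simp)) hD
      obtain ⟨-, ε, hε⟩ := hF.coherent D μ _ hX hXD _ (Multiset.mem_cons_self _ _)
      have h1 := μ.sgn_map g hg c₁ hf hD
      rw [h, hε c₁ (by simp), hε c₂ (by simp)] at h1
      tauto
    · exact h

/-- A marked side in a list is determined by the number of marked sides before it. -/
theorem splitting_unique' {B₁ B₂ B₁' B₂' : List (Side d N)} {c c' : Side d N}
    (h : B₁ ++ c :: B₂ = B₁' ++ c' :: B₂') (hc : Marked M c) (hc' : Marked M c')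
    (hB : markCount M B₁ = markCount M B₁') : B₁ = B₁' ∧ c = c' ∧ B₂ = B₂' := by
  refine splitting_unique h hc hc' ?_
  have := congrArg (markCount M) h
  rw [markCount_append, markCount_append, markCount_cons_of_marked hc,
    markCount_cons_of_marked hc'] at this
  omega

open Classical in
/-- The number of completions is bounded by the weight, first for states in which all contours are
resolved, and second for states with one contour consisting of two arcs that may still be joined
by pairs. The induction is on the number `n` of sides in the contours, which is lowered by two by
every merger and by every splitting. -/
theorem card_completions_le (T : Set (Gluing d N)) (n : ℕ) :
    (∀ (𝒦 : Set (Gluing d N)) (S : Multiset (Component d N)) (𝓕 : Finset (Set (Gluing d N))),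
      (sideSet S).card = n → Describes M 𝒦 S → T ⊆ 𝒦 →
      (∀ G ∈ 𝓕, Fits T M 𝒦 S G ∧ Resolved M G S) → (𝓕.card : ℝ) ≤ totalWeight M S) ∧
    (∀ (𝒦 : Set (Gluing d N)) (tris : Set (Fin N × Finset (Fin (d + 1)))) (m : ℕ)
      (A B : List (Side d N)) (C : Multiset (List (Side d N))) (R : Multiset (Component d N))
      (𝓕 : Finset (Set (Gluing d N))),
      (sideSet (⟨tris, m, (A ++ B) ::ₘ C⟩ ::ₘ R)).card = n →
      Describes M 𝒦 (⟨tris, m, (A ++ B) ::ₘ C⟩ ::ₘ R) → T ⊆ 𝒦 →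
      (∀ G ∈ 𝓕, Fits T M 𝒦 (⟨tris, m, (A ++ B) ::ₘ C⟩ ::ₘ R) G ∧ NoPair M G A A ∧
        NoPair M G B B ∧ (∀ K ∈ C, NoPair M G K K) ∧ Resolved M G R) →
      (𝓕.card : ℝ) ≤ arcWeight (markCount M A) (markCount M B) *
        (C.map fun K => contourWeight (markCount M K)).prod * componentWeight m *
          totalWeight M R) := by
  induction n using Nat.strong_induction_on with
  | _ n ih =>
  have partA : ∀ (𝒦 : Set (Gluing d N)) (S : Multiset (Component d N))
      (𝓕 : Finset (Set (Gluing d N))),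
      (sideSet S).card = n → Describes M 𝒦 S → T ⊆ 𝒦 →
      (∀ G ∈ 𝓕, Fits T M 𝒦 S G ∧ Resolved M G S) → (𝓕.card : ℝ) ≤ totalWeight M S := by
    intro 𝒦 S 𝓕 hn hS hT h𝓕
    by_cases hm : ∀ g ∈ 𝒦, ∀ s : Side d N, s.facet = g.src →
        ∃ X ∈ S, s.tri ∈ X.tris ∧ (g.map s).tri ∈ X.tris
    · have h1 : 𝓕.card ≤ 1 := by
        rw [Finset.card_le_one]
        intro G hG G' hG'
        rw [← (h𝓕 G hG).1.eq_of_resolved hS hT (h𝓕 G hG).2 hm,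
          ← (h𝓕 G' hG').1.eq_of_resolved hS hT (h𝓕 G' hG').2 hm]
      exact le_trans (by exact_mod_cast h1) (one_le_totalWeight S)
    · push Not at hm
      obtain ⟨g, hg, s, hs, hno⟩ := hm
      rcases 𝓕.eq_empty_or_nonempty with rfl | ⟨G₀, hG₀⟩
      · simpa using zero_le_one.trans (one_le_totalWeight S)
      · have hF₀ := (h𝓕 G₀ hG₀).1
        obtain ⟨tris, m, A, B, C, R, hS', hlt, hle, hcomp⟩ := exists_merge hS
          (fun g hg h hh => hF₀.good.src_inj g (hF₀.sub hg) h (hF₀.sub hh)) hg hs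
          (by push Not; exact hno)
        exact ((ih _ (hn ▸ hlt)).2 𝒦 tris m A B C R 𝓕 rfl hS' hT fun G hG =>
          hcomp T G (h𝓕 G hG).1 (h𝓕 G hG).2).trans hle
  refine ⟨partA, ?_⟩
  intro 𝒦 tris m A B C R 𝓕 hn hS hT h𝓕
  set rest := (C.map fun K => contourWeight (markCount M K)).prod * componentWeight m *
    totalWeight M R with hrest
  have hrest0 : 0 ≤ rest := by
    have h1 := one_le_contours_prod (M := M) C
    have h2 := one_le_componentWeight m
    have h3 := one_le_totalWeight (M := M) R
    positivity
  -- the completions in which the innermost pair is preceded and followed by given numbers of marks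
  let P : ℕ → ℕ → Set (Gluing d N) → Prop := fun i j G =>
    ∃ A₁ c₁ A₂ B₁ c₂ B₂, A = A₁ ++ c₁ :: A₂ ∧ B = B₁ ++ c₂ :: B₂ ∧ Marked M c₁ ∧ Marked M c₂ ∧
      NoPair M G A₂ B ∧ markCount M A₂ = i ∧ markCount M B₁ = j ∧
        ∃ g ∈ G, c₁.facet = g.src ∧ g.map c₁ = c₂.rev
  have h0 : ((𝓕.filter fun G => NoPair M G A B).card : ℝ) ≤
      contourWeight (markCount M A + markCount M B) * rest := by
    have := partA 𝒦 _ (𝓕.filter fun G => NoPair M G A B) hn hS hT ?_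
    · simp only [totalWeight, Multiset.map_cons, Multiset.prod_cons, Component.weight,
        markCount_append] at this
      rw [hrest]
      simp only [totalWeight]
      linarith
    · intro G hG
      obtain ⟨hG, hAB⟩ := Finset.mem_filter.1 hG
      obtain ⟨hF, hA, hB, hC, hR⟩ := h𝓕 G hG
      refine ⟨hF, resolved_cons.2 ⟨fun K hK => ?_, hR⟩⟩
      rcases Multiset.mem_cons.1 hK with rfl | hK
      · exact noPair_append.2 ⟨hA, hAB, hAB.symm hF.good, hB⟩
      · exact hC K hK
  have hij : ∀ i < markCount M A, ∀ j < markCount M B, ((𝓕.filter (P i j)).card : ℝ) ≤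
      contourWeight (i + j) * arcWeight (markCount M A - 1 - i) (markCount M B - 1 - j) *
        rest := by
    intro i hi j hj
    rcases (𝓕.filter (P i j)).eq_empty_or_nonempty with he | ⟨G₀, hG₀⟩
    · have h1 := contourWeight_pos (i + j)
      have h2 := arcWeight_pos (markCount M A - 1 - i) (markCount M B - 1 - j)
      rw [he, Finset.card_empty, Nat.cast_zero]
      positivity
    obtain ⟨hG₀', A₁, c₁, A₂, B₁, c₂, B₂, rfl, rfl, h₁, h₂, -, hi', hj', g, hg, hf, hm⟩ :=
      Finset.mem_filter.1 hG₀
    have hX := Multiset.mem_cons_self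
      (⟨tris, m, ((A₁ ++ c₁ :: A₂) ++ (B₁ ++ c₂ :: B₂)) ::ₘ C⟩ : Component d N) R
    have hadj : Relation.EqvGen (Adj 𝒦) c₁.tri c₂.rev.tri := by
      rw [Side.tri_rev]
      exact Crossed.adj (hS.connected _ hX _
        (hS.tri_mem _ hX _ (Multiset.mem_cons_self _ _) c₁ (by simp)) _
        (hS.tri_mem _ hX _ (Multiset.mem_cons_self _ _) c₂ (by simp)))
    have hF₀ := (h𝓕 G₀ hG₀').1
    have hcard := congrArg Multiset.card (sideSet_split tris m A₁ A₂ B₁ B₂ c₁ c₂ C R)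
    rw [Multiset.card_cons, Multiset.card_cons, hn] at hcard
    have := (ih _ (by omega)).2 (𝒦 ∪ {g, g.symm}) tris m A₁ B₂ ((A₂ ++ B₁) ::ₘ C) R
      (𝓕.filter (P i j)) rfl (hS.split h₁ h₂ hf hm) (hT.trans Set.subset_union_left) ?_
    · refine this.trans (le_of_eq ?_)
      have e₁ : markCount M (A₁ ++ c₁ :: A₂) - 1 - i = markCount M A₁ := by
        rw [markCount_append, markCount_cons_of_marked h₁]; omega
      have e₂ : markCount M (B₁ ++ c₂ :: B₂) - 1 - j = markCount M B₂ := by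
        rw [markCount_append, markCount_cons_of_marked h₂]; omega
      rw [e₁, e₂, Multiset.map_cons, Multiset.prod_cons, markCount_append, hi', hj', hrest]
      ring
    · intro G hG
      obtain ⟨hG, A₁', c₁', A₂', B₁', c₂', B₂', eA, eB, h₁', h₂', hno, hi'', hj'', g', hg', hf',
        hm'⟩ := Finset.mem_filter.1 hG
      obtain ⟨rfl, rfl, rfl⟩ := splitting_unique eA h₁ h₁' (hi'.trans hi''.symm)
      obtain ⟨rfl, rfl, rfl⟩ := splitting_unique' eB h₂ h₂' (hj'.trans hj''.symm)
      obtain ⟨hF, hA, hB, hC, hR⟩ := h𝓕 G hG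
      -- both completions glue the same two sides, hence by the same gluing
      have hgg : g = g' := Good.gluing_unique hF₀.good hF.good hF₀.sub hF.sub hg hg' hf hf'
        hm hm' hadj
      subst hgg
      have hA' := (noPair_append.1 hA)
      have hB' := (noPair_append.1 hB)
      refine ⟨hF.split hS hg' hf hm, hA'.1, hB'.2.2.2.mono (by simp) (by simp), ?_, hR⟩
      intro K hK
      rcases Multiset.mem_cons.1 hK with rfl | hK
      -- the contour that is split off is resolved, because the pair is innermost
      · have h5 : NoPair M G A₂ B₁ := hno.mono (fun _ h => h) (by simp)
        exact noPair_append.2 ⟨hA'.2.2.2.mono (by simp) (by simp), h5, h5.symm hF.good, hB'.1⟩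
      · exact hC K hK
  have hcover : 𝓕 ⊆ (𝓕.filter fun G => NoPair M G A B) ∪
      (Finset.range (markCount M A)).biUnion fun i =>
        (Finset.range (markCount M B)).biUnion fun j => 𝓕.filter (P i j) := by
    intro G hG
    rw [Finset.mem_union]
    by_cases hAB : NoPair M G A B
    · exact .inl (Finset.mem_filter.2 ⟨hG, hAB⟩)
    · right
      obtain ⟨A₁, c₁, A₂, B₁, c₂, B₂, hA, hB, h₁, h₂, hno, hg⟩ :=
        (h𝓕 G hG).1.exists_innermost hS hAB
      refine Finset.mem_biUnion.2 ⟨markCount M A₂, ?_, Finset.mem_biUnion.2 ⟨markCount M B₁, ?_,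
        Finset.mem_filter.2 ⟨hG, A₁, c₁, A₂, B₁, c₂, B₂, hA, hB, h₁, h₂, hno, rfl, rfl, hg⟩⟩⟩
      · rw [hA, markCount_append, markCount_cons_of_marked h₁, Finset.mem_range]; omega
      · rw [hB, markCount_append, markCount_cons_of_marked h₂, Finset.mem_range]; omega
  have hcard : (𝓕.card : ℝ) ≤ ((𝓕.filter fun G => NoPair M G A B).card : ℝ) +
      ∑ i ∈ Finset.range (markCount M A), ∑ j ∈ Finset.range (markCount M B),
        ((𝓕.filter (P i j)).card : ℝ) := by
    have h1 := (Finset.card_le_card hcover).trans (Finset.card_union_le _ _)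
    have h2 : ((Finset.range (markCount M A)).biUnion fun i =>
        (Finset.range (markCount M B)).biUnion fun j => 𝓕.filter (P i j)).card ≤
        ∑ i ∈ Finset.range (markCount M A), ∑ j ∈ Finset.range (markCount M B),
          (𝓕.filter (P i j)).card :=
      Finset.card_biUnion_le.trans (Finset.sum_le_sum fun i _ => Finset.card_biUnion_le)
    exact_mod_cast h1.trans (Nat.add_le_add_left h2 _)
  calc (𝓕.card : ℝ) ≤ _ := hcard
    _ ≤ contourWeight (markCount M A + markCount M B) * rest +
        ∑ i ∈ Finset.range (markCount M A), ∑ j ∈ Finset.range (markCount M B),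
          contourWeight (i + j) * arcWeight (markCount M A - 1 - i) (markCount M B - 1 - j) *
            rest :=
      add_le_add h0 (Finset.sum_le_sum fun i hi => Finset.sum_le_sum fun j hj =>
        hij i (Finset.mem_range.1 hi) j (Finset.mem_range.1 hj))
    _ = (contourWeight (markCount M A + markCount M B) +
        ∑ i ∈ Finset.range (markCount M A), ∑ j ∈ Finset.range (markCount M B),
          contourWeight (i + j) * arcWeight (markCount M A - 1 - i) (markCount M B - 1 - j)) *
            rest := by
      rw [add_mul, Finset.sum_mul]
      simp_rw [Finset.sum_mul]
    _ ≤ arcWeight (markCount M A) (markCount M B) * rest :=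
      mul_le_mul_of_nonneg_right (arcWeight_ge _ _) hrest0
    _ = _ := by rw [hrest]; ring

end Core

/-! ### The initial state: single triangles -/

section Core

variable {d N : ℕ} {M : Fin N × Fin (d + 1) → Option (Finset (Fin (d + 1)))}

theorem Side.edge_eq_of_tri_eq {s t : Side d N} (h : s.tri = t.tri) :
    s.edge = t.edge ∨ s.edge = t.rot.edge ∨ s.edge = t.rot.rot.edge := by
  obtain ⟨k, a, b, c, hab, hac, hbc⟩ := s
  obtain ⟨k', a', b', c', hab', hac', hbc'⟩ := t
  simp only [Side.tri, Prod.mk.injEq] at h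
  obtain ⟨rfl, h⟩ := h
  simp only [Side.edge, Side.rot, Prod.mk.injEq, true_and]
  have key : ∀ x y z u v w : Fin (d + 1), x ≠ y → x ≠ z → u ≠ v → u ≠ w → x = u →
      ({x, y, z} : Finset (Fin (d + 1))) = {u, v, w} →
        ({y, z} : Finset (Fin (d + 1))) = {v, w} := by
    rintro x y z u v w h1 h2 h3 h4 rfl h5
    have := congrArg (fun F => F.erase x) h5
    simpa [Finset.erase_insert_eq_erase, Finset.erase_eq_of_notMem, h1, h2, h3, h4] using this
  have ha : a ∈ ({a', b', c'} : Finset (Fin (d + 1))) := h ▸ Finset.mem_insert_self _ _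
  simp only [Finset.mem_insert, Finset.mem_singleton] at ha
  have r1 : ({a', b', c'} : Finset (Fin (d + 1))) = {b', c', a'} := by ext; simp; tauto
  have r2 : ({a', b', c'} : Finset (Fin (d + 1))) = {c', a', b'} := by ext; simp; tauto
  rcases ha with ha | ha | ha
  · exact .inl ⟨ha, key _ _ _ _ _ _ hab hac hab' hac' ha h⟩
  · exact .inr (.inl ⟨ha, key _ _ _ _ _ _ hab hac hbc' hab'.symm ha (h.trans r1)⟩)
  · exact .inr (.inr ⟨ha, key _ _ _ _ _ _ hab hac hac'.symm hbc'.symm ha (h.trans r2)⟩)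

/-- The component that consists of a single triangle. -/
noncomputable def triangleComponent
    (M : Fin N × Fin (d + 1) → Option (Finset (Fin (d + 1)))) (s : Side d N) : Component d N :=
  ⟨{s.tri}, markCount M [s, s.rot, s.rot.rot], {[s, s.rot, s.rot.rot]}⟩

theorem sideSet_triangles {ι : Type} (l : Multiset ι) (f : ι → Side d N) :
    sideSet (l.map fun t => triangleComponent M (f t)) =
      l.bind fun t => (([f t, (f t).rot, (f t).rot.rot].map Side.edge : List _) : Multiset _) := by
  simp [sideSet, Multiset.bind_map, triangleComponent, contourSides]

open Classical in
theorem totalWeight_triangles_le {ι : Type} (l : Multiset ι) (f : ι → Side d N) :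
    totalWeight M (l.map fun t => triangleComponent M (f t)) ≤
      12 ^ (sideSet (l.map fun t => triangleComponent M (f t))).countP
        fun e => M (e.1, e.2.1) = some e.2.2 := by
  induction l using Multiset.induction with
  | empty => simp [totalWeight, sideSet]
  | cons x l ih =>
    have h1 : ((contourSides (triangleComponent M (f x)).contours).countP
        fun e => M (e.1, e.2.1) = some e.2.2) = markCount M [f x, (f x).rot, (f x).rot.rot] := by
      simp only [triangleComponent, contourSides, Multiset.singleton_bind]
      rfl
    rw [Multiset.map_cons, totalWeight, Multiset.map_cons, Multiset.prod_cons, sideSet_cons,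
      Multiset.countP_add, pow_add, h1]
    have h2 := contourWeight_mul_componentWeight_le (markCount M [f x, (f x).rot, (f x).rot.rot])
    have h3 : (triangleComponent M (f x)).weight M =
        contourWeight (markCount M [f x, (f x).rot, (f x).rot.rot]) *
          componentWeight (markCount M [f x, (f x).rot, (f x).rot.rot]) := by
      simp [Component.weight, triangleComponent]
    rw [h3]
    exact mul_le_mul h2 ih (zero_le_one.trans (one_le_totalWeight _)) (by positivity)

open Classical in
/-- For a given tree of simplices and given marks, there are at most `12 ^ m` completions, where `m`
is the number of marked facets. -/
theorem card_good_le (T : Set (Gluing d N)) (hT : ∀ g ∈ T, g.symm ∈ T)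
    (hTM : ∀ g ∈ T, ∀ s : Side d N, s.facet = g.src → ¬ Marked M s)
    (𝓕 : Finset (Set (Gluing d N))) (h𝓕 : ∀ G ∈ 𝓕, Good T M G) :
    𝓕.card ≤ 12 ^ (Finset.univ.filter fun f => M f ≠ none).card := by
  let ι := {t : Fin N × Finset (Fin (d + 1)) // ∃ s : Side d N, s.tri = t}
  let f : ι → Side d N := fun t => t.2.choose
  have hf : ∀ t : ι, (f t).tri = t.1 := fun t => t.2.choose_spec
  let S : Multiset (Component d N) :=
    (Finset.univ : Finset ι).val.map fun t => triangleComponent M (f t)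
  have hmem : ∀ X ∈ S, ∃ t : ι, X = triangleComponent M (f t) := by
    intro X hX
    obtain ⟨t, -, rfl⟩ := Multiset.mem_map.1 hX
    exact ⟨t, rfl⟩
  have hmem' : ∀ t : ι, triangleComponent M (f t) ∈ S := fun t =>
    Multiset.mem_map_of_mem _ (Finset.mem_univ t)
  have htri : ∀ s t : Side d N, s.edge ∈ [t, t.rot, t.rot.rot].map Side.edge → s.tri = t.tri := by
    intro s t h
    simp only [List.map_cons, List.map_nil, List.mem_cons, List.not_mem_nil, or_false] at h
    rcases h with h | h | h <;> simpa using Side.tri_eq_of_edge_eq h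
  have hcont : ∀ (t : ι), ∀ K ∈ (triangleComponent M (f t)).contours,
      K = [f t, (f t).rot, (f t).rot.rot] := fun t K hK => by
    simpa [triangleComponent] using hK
  have hnodup : (sideSet S).Nodup := by
    rw [sideSet_triangles, Multiset.nodup_bind]
    refine ⟨fun t _ => ?_, ?_⟩
    · rw [Multiset.coe_nodup]
      have h1 := (f t).hab
      have h2 := (f t).hac
      have h3 := (f t).hbc
      simp [Side.edge, Side.rot, h1, h2, h3]
    · refine Multiset.Nodup.pairwise ?_ Finset.univ.nodup
      intro t _ t' _ hne
      rw [Function.onFun, Multiset.disjoint_left]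
      intro e he he'
      rw [Multiset.mem_coe] at he he'
      obtain ⟨s, hs, rfl⟩ := List.mem_map.1 he
      apply hne
      apply Subtype.ext
      rw [← hf t, ← hf t', ← htri s (f t) he, ← htri s (f t') he']
  have hD : Describes M T S := by
    refine ⟨hT, hnodup, ?_, ?_, ?_, ?_, ?_, ?_⟩
    · intro s
      exact ⟨_, hmem' ⟨s.tri, s, rfl⟩, (hf ⟨s.tri, s, rfl⟩).symm⟩
    · intro s
      left
      refine mem_sideSet.2 ⟨_, hmem' ⟨s.tri, s, rfl⟩, _, Multiset.mem_singleton_self _, ?_⟩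
      have := Side.edge_eq_of_tri_eq (hf ⟨s.tri, s, rfl⟩).symm
      simpa using this
    · intro X hX K hK s hs
      obtain ⟨t, rfl⟩ := hmem X hX
      rw [hcont t K hK] at hs
      exact htri s _ hs
    · intro X hX t ht t' ht'
      obtain ⟨u, rfl⟩ := hmem X hX
      rw [show t = t' from (show t = _ from ht).trans (show t' = _ from ht').symm]
      exact .refl _
    · intro X hX K hK
      obtain ⟨t, rfl⟩ := hmem X hX
      rw [hcont t K hK]
      exact le_rfl
    · exact fun g hg s hs _ => hTM g hg s hs
  have hF : ∀ G ∈ 𝓕, Fits T M T S G ∧ Resolved M G S := by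
    intro G hG
    have hgood := h𝓕 G hG
    refine ⟨⟨hgood, hgood.tree, ?_⟩, ?_⟩
    · intro C m X hX hXC K hK
      obtain ⟨t, rfl⟩ := hmem X hX
      rw [hcont t K hK]
      have hC : (f t).tri ∈ C := hXC rfl
      have hC' : (f t).rot.tri ∈ C := by simpa using hC
      have hC'' : (f t).rot.rot.tri ∈ C := by simpa using hC
      have r1 := m.start_rot _ hC
      have r2 := m.start_rot _ hC'
      have r3 := m.start_rot _ hC''
      have s1 := m.sgn_rot _ hC
      have s2 := m.sgn_rot _ hC'
      have s3 := m.sgn_rot _ hC''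
      have hrot : (f t).rot.rot.rot = f t := rfl
      rw [hrot] at r3 s3
      refine ⟨⟨m.start (f t), rfl, r1, r2, r3.symm⟩, m.sgn (f t), ?_⟩
      intro s hs
      simp only [List.mem_cons, List.not_mem_nil, or_false] at hs
      rcases hs with rfl | rfl | rfl
      · exact Iff.rfl
      · exact ⟨fun h => s3 (s2 h), s1⟩
      · exact ⟨s3, fun h => s2 (s1 h)⟩
    -- the sides of one triangle are not glued to each other, as they belong to one simplex
    · intro X hX K hK s hs _ g hg hsg hs'
      obtain ⟨t, rfl⟩ := hmem X hX
      rw [hcont t K hK] at hs hs'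
      have h1 := (htri _ _ hs).trans (htri _ _ hs').symm
      have h2 : s.k = g.j := congrArg Prod.fst h1
      have h3 : s.k = g.i := congrArg Prod.fst hsg
      exact hgood.ne g hg (h3.symm.trans h2)
  have h1 := (card_completions_le T _).1 T S 𝓕 rfl hD subset_rfl hF
  have h2 := h1.trans (totalWeight_triangles_le (M := M) _ _)
  have h3 : ((sideSet S).countP fun e => M (e.1, e.2.1) = some e.2.2) ≤
      (Finset.univ.filter fun f => M f ≠ none).card := by
    rw [Multiset.countP_eq_card_filter]
    let E : Finset (Fin N × Fin (d + 1) × Finset (Fin (d + 1))) :=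
      ⟨(sideSet S).filter fun e => M (e.1, e.2.1) = some e.2.2, hnodup.filter _⟩
    refine Finset.card_le_card_of_injOn (s := E) (fun e => (e.1, e.2.1)) ?_ ?_
    · intro e he
      have : M (e.1, e.2.1) = some e.2.2 := (Multiset.mem_filter.1 he).2
      simp [this]
    · intro e he e' he' hee
      have h4 : M (e.1, e.2.1) = some e.2.2 := (Multiset.mem_filter.1 he).2
      have h5 : M (e'.1, e'.2.1) = some e'.2.2 := (Multiset.mem_filter.1 he').2
      simp only [Prod.mk.injEq] at hee
      rw [hee.1, hee.2, h5, Option.some.injEq] at h4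
      exact Prod.ext hee.1 (Prod.ext hee.2 h4.symm)
  have h4 : (𝓕.card : ℝ) ≤ 12 ^ (Finset.univ.filter fun f => M f ≠ none).card :=
    h2.trans (pow_le_pow_right₀ (by norm_num) h3)
  exact_mod_cast h4

end Core

/-! ### Heights and vertices of faces -/

section Height

variable {P : Type} [PartialOrder P]

/-- On a lower set, the height is any strictly monotone function that takes every smaller value
below each element. -/
theorem height_eq_of_rank {D : Set P} (hD : IsLowerSet D) (r : P → ℕ)
    (hr : ∀ x ∈ D, ∀ y < x, r y < r x) (hp : ∀ x ∈ D, ∀ n, r x = n + 1 → ∃ y < x, r y = n)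
    {x : P} (hx : x ∈ D) : Order.height x = r x := by
  induction h : r x using Nat.strong_induction_on generalizing x with
  | _ n ih =>
  apply le_antisymm
  · rw [Order.height_le_coe_iff]
    intro y hy
    have h1 := hr x hx y hy
    rw [ih (r y) (h ▸ h1) (hD hy.le hx) rfl]
    exact_mod_cast h ▸ h1
  · cases n with
    | zero => simp
    | succ n =>
      obtain ⟨y, hy, hyn⟩ := hp x hx n h
      have h1 := Order.height_add_one_le hy
      rw [ih n (Nat.lt_succ_self n) (hD hy.le hx) hyn] at h1
      exact_mod_cast h1

variable {x : P} {n : ℕ} (e : Set.Iic x ≃o {S : Finset (Fin n) // S.Nonempty})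

include e in
theorem height_eq_card_sub_one {y : P} (hy : y ≤ x) :
    Order.height y = ((e ⟨y, hy⟩).1.card - 1 : ℕ) := by
  classical
  have key := height_eq_of_rank (isLowerSet_Iic x)
    (fun y => if h : y ≤ x then (e ⟨y, h⟩).1.card - 1 else 0) ?_ ?_ (x := y) hy
  · simpa [hy] using key
  · intro y hy z hz
    have hy' : y ≤ x := hy
    have hz' : z ≤ x := hz.le.trans hy'
    have h1 : (e ⟨z, hz'⟩) < e ⟨y, hy'⟩ := e.lt_iff_lt.2 hz
    have h2 : (e ⟨z, hz'⟩).1 ⊂ (e ⟨y, hy'⟩).1 := h1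
    have h3 := Finset.card_lt_card h2
    have h4 := (e ⟨z, hz'⟩).2.card_pos
    simp only [hy', hz', dif_pos]
    omega
  · intro y hy m hm
    have hy' : y ≤ x := hy
    simp only [hy', dif_pos] at hm
    obtain ⟨v, hv⟩ := (e ⟨y, hy'⟩).2
    have hne : ((e ⟨y, hy'⟩).1.erase v).Nonempty := by
      rw [← Finset.card_pos, Finset.card_erase_of_mem hv]; omega
    have hlt : (⟨(e ⟨y, hy'⟩).1.erase v, hne⟩ : {S : Finset (Fin n) // S.Nonempty}) <
        e ⟨y, hy'⟩ := Finset.erase_ssubset hv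
    have hlt' : e.symm ⟨_, hne⟩ < ⟨y, hy'⟩ := by
      rw [← e.lt_iff_lt, e.apply_symm_apply]; exact hlt
    refine ⟨(e.symm ⟨_, hne⟩).1, hlt', ?_⟩
    have h1 : (e.symm ⟨_, hne⟩).1 ≤ x := (e.symm ⟨_, hne⟩).2
    simp only [h1, dif_pos]
    change (e (e.symm ⟨_, hne⟩)).1.card - 1 = m
    rw [e.apply_symm_apply]
    simp only [Finset.card_erase_of_mem hv]
    omega

theorem IsSimplicial.exists_vertex (hP : IsSimplicial P) (x : P) :
    ∃ v ≤ x, Order.height v = 0 := by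
  obtain ⟨n, ⟨e⟩⟩ := hP.2 x
  obtain ⟨i, hi⟩ := (e ⟨x, le_rfl⟩).2
  refine ⟨(e.symm ⟨{i}, Finset.singleton_nonempty i⟩).1, (e.symm _).2, ?_⟩
  rw [height_eq_card_sub_one e (e.symm _).2, Subtype.coe_eta, e.apply_symm_apply]
  simp

theorem IsSimplicial.exists_edge (hP : IsSimplicial P) {x u v : P} (hu : u ≤ x) (hv : v ≤ x)
    (hu0 : Order.height u = 0) (hv0 : Order.height v = 0) (huv : u ≠ v) :
    ∃ e ≤ x, Order.height e = 1 ∧ u ≤ e ∧ v ≤ e := by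
  obtain ⟨n, ⟨e⟩⟩ := hP.2 x
  have hcu := height_eq_card_sub_one e hu
  have hcv := height_eq_card_sub_one e hv
  rw [hu0] at hcu
  rw [hv0] at hcv
  have h1 : (e ⟨u, hu⟩).1.card = 1 := by
    have := (e ⟨u, hu⟩).2.card_pos
    have h2 : (e ⟨u, hu⟩).1.card - 1 = 0 := by exact_mod_cast hcu.symm
    omega
  have h2 : (e ⟨v, hv⟩).1.card = 1 := by
    have := (e ⟨v, hv⟩).2.card_pos
    have h2 : (e ⟨v, hv⟩).1.card - 1 = 0 := by exact_mod_cast hcv.symm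
    omega
  obtain ⟨i, hi⟩ := Finset.card_eq_one.1 h1
  obtain ⟨j, hj⟩ := Finset.card_eq_one.1 h2
  have hij : i ≠ j := by
    rintro rfl
    have : e ⟨u, hu⟩ = e ⟨v, hv⟩ := Subtype.ext (hi.trans hj.symm)
    exact huv (congrArg Subtype.val (e.injective this))
  have hne : ({i, j} : Finset (Fin n)).Nonempty := ⟨i, by simp⟩
  refine ⟨(e.symm ⟨{i, j}, hne⟩).1, (e.symm _).2, ?_, ?_, ?_⟩
  · rw [height_eq_card_sub_one e (e.symm _).2, Subtype.coe_eta, e.apply_symm_apply,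
      Finset.card_pair hij]
    rfl
  · have : (⟨u, hu⟩ : Set.Iic x) ≤ e.symm ⟨{i, j}, hne⟩ := by
      rw [← e.le_iff_le, e.apply_symm_apply, ← Subtype.coe_le_coe, hi]; simp
    exact this
  · have : (⟨v, hv⟩ : Set.Iic x) ≤ e.symm ⟨{i, j}, hne⟩ := by
      rw [← e.le_iff_le, e.apply_symm_apply, ← Subtype.coe_le_coe, hj]; simp
    exact this

/-- An edge has exactly two vertices. -/
theorem IsSimplicial.eq_or_eq_of_edge (hP : IsSimplicial P) {x u v w : P}
    (hx : Order.height x = 1) (hu : u ≤ x) (hv : v ≤ x) (hw : w ≤ x)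
    (hu0 : Order.height u = 0) (hv0 : Order.height v = 0) (hw0 : Order.height w = 0)
    (huv : u ≠ v) : w = u ∨ w = v := by
  obtain ⟨n, ⟨e⟩⟩ := hP.2 x
  have hc : ∀ y (hy : y ≤ x), Order.height y = 0 → ∃ i, (e ⟨y, hy⟩).1 = {i} := by
    intro y hy hy0
    have h1 := height_eq_card_sub_one e hy
    rw [hy0] at h1
    have h2 : (e ⟨y, hy⟩).1.card - 1 = 0 := by exact_mod_cast h1.symm
    have h3 := (e ⟨y, hy⟩).2.card_pos
    exact Finset.card_eq_one.1 (by omega)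
  obtain ⟨i, hi⟩ := hc u hu hu0
  obtain ⟨j, hj⟩ := hc v hv hv0
  obtain ⟨k, hk⟩ := hc w hw hw0
  have hcx := height_eq_card_sub_one e (le_refl x)
  rw [hx] at hcx
  have hcard : (e ⟨x, le_rfl⟩).1.card = 2 := by
    have h2 : (e ⟨x, le_rfl⟩).1.card - 1 = 1 := by exact_mod_cast hcx.symm
    omega
  have hle : ∀ y (hy : y ≤ x), (e ⟨y, hy⟩).1 ⊆ (e ⟨x, le_rfl⟩).1 := fun y hy =>
    e.le_iff_le.2 (show (⟨y, hy⟩ : Set.Iic x) ≤ ⟨x, le_rfl⟩ from hy)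
  have hne : ∀ y z (hy : y ≤ x) (hz : z ≤ x), (e ⟨y, hy⟩).1 = (e ⟨z, hz⟩).1 → y = z :=
    fun y z hy hz h => congrArg Subtype.val (e.injective (Subtype.ext h))
  have hij : i ≠ j := fun h => huv (hne u v hu hv (by rw [hi, hj, h]))
  have hpair : (e ⟨x, le_rfl⟩).1 = {i, j} := by
    symm
    apply Finset.eq_of_subset_of_card_le
    · intro a ha
      rcases Finset.mem_insert.1 ha with rfl | ha
      · exact hle u hu (by simp [hi])
      · rw [Finset.mem_singleton] at ha
        exact hle v hv (by simp [hj, ha])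
    · rw [hcard, Finset.card_pair hij]
  have hk' : k ∈ ({i, j} : Finset (Fin n)) := hpair ▸ hle w hw (by simp [hk])
  rcases Finset.mem_insert.1 hk' with rfl | h
  · exact .inl (hne w u hw hu (by rw [hk, hi]))
  · rw [Finset.mem_singleton] at h
    exact .inr (hne w v hw hv (by rw [hk, hj, h]))

end Height

section Faces

variable {d N : ℕ}

/-- A vertex of a simplex, as a nonempty set of vertices. -/
def vertexSet (v : Fin (d + 1)) : {S : Finset (Fin (d + 1)) // S.Nonempty} :=
  ⟨{v}, Finset.singleton_nonempty v⟩

namespace Face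

variable {L : List (Gluing d N)}

theorem mk_le_mk {k : Fin N} {S T : {S : Finset (Fin (d + 1)) // S.Nonempty}} (h : S.1 ⊆ T.1) :
    mk L (k, S) ≤ mk L (k, T) := ⟨k, S, T, h, rfl, rfl⟩

theorem le_mk_iff {x : Face L} {k : Fin N} {T : {S : Finset (Fin (d + 1)) // S.Nonempty}} :
    x ≤ mk L (k, T) ↔ ∃ S : {S : Finset (Fin (d + 1)) // S.Nonempty}, S.1 ⊆ T.1 ∧
      mk L (k, S) = x := by
  constructor
  · rintro ⟨l, U, V, hUV, rfl, hV⟩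
    obtain ⟨S, hS, h⟩ := (transport (mk_eq_iff.1 hV)).1 U hUV
    exact ⟨S, hS, (mk_eq_iff.2 h).symm⟩
  · rintro ⟨S, hS, rfl⟩
    exact mk_le_mk hS

theorem card_lt_of_lt {x y : RawFace d N} (h : mk L x < mk L y) :
    x.2.1.card < y.2.1.card := by
  obtain ⟨S, hS, hx⟩ := le_mk_iff.1 h.le
  have h1 := card_eq (mk_eq_iff.1 hx)
  change S.1.card = x.2.1.card at h1
  rw [← h1]
  refine Finset.card_lt_card (Finset.ssubset_iff_subset_ne.2 ⟨hS, fun he => h.ne ?_⟩)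
  rw [← hx]
  exact congrArg (fun S => mk L (y.1, S)) (Subtype.ext he)

theorem height_mk (x : RawFace d N) : Order.height (mk L x) = (x.2.1.card - 1 : ℕ) := by
  let r : Face L → ℕ := Quotient.lift (fun x : RawFace d N => x.2.1.card - 1)
    fun x y (h : Relation.EqvGen (Step L) x y) => by
      simp only [card_eq h]
  have key := height_eq_of_rank (isLowerSet_univ (α := Face L)) r ?_ ?_ (x := mk L x) trivial
  · exact key
  · intro x _ y hy
    induction x using Quotient.inductionOn with
    | h x =>
    induction y using Quotient.inductionOn with
    | h y =>
    have h1 := card_lt_of_lt hy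
    have h2 := y.2.2.card_pos
    change y.2.1.card - 1 < x.2.1.card - 1
    omega
  · intro x _ n hn
    induction x using Quotient.inductionOn with
    | h x =>
    change x.2.1.card - 1 = n + 1 at hn
    obtain ⟨v, hv⟩ := x.2.2
    have hc := Finset.card_erase_of_mem hv
    have hne : (x.2.1.erase v).Nonempty := by rw [← Finset.card_pos]; omega
    refine ⟨mk L (x.1, ⟨x.2.1.erase v, hne⟩), ?_, ?_⟩
    · refine lt_of_le_of_ne (mk_le_mk (Finset.erase_subset _ _)) fun h => ?_
      have := card_eq (mk_eq_iff.1 h)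
      simp only at this
      omega
    · change (x.2.1.erase v).card - 1 = n
      omega

theorem isMin_vertex (k : Fin N) (v : Fin (d + 1)) : IsMin (mk L (k, vertexSet v)) := by
  rw [← Order.height_eq_zero, height_mk]
  simp [vertexSet]

end Face

/-- The vertices of every simplex remain distinct in the glued complex. -/
def VerticesDistinct (L : List (Gluing d N)) : Prop :=
  ∀ k v w, Relation.EqvGen (Step L) (k, vertexSet v) (k, vertexSet w) → v = w

theorem VerticesDistinct.face_eq {L : List (Gluing d N)} (h : VerticesDistinct L) {k : Fin N}
    {S T : {S : Finset (Fin (d + 1)) // S.Nonempty}}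
    (hST : Relation.EqvGen (Step L) (k, S) (k, T)) : S = T := by
  have key : ∀ S T : {S : Finset (Fin (d + 1)) // S.Nonempty},
      Relation.EqvGen (Step L) (k, S) (k, T) → S.1 ⊆ T.1 := by
    intro S T hST v hv
    obtain ⟨W, hW, hvW⟩ := (Face.transport hST).1 (vertexSet v) (by simpa [vertexSet] using hv)
    have hc := Face.card_eq hvW
    simp only [vertexSet, Finset.card_singleton] at hc
    obtain ⟨w, hw⟩ := Finset.card_eq_one.1 hc.symm
    have hW' : W = vertexSet w := Subtype.ext hw
    subst hW'
    rw [h k v w hvW]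
    exact hW (by simp [vertexSet])
  exact Subtype.ext ((key S T hST).antisymm (key T S hST.symm))

/-- In a simplicial complex, the vertices of a simplex cannot be identified: otherwise the simplex
would not have enough faces. -/
theorem verticesDistinct_of_isSimplicial {L : List (Gluing d N)} (h : IsSimplicial (Face L)) :
    VerticesDistinct L := by
  intro k v w hvw
  obtain ⟨n, ⟨e⟩⟩ := h.2 (Face.mk L (k, ⟨Finset.univ, Finset.univ_nonempty⟩))
  have htop : ∀ S : {S : Finset (Fin (d + 1)) // S.Nonempty}, Face.mk L (k, S) ∈
      Set.Iic (Face.mk L (k, ⟨Finset.univ, Finset.univ_nonempty⟩)) := fun S =>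
    Face.mk_le_mk (Finset.subset_univ _)
  have hn : d + 1 ≤ n := by
    have hc := height_eq_card_sub_one e (htop ⟨Finset.univ, Finset.univ_nonempty⟩)
    rw [Face.height_mk] at hc
    have h1 := Finset.card_le_univ (e ⟨_, htop ⟨Finset.univ, Finset.univ_nonempty⟩⟩).1
    rw [Fintype.card_fin] at h1
    have h2 := (e ⟨_, htop ⟨Finset.univ, Finset.univ_nonempty⟩⟩).2.card_pos
    have h3 := Nat.cast_injective (R := ℕ∞) hc
    simp at h3
    omega
  -- every atom below the top face is the image of a vertex of the simplex
  have hv : ∀ i : Fin n, ∃ v : Fin (d + 1), ⟨Face.mk L (k, vertexSet v), htop _⟩ =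
      e.symm ⟨{i}, Finset.singleton_nonempty i⟩ := by
    intro i
    obtain ⟨S, -, hS⟩ := Face.le_mk_iff.1 (e.symm ⟨{i}, Finset.singleton_nonempty i⟩).2
    obtain ⟨v, hv⟩ := S.2
    have hle : (⟨Face.mk L (k, vertexSet v), htop _⟩ : Set.Iic _) ≤
        e.symm ⟨{i}, Finset.singleton_nonempty i⟩ := by
      rw [← Subtype.coe_le_coe, ← hS]
      exact Face.mk_le_mk (by simpa [vertexSet] using hv)
    refine ⟨v, ?_⟩
    rw [← e.le_iff_le, e.apply_symm_apply] at hle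
    rw [e.eq_symm_apply]
    apply Subtype.ext
    have hle' : (e ⟨Face.mk L (k, vertexSet v), htop _⟩).1 ⊆ {i} := hle
    exact (Finset.Nonempty.subset_singleton_iff (e _).2).1 hle'
  choose f hf using hv
  have hinj : Function.Injective f := by
    intro i j hij
    have h1 := hf i
    rw [hij, hf j] at h1
    have h2 := congrArg Subtype.val (e.symm.injective h1)
    exact (Finset.singleton_injective h2).symm
  have hsurj : Function.Surjective f := by
    have h1 : n = d + 1 := le_antisymm (by simpa using Fintype.card_le_of_injective f hinj) hn
    exact ((Fintype.bijective_iff_injective_and_card f).2 ⟨hinj, by simp [h1]⟩).2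
  obtain ⟨i, rfl⟩ := hsurj v
  obtain ⟨j, rfl⟩ := hsurj w
  have h1 : e.symm ⟨{i}, Finset.singleton_nonempty i⟩ =
      e.symm ⟨{j}, Finset.singleton_nonempty j⟩ := by
    rw [← hf i, ← hf j]
    exact Subtype.ext (Face.mk_eq_iff.2 hvw)
  have h2 : ({i} : Finset (Fin n)) = {j} := congrArg Subtype.val (e.symm.injective h1)
  exact congrArg f (Finset.singleton_injective h2)

end Faces

/-! ### Cycles on a triangulated sphere -/

section Sphere

variable {Q : Type} [PartialOrder Q]

open Classical in
theorem IsSimplicial.card_edges_between (hQ : IsSimplicial Q) [Fintype Q] {v t : Q}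
    (hv : Order.height v = 0) (ht : Order.height t = 2) (hvt : v ≤ t) :
    (Finset.univ.filter fun e : Q => Order.height e = 1 ∧ v ≤ e ∧ e ≤ t).card = 2 := by
  obtain ⟨n, ⟨e⟩⟩ := hQ.2 t
  have hcv := height_eq_card_sub_one e hvt
  have hct := height_eq_card_sub_one e le_rfl
  rw [hv] at hcv
  rw [ht] at hct
  have hv1 : (e ⟨v, hvt⟩).1.card = 1 := by
    have h2 : (e ⟨v, hvt⟩).1.card - 1 = 0 := by exact_mod_cast hcv.symm
    have h3 := (e ⟨v, hvt⟩).2.card_pos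
    omega
  have ht3 : (e ⟨t, le_rfl⟩).1.card = 3 := by
    have h2 : (e ⟨t, le_rfl⟩).1.card - 1 = 2 := by exact_mod_cast hct.symm
    omega
  obtain ⟨i, hi⟩ := Finset.card_eq_one.1 hv1
  have hle : ∀ y (hy : y ≤ t), (e ⟨y, hy⟩).1 ⊆ (e ⟨t, le_rfl⟩).1 := fun y hy =>
    e.le_iff_le.2 (show (⟨y, hy⟩ : Set.Iic t) ≤ ⟨t, le_rfl⟩ from hy)
  have hit : i ∈ (e ⟨t, le_rfl⟩).1 := hle v hvt (by simp [hi])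
  have hne : ∀ j, ({i, j} : Finset (Fin n)).Nonempty := fun j => ⟨i, by simp⟩
  have h2 : ((e ⟨t, le_rfl⟩).1.erase i).card = 2 := by
    rw [Finset.card_erase_of_mem hit, ht3]
  rw [← h2]
  symm
  refine Finset.card_bij (fun j _ => (e.symm ⟨{i, j}, hne j⟩).1) ?_ ?_ ?_
  · intro j hj
    rw [Finset.mem_erase] at hj
    have h3 : (e.symm ⟨{i, j}, hne j⟩).1 ≤ t := (e.symm ⟨{i, j}, hne j⟩).2
    simp only [Finset.mem_filter, Finset.mem_univ, true_and]
    refine ⟨?_, ?_, h3⟩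
    · rw [height_eq_card_sub_one e (e.symm _).2, Subtype.coe_eta, e.apply_symm_apply,
        Finset.card_pair hj.1.symm]
      rfl
    · have : (⟨v, hvt⟩ : Set.Iic t) ≤ e.symm ⟨{i, j}, hne j⟩ := by
        rw [← e.le_iff_le, e.apply_symm_apply, ← Subtype.coe_le_coe, hi]; simp
      exact this
  · intro j hj k hk hjk
    have h3 : ({i, j} : Finset (Fin n)) = {i, k} :=
      congrArg Subtype.val (e.symm.injective (Subtype.ext hjk))
    have h4 : j ∈ ({i, k} : Finset (Fin n)) := h3 ▸ (by simp)
    rw [Finset.mem_erase] at hj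
    simpa [hj.1] using h4
  · intro y hy
    simp only [Finset.mem_filter, Finset.mem_univ, true_and] at hy
    obtain ⟨hy1, hvy, hyt⟩ := hy
    have hcy := height_eq_card_sub_one e hyt
    rw [hy1] at hcy
    have hy2 : (e ⟨y, hyt⟩).1.card = 2 := by
      have h2 : (e ⟨y, hyt⟩).1.card - 1 = 1 := by exact_mod_cast hcy.symm
      omega
    have hiy : i ∈ (e ⟨y, hyt⟩).1 := by
      have : (e ⟨v, hvt⟩).1 ⊆ (e ⟨y, hyt⟩).1 :=
        e.le_iff_le.2 (show (⟨v, hvt⟩ : Set.Iic t) ≤ ⟨y, hyt⟩ from hvy)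
      exact this (by simp [hi])
    obtain ⟨j, hj⟩ := Finset.card_eq_one.1
      (show ((e ⟨y, hyt⟩).1.erase i).card = 1 by rw [Finset.card_erase_of_mem hiy, hy2])
    have hjm : j ∈ (e ⟨y, hyt⟩).1.erase i := by simp [hj]
    rw [Finset.mem_erase] at hjm
    refine ⟨j, Finset.mem_erase.2 ⟨hjm.1, hle y hyt hjm.2⟩, ?_⟩
    have h5 : (⟨{i, j}, hne j⟩ : {S : Finset (Fin n) // S.Nonempty}) = e ⟨y, hyt⟩ := by
      apply Subtype.ext
      simp only
      rw [← Finset.insert_erase hiy, hj]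
    rw [h5, e.symm_apply_apply]

variable (hQ : IsTriangulatedSphere Q)

include hQ

theorem IsTriangulatedSphere.eq_or_eq {e t t' s : Q} (he : Order.height e = 1)
    (ht : Order.height t = 2) (ht' : Order.height t' = 2) (hs : Order.height s = 2)
    (het : e ≤ t) (het' : e ≤ t') (hes : e ≤ s) (hne : t ≠ t') : s = t ∨ s = t' := by
  obtain ⟨a, b, -, hab⟩ := Set.ncard_eq_two.1 (hQ.two_triangles e he)
  have key : ∀ u, Order.height u = 2 → e ≤ u → u = a ∨ u = b := fun u hu heu => by
    have : u ∈ ({a, b} : Set Q) := hab ▸ ⟨hu, heu⟩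
    simpa using this
  rcases key t ht het with rfl | rfl <;> rcases key t' ht' het' with rfl | rfl <;>
    rcases key s hs hes with rfl | rfl <;> simp_all

/-- The triangles of a triangulated sphere are connected through common edges. -/
theorem IsTriangulatedSphere.const_of_triangles {α : Type} (A : Q → α)
    (hA : ∀ e t t', Order.height e = 1 → Order.height t = 2 → Order.height t' = 2 → e ≤ t →
      e ≤ t' → A t = A t') {t t' : Q} (ht : Order.height t = 2) (ht' : Order.height t' = 2) :
    A t = A t' := by
  have star : ∀ v, Order.height v = 0 → ∀ t t', Order.height t = 2 → Order.height t' = 2 →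
      v ≤ t → v ≤ t' → A t = A t' := by
    intro v hv t t' ht ht' hvt hvt'
    have key : ∀ s s', Relation.EqvGen
        (fun s s' => ∃ e, Order.height e = 1 ∧ v ≤ e ∧ e ≤ s ∧ e ≤ s') s s' →
        s = s' ∨ ∀ t t', Order.height t = 2 → Order.height t' = 2 → s ≤ t → s' ≤ t' →
          A t = A t' := by
      intro s s' h
      induction h with
      | rel s s' h =>
        obtain ⟨e, he, -, hs, hs'⟩ := h
        exact .inr fun t t' ht ht' hst hst' =>
          hA e t t' he ht ht' (hs.trans hst) (hs'.trans hst')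
      | refl s => exact .inl rfl
      | symm s s' _ ih =>
        rcases ih with rfl | ih
        · exact .inl rfl
        · exact .inr fun t t' ht ht' h h' => (ih t' t ht' ht h' h).symm
      | trans s s' s'' _ _ ih₁ ih₂ =>
        rcases ih₁ with rfl | ih₁
        · exact ih₂
        rcases ih₂ with rfl | ih₂
        · exact .inr ih₁
        obtain ⟨u, hu, hu2⟩ := hQ.pure s'
        exact .inr fun t t' ht ht' h h' => (ih₁ t u ht hu2 h hu).trans (ih₂ u t' hu2 ht' hu h')
    rcases key t t' (hQ.vertex_link v hv t t' ht ht' hvt hvt') with rfl | h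
    · rfl
    · exact h t t' ht ht' le_rfl le_rfl
  have star' : ∀ x t t', Order.height t = 2 → Order.height t' = 2 →
      x ≤ t → x ≤ t' → A t = A t' := by
    intro x t t' ht ht' hxt hxt'
    obtain ⟨v, hvx, hv⟩ := hQ.simplicial.exists_vertex x
    exact star v hv t t' ht ht' (hvx.trans hxt) (hvx.trans hxt')
  have key : ∀ x y, Relation.EqvGen (fun u v : Q => u ≤ v) x y → ∀ t t', Order.height t = 2 →
      Order.height t' = 2 → x ≤ t → y ≤ t' → A t = A t' := by
    intro x y h
    induction h with
    | rel x y h => exact fun t t' ht ht' hx hy => star' x t t' ht ht' hx (h.trans hy)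
    | refl x => exact star' x
    | symm x y _ ih => exact fun t t' ht ht' h h' => (ih t' t ht' ht h' h).symm
    | trans x y z _ _ ih₁ ih₂ =>
      obtain ⟨u, hu, hu2⟩ := hQ.pure y
      exact fun t t' ht ht' h h' => (ih₁ t u ht hu2 h hu).trans (ih₂ u t' hu2 ht' hu h')
  exact key t t' (hQ.connected t t') t t' ht ht' le_rfl le_rfl

/-- The vertices of a triangulated sphere are connected through edges. -/
theorem IsTriangulatedSphere.const_of_vertices {α : Type} (f : Q → α)
    (hf : ∀ e u v, Order.height e = 1 → Order.height u = 0 → Order.height v = 0 → u ≤ e →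
      v ≤ e → u ≠ v → f u = f v) {u v : Q} (hu : Order.height u = 0) (hv : Order.height v = 0) :
    f u = f v := by
  have cell : ∀ x u v, Order.height u = 0 → Order.height v = 0 → u ≤ x → v ≤ x → f u = f v := by
    intro x u v hu hv hux hvx
    by_cases huv : u = v
    · rw [huv]
    obtain ⟨e, -, he, hue, hve⟩ := hQ.simplicial.exists_edge hux hvx hu hv huv
    exact hf e u v he hu hv hue hve huv
  have key : ∀ x y, Relation.EqvGen (fun u v : Q => u ≤ v) x y → ∀ u v, Order.height u = 0 →
      Order.height v = 0 → u ≤ x → v ≤ y → f u = f v := by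
    intro x y h
    induction h with
    | rel x y h => exact fun u v hu hv hx hy => cell y u v hu hv (hx.trans h) hy
    | refl x => exact cell x
    | symm x y _ ih => exact fun u v hu hv h h' => (ih v u hv hu h' h).symm
    | trans x y z _ _ ih₁ ih₂ =>
      obtain ⟨w, hw, hw0⟩ := hQ.simplicial.exists_vertex y
      exact fun u v hu hv h h' => (ih₁ u w hu hw0 h hw).trans (ih₂ w v hw0 hv hw h')
  exact key u v (hQ.connected u v) u v hu hv le_rfl le_rfl

open Classical in
/-- Every cycle of edges modulo 2 on a triangulated sphere bounds. The dimensions of the spaces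
of cycles and of boundaries agree by Euler's formula, as the sphere is connected, through triangles
as well as through edges. -/
theorem IsTriangulatedSphere.exists_filling [Fintype Q] (z : Q → ZMod 2)
    (hz : ∀ v : Q, Order.height v = 0 →
      ∑ e ∈ Finset.univ.filter (fun e : Q => Order.height e = 1 ∧ v ≤ e), z e = 0) :
    ∃ A : Q → ZMod 2, ∀ e t t' : Q, Order.height e = 1 → Order.height t = 2 →
      Order.height t' = 2 → e ≤ t → e ≤ t' → t ≠ t' → A t + A t' = z e := by
  let V := {v : Q // Order.height v = 0}
  let E := {e : Q // Order.height e = 1}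
  let F := {t : Q // Order.height t = 2}
  let D₁ : Matrix V E (ZMod 2) := fun v e => if v.1 ≤ e.1 then 1 else 0
  let D₂ : Matrix E F (ZMod 2) := fun e t => if e.1 ≤ t.1 then 1 else 0
  have heuler : Fintype.card V + Fintype.card F = Fintype.card E + 2 := by
    have := hQ.euler
    rwa [← Nat.card_coe_set_eq, ← Nat.card_coe_set_eq, ← Nat.card_coe_set_eq,
      Nat.card_eq_fintype_card, Nat.card_eq_fintype_card, Nat.card_eq_fintype_card] at this
  have hne : Nonempty Q := by
    by_contra h
    rw [not_nonempty_iff] at h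
    have h1 : Fintype.card V = 0 := Fintype.card_eq_zero_iff.2 ⟨fun v => h.false v.1⟩
    have h2 : Fintype.card F = 0 := Fintype.card_eq_zero_iff.2 ⟨fun v => h.false v.1⟩
    omega
  obtain ⟨x⟩ := hne
  obtain ⟨t₀, -, ht₀⟩ := hQ.pure x
  obtain ⟨v₀, -, hv₀⟩ := hQ.simplicial.exists_vertex x
  have hD₂ : ∀ (a : F → ZMod 2) (e : E) (t t' : F), e.1 ≤ t.1 → e.1 ≤ t'.1 → t ≠ t' →
      D₂.mulVec a e = a t + a t' := by
    intro a e t t' ht ht' htt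
    change ∑ s : F, (if e.1 ≤ s.1 then 1 else 0) * a s = _
    rw [Fintype.sum_eq_add t t' htt, if_pos ht, if_pos ht', one_mul, one_mul]
    intro s hs
    rw [if_neg, zero_mul]
    intro hes
    rcases hQ.eq_or_eq e.2 t.2 t'.2 s.2 ht ht' hes (fun h => htt (Subtype.ext h)) with h | h
    · exact hs.1 (Subtype.ext h)
    · exact hs.2 (Subtype.ext h)
  -- a cycle of triangles takes one value everywhere
  have hker₂ : Module.finrank (ZMod 2) (LinearMap.ker D₂.mulVecLin) ≤ 1 := by
    have h1 := LinearMap.finrank_le_finrank_of_injective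
      (f := (LinearMap.proj (R := ZMod 2) (φ := fun _ : F => ZMod 2) ⟨t₀, ht₀⟩).comp
        (LinearMap.ker D₂.mulVecLin).subtype) ?_
    · simpa using h1
    rw [← LinearMap.ker_eq_bot, LinearMap.ker_eq_bot']
    rintro ⟨a, ha⟩ h0
    apply Subtype.ext
    funext t
    have h0' : a ⟨t₀, ht₀⟩ = 0 := h0
    have := hQ.const_of_triangles (fun t => if h : Order.height t = 2 then a ⟨t, h⟩ else 0)
      ?_ t.2 ht₀
    · simp only [t.2, ht₀, h0', dif_pos] at this
      exact this
    intro e t t' he ht ht' het het'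
    simp only [ht, ht', dif_pos]
    by_cases htt : t = t'
    · subst htt; rfl
    have h2 := hD₂ a ⟨e, he⟩ ⟨t, ht⟩ ⟨t', ht'⟩ het het' (fun h => htt (congrArg Subtype.val h))
    have h3 : D₂.mulVec a ⟨e, he⟩ = 0 := congrFun (LinearMap.mem_ker.1 ha) ⟨e, he⟩
    rw [h3] at h2
    exact CharTwo.add_eq_zero.1 h2.symm
  -- a cochain of vertices without coboundary takes one value everywhere
  have hker₁ : Module.finrank (ZMod 2) (LinearMap.ker D₁.transpose.mulVecLin) ≤ 1 := by
    have h1 := LinearMap.finrank_le_finrank_of_injective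
      (f := (LinearMap.proj (R := ZMod 2) (φ := fun _ : V => ZMod 2) ⟨v₀, hv₀⟩).comp
        (LinearMap.ker D₁.transpose.mulVecLin).subtype) ?_
    · simpa using h1
    rw [← LinearMap.ker_eq_bot, LinearMap.ker_eq_bot']
    rintro ⟨a, ha⟩ h0
    apply Subtype.ext
    funext v
    have h0' : a ⟨v₀, hv₀⟩ = 0 := h0
    have := hQ.const_of_vertices (fun v => if h : Order.height v = 0 then a ⟨v, h⟩ else 0)
      ?_ v.2 hv₀
    · simp only [v.2, hv₀, h0', dif_pos] at this
      exact this
    intro e u v he hu hv hue hve huv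
    simp only [hu, hv, dif_pos]
    have h3 : D₁.transpose.mulVec a ⟨e, he⟩ = 0 := congrFun (LinearMap.mem_ker.1 ha) ⟨e, he⟩
    have h2 : D₁.transpose.mulVec a ⟨e, he⟩ = a ⟨u, hu⟩ + a ⟨v, hv⟩ := by
      change ∑ w : V, (if w.1 ≤ e then 1 else 0) * a w = _
      rw [Fintype.sum_eq_add ⟨u, hu⟩ ⟨v, hv⟩ (fun h => huv (congrArg Subtype.val h)),
        if_pos hue, if_pos hve, one_mul, one_mul]
      intro w hw
      rw [if_neg, zero_mul]
      intro hwe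
      rcases hQ.simplicial.eq_or_eq_of_edge he hue hve hwe hu hv w.2 huv with h | h
      · exact hw.1 (Subtype.ext h)
      · exact hw.2 (Subtype.ext h)
    rw [h3] at h2
    exact CharTwo.add_eq_zero.1 h2.symm
  -- boundaries are cycles, as two edges of a triangle meet in each of its vertices
  have hle : LinearMap.range D₂.mulVecLin ≤ LinearMap.ker D₁.mulVecLin := by
    rintro _ ⟨a, rfl⟩
    rw [LinearMap.mem_ker, Matrix.mulVecLin_apply, Matrix.mulVecLin_apply, Matrix.mulVec_mulVec]
    have h0 : D₁ * D₂ = 0 := by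
      ext v t
      rw [Matrix.mul_apply]
      change ∑ e : E, (if v.1 ≤ e.1 then 1 else 0) * (if e.1 ≤ t.1 then 1 else 0) = (0 : ZMod 2)
      have hite : ∀ e : E, ((if v.1 ≤ e.1 then 1 else 0) * (if e.1 ≤ t.1 then 1 else 0) : ZMod 2) =
          if v.1 ≤ e.1 ∧ e.1 ≤ t.1 then 1 else 0 := by
        intro e
        by_cases h1 : v.1 ≤ e.1 <;> by_cases h2 : e.1 ≤ t.1 <;> simp [h1, h2]
      rw [Finset.sum_congr rfl fun e _ => hite e, Finset.sum_boole]
      have h1 : (Finset.univ.filter fun e : E => v.1 ≤ e.1 ∧ e.1 ≤ t.1).card =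
          (Finset.univ.filter fun e : Q => Order.height e = 1 ∧ v.1 ≤ e ∧ e ≤ t.1).card := by
        refine Finset.card_bij (fun e _ => e.1) ?_ ?_ ?_
        · intro e he
          simp only [Finset.mem_filter, Finset.mem_univ, true_and] at he ⊢
          exact ⟨e.2, he⟩
        · exact fun e _ e' _ h => Subtype.ext h
        · intro e he
          simp only [Finset.mem_filter, Finset.mem_univ, true_and] at he
          exact ⟨⟨e, he.1⟩, by simpa using he.2, rfl⟩
      rw [h1]
      by_cases hvt : v.1 ≤ t.1
      · rw [hQ.simplicial.card_edges_between v.2 t.2 hvt]; rfl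
      · rw [Finset.filter_eq_empty_iff.2, Finset.card_empty, Nat.cast_zero]
        exact fun e _ h => hvt (h.2.1.trans h.2.2)
    rw [h0, Matrix.zero_mulVec]
  -- Euler's formula gives the opposite inequality of dimensions
  have heq : LinearMap.range D₂.mulVecLin = LinearMap.ker D₁.mulVecLin := by
    apply Submodule.eq_of_le_of_finrank_le hle
    have r1 := LinearMap.finrank_range_add_finrank_ker D₁.mulVecLin
    have r2 := LinearMap.finrank_range_add_finrank_ker D₂.mulVecLin
    have r3 := LinearMap.finrank_range_add_finrank_ker D₁.transpose.mulVecLin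
    have r4 : Module.finrank (ZMod 2) (LinearMap.range D₁.transpose.mulVecLin) =
        Module.finrank (ZMod 2) (LinearMap.range D₁.mulVecLin) := Matrix.rank_transpose D₁
    rw [Module.finrank_fintype_fun_eq_card] at r1 r2 r3
    omega
  have hzmem : (fun e : E => z e.1) ∈ LinearMap.ker D₁.mulVecLin := by
    rw [LinearMap.mem_ker, Matrix.mulVecLin_apply]
    funext v
    change ∑ e : E, (if v.1 ≤ e.1 then 1 else 0) * z e.1 = 0
    refine Eq.trans ?_ (hz v.1 v.2)
    simp_rw [ite_mul, one_mul, zero_mul]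
    rw [← Finset.sum_filter]
    refine Finset.sum_bij (fun e _ => e.1) ?_ ?_ ?_ (fun _ _ => rfl)
    · intro e he
      simp only [Finset.mem_filter, Finset.mem_univ, true_and] at he ⊢
      exact ⟨e.2, he⟩
    · exact fun e _ e' _ h => Subtype.ext h
    · intro e he
      simp only [Finset.mem_filter, Finset.mem_univ, true_and] at he
      exact ⟨⟨e, he.1⟩, by simpa using he.2, rfl⟩
  rw [← heq] at hzmem
  obtain ⟨a, ha⟩ := hzmem
  refine ⟨fun t => if h : Order.height t = 2 then a ⟨t, h⟩ else 0, ?_⟩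
  intro e t t' he ht ht' het het' htt
  simp only [ht, ht', dif_pos]
  rw [← hD₂ a ⟨e, he⟩ ⟨t, ht⟩ ⟨t', ht'⟩ het het' (fun h => htt (congrArg Subtype.val h))]
  exact congrFun ha ⟨e, he⟩

end Sphere

/-! ### Planar models of links -/

section Links

variable {d N : ℕ}

/-- The gluings of a list, read in both directions. -/
def glueSet (L : List (Gluing d N)) : Set (Gluing d N) := {g | g ∈ L ∨ g.symm ∈ L}

theorem symm_mem_glueSet {L : List (Gluing d N)} {g : Gluing d N} (h : g ∈ glueSet L) :
    g.symm ∈ glueSet L := by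
  rcases h with h | h
  · exact .inr (by rwa [Gluing.symm_symm])
  · exact .inl h

/-- A gluing, in either direction, identifies a face with its image. -/
theorem mk_map {L : List (Gluing d N)} {g : Gluing d N} (hg : g ∈ glueSet L)
    {S T : {S : Finset (Fin (d + 1)) // S.Nonempty}} (ha : g.a ∉ S.1)
    (hT : T.1 = S.1.map g.π.toEmbedding) : Face.mk L (g.j, T) = Face.mk L (g.i, S) := by
  rcases hg with hg | hg
  · exact (Face.mk_eq_iff.2 (.rel _ _ ⟨g, hg, rfl, ha, rfl, hT⟩)).symm
  · refine Face.mk_eq_iff.2 (.rel _ _ ⟨g.symm, hg, rfl, ?_, rfl, ?_⟩)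
    · simpa [Gluing.symm, hT] using ha
    · ext v; simp [Gluing.symm, hT]

namespace Side

/-- The vertices of the triangle of a side. -/
def verts (s : Side d N) : {S : Finset (Fin (d + 1)) // S.Nonempty} :=
  ⟨{s.a, s.b, s.c}, ⟨s.a, by simp⟩⟩

/-- The vertices of a side. -/
def ends (s : Side d N) : {S : Finset (Fin (d + 1)) // S.Nonempty} :=
  ⟨{s.b, s.c}, ⟨s.b, by simp⟩⟩

/-- The triangle of a side, as a face of the glued complex. -/
def triFace (L : List (Gluing d N)) (s : Side d N) : Face L := Face.mk L (s.k, s.verts)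

/-- A side, as a face of the glued complex. -/
def edgeFace (L : List (Gluing d N)) (s : Side d N) : Face L := Face.mk L (s.k, s.ends)

/-- The starting point of a side, as a face of the glued complex. -/
def startFace (L : List (Gluing d N)) (s : Side d N) : Face L := Face.mk L (s.k, vertexSet s.b)

theorem card_verts (s : Side d N) : s.verts.1.card = 3 :=
  Finset.card_eq_three.2 ⟨s.a, s.b, s.c, s.hab, s.hac, s.hbc, rfl⟩

theorem card_ends (s : Side d N) : s.ends.1.card = 2 := Finset.card_pair s.hbc

variable {L : List (Gluing d N)}

theorem height_triFace (s : Side d N) : Order.height (s.triFace L) = 2 := by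
  rw [triFace, Face.height_mk, card_verts]; rfl

theorem height_edgeFace (s : Side d N) : Order.height (s.edgeFace L) = 1 := by
  rw [edgeFace, Face.height_mk, card_ends]; rfl

theorem height_startFace (s : Side d N) : Order.height (s.startFace L) = 0 :=
  Order.height_eq_zero.2 (Face.isMin_vertex _ _)

theorem edgeFace_le (s : Side d N) : s.edgeFace L ≤ s.triFace L :=
  Face.mk_le_mk (Finset.subset_insert _ _)

theorem startFace_le (s : Side d N) : s.startFace L ≤ s.edgeFace L :=
  Face.mk_le_mk (by simp [vertexSet, ends])

@[simp] theorem triFace_rev (s : Side d N) : s.rev.triFace L = s.triFace L := by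
  have : s.rev.verts = s.verts := Subtype.ext (congrArg Prod.snd s.tri_rev)
  rw [triFace, this]; rfl

@[simp] theorem triFace_rot (s : Side d N) : s.rot.triFace L = s.triFace L := by
  have : s.rot.verts = s.verts := Subtype.ext (congrArg Prod.snd s.tri_rot)
  rw [triFace, this]; rfl

@[simp] theorem edgeFace_rev (s : Side d N) : s.rev.edgeFace L = s.edgeFace L := by
  have : s.rev.ends = s.ends := Subtype.ext (Finset.pair_comm _ _)
  rw [edgeFace, this]; rfl

theorem triFace_congr {s t : Side d N} (h : s.tri = t.tri) : s.triFace L = t.triFace L := by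
  have h1 : s.k = t.k := congrArg Prod.fst h
  have h2 : s.verts = t.verts := Subtype.ext (congrArg Prod.snd h)
  rw [triFace, triFace, h1, h2]

theorem edgeFace_congr {s t : Side d N} (h : s.edge = t.edge) : s.edgeFace L = t.edgeFace L := by
  have h1 : s.k = t.k := congrArg Prod.fst h
  have h2 : s.ends = t.ends := Subtype.ext (congrArg (fun e => e.2.2) h)
  rw [edgeFace, edgeFace, h1, h2]

theorem startFace_ne (hV : VerticesDistinct L) (s : Side d N) :
    s.startFace L ≠ s.rev.startFace L := fun h => s.hbc (hV _ _ _ (Face.mk_eq_iff.1 h))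

theorem edgeFace_map {g : Gluing d N} (hg : g ∈ glueSet L) {s : Side d N} (hs : s.facet = g.src) :
    (g.map s).edgeFace L = s.edgeFace L := by
  simp only [facet, Gluing.src, Prod.mk.injEq] at hs
  rw [edgeFace, edgeFace, hs.1]
  refine mk_map hg ?_ ?_
  · simp [ends, ← hs.2, s.hab, s.hac]
  · simp [ends, Gluing.map, Finset.map_insert]

theorem startFace_map {g : Gluing d N} (hg : g ∈ glueSet L) {s : Side d N}
    (hs : s.facet = g.src) : (g.map s).startFace L = s.startFace L := by
  simp only [facet, Gluing.src, Prod.mk.injEq] at hs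
  rw [startFace, startFace, hs.1]
  refine mk_map hg ?_ ?_
  · simp [vertexSet, ← hs.2, s.hab]
  · simp [vertexSet, Gluing.map]

theorem edge_eq_of_tri_eq_of_ends_eq {s t : Side d N} (h : s.tri = t.tri) (h' : s.ends = t.ends) :
    s.edge = t.edge := by
  have h1 : s.k = t.k := congrArg Prod.fst h
  have h2 : ({s.b, s.c} : Finset (Fin (d + 1))) = {t.b, t.c} := congrArg Subtype.val h'
  have h3 : s.a = t.a := by
    have h4 : s.a ∈ t.tri.2 := by rw [← h]; simp [tri]
    have h5 : s.a ∉ ({t.b, t.c} : Finset (Fin (d + 1))) := by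
      rw [← h2]; simp [s.hab, s.hac]
    simp only [tri, Finset.mem_insert, Finset.mem_singleton] at h4 h5
    tauto
  simp [edge, h1, h2, h3]

end Side

/-- The triangles, in the single simplices, that make up the link of the `(d-3)`-face `δ`. -/
def linkTriangles (L : List (Gluing d N)) (δ : Face L) : Set (Fin N × Finset (Fin (d + 1))) :=
  {t | ∃ h : t.2ᶜ.Nonempty, Face.mk L (t.1, ⟨t.2ᶜ, h⟩) = δ}

theorem mem_link_of_mem_linkTriangles {L : List (Gluing d N)} (hV : VerticesDistinct L)
    {δ : Face L} {t : Fin N × Finset (Fin (d + 1))} (ht : t ∈ linkTriangles L δ)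
    {S : {S : Finset (Fin (d + 1)) // S.Nonempty}} (hS : S.1 ⊆ t.2) :
    Face.mk L (t.1, S) ∈ link δ := by
  obtain ⟨h, rfl⟩ := ht
  refine ⟨⟨Face.mk L (t.1, ⟨Finset.univ, Finset.univ_nonempty⟩),
    Face.mk_le_mk (Finset.subset_univ _), Face.mk_le_mk (Finset.subset_univ _)⟩, ?_⟩
  rintro ⟨v, hv₁, hv₂⟩
  obtain ⟨A, hA, rfl⟩ := Face.le_mk_iff.1 hv₁
  obtain ⟨B, hB, hAB⟩ := Face.le_mk_iff.1 hv₂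
  obtain rfl := hV.face_eq (Face.mk_eq_iff.1 hAB)
  obtain ⟨x, hx⟩ := B.2
  exact Finset.mem_compl.1 (hA hx) (hS (hB hx))

theorem map_mem_linkTriangles {L : List (Gluing d N)} {δ : Face L} {g : Gluing d N}
    (hg : g ∈ glueSet L) {s : Side d N} (hs : s.facet = g.src) (h : s.tri ∈ linkTriangles L δ) :
    (g.map s).tri ∈ linkTriangles L δ := by
  obtain ⟨h, rfl⟩ := h
  simp only [Side.facet, Gluing.src, Prod.mk.injEq] at hs
  have hc : (g.map s).tri.2ᶜ = s.tri.2ᶜ.map g.π.toEmbedding := by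
    ext v
    simp [Side.tri, Gluing.map, ← Equiv.symm_apply_eq]
  have hne : (g.map s).tri.2ᶜ.Nonempty := by rw [hc]; exact h.map
  refine ⟨hne, ?_⟩
  have := mk_map (S := ⟨s.tri.2ᶜ, h⟩) (T := ⟨(g.map s).tri.2ᶜ, hne⟩) hg
    (by simp [Side.tri, hs.2]) hc
  rw [show (g.map s).tri.1 = g.j from rfl, this, show s.tri.1 = g.i from hs.1]

/-- In the link of a `(d-3)`-face, different triangles of simplices are different faces of the
glued complex. -/
def TrianglesDistinct (L : List (Gluing d N)) : Prop :=
  ∀ δ : Face L, Order.height δ + 3 = d → ∀ s s' : Side d N, s.tri ∈ linkTriangles L δ →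
    s'.tri ∈ linkTriangles L δ → s.triFace L = s'.triFace L → s.tri = s'.tri

theorem height_of_lt_of_lt {Q : Type} [PartialOrder Q] {a b c : Q} (hab : a < b) (hbc : b < c)
    (hc : Order.height c = 2) : Order.height a = 0 ∧ Order.height b = 1 := by
  have h1 := Order.height_add_one_le hab
  have h2 := Order.height_add_one_le hbc
  rw [hc] at h2
  have hb : Order.height b ≠ ⊤ := by
    intro h; rw [h] at h2; simp at h2
  obtain ⟨n, hn⟩ := ENat.ne_top_iff_exists.1 hb
  have ha : Order.height a ≠ ⊤ := by
    intro h; rw [h, ← hn] at h1; simp at h1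
  obtain ⟨m, hm⟩ := ENat.ne_top_iff_exists.1 ha
  rw [← hn, ← hm] at h1
  rw [← hn] at h2
  rw [← hn, ← hm]
  have h1' : m + 1 ≤ n := by exact_mod_cast h1
  have h2' : n + 1 ≤ 2 := by exact_mod_cast h2
  have h3 : m = 0 := by omega
  have h4 : n = 1 := by omega
  subst h3; subst h4
  exact ⟨rfl, rfl⟩

open Classical in
/-- The endpoints of the sides of a walk cancel modulo 2, except for its own endpoints. -/
theorem walk_sum {V : Type} {f : Side d N → V} {K : List (Side d N)} {p q : V}
    (h : Walk f p K q) (v : V) :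
    (K.map fun s => (if f s = v then 1 else 0) + (if f s.rev = v then 1 else 0 : ZMod 2)).sum =
      (if p = v then 1 else 0) + (if q = v then 1 else 0) := by
  induction K generalizing p with
  | nil => rw [show p = q from h]; simp [CharTwo.add_self_eq_zero]
  | cons s K ih =>
    rw [List.map_cons, List.sum_cons, ih h.2, h.1]
    have := CharTwo.add_self_eq_zero (if f s.rev = v then (1 : ZMod 2) else 0)
    linear_combination this

theorem sum_list_sum {α β : Type} (F : Finset α) (K : List β) (f : β → α → ZMod 2) :
    ∑ e ∈ F, (K.map fun s => f s e).sum = (K.map fun s => ∑ e ∈ F, f s e).sum := by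
  induction K with
  | nil => simp
  | cons s K ih => simp [Finset.sum_add_distrib, ih]

open Classical in
/-- If at most the elements `x` and `y` have the image `q`, then the number of times, modulo 2, that
`q` occurs is given by the occurrences of `x` and `y`. -/
theorem sum_ite_eq_of_nodup {α β γ : Type} (K : List β) (E : β → α) (edge : β → γ) (q : α)
    (x y : γ) (hxy : x ≠ y) (h : ∀ s ∈ K, E s = q ↔ edge s = x ∨ edge s = y)
    (hK : (K.map edge).Nodup) :
    (K.map fun s => if E s = q then (1 : ZMod 2) else 0).sum =
      (if x ∈ K.map edge then 1 else 0) + (if y ∈ K.map edge then 1 else 0) := by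
  induction K with
  | nil => simp
  | cons s K ih =>
    have h1 := h s (List.mem_cons_self ..)
    rw [List.map_cons, List.nodup_cons] at hK
    rw [List.map_cons, List.sum_cons, ih (fun s hs => h s (List.mem_cons_of_mem _ hs)) hK.2,
      List.map_cons]
    by_cases hx : edge s = x
    · have hxK : x ∉ K.map edge := hx ▸ hK.1
      have hys : ¬ y = edge s := fun h => hxy (hx.symm.trans h.symm)
      rw [if_pos (h1.2 (.inl hx)), if_neg hxK, zero_add, hx]
      simp only [List.mem_cons, true_or, if_true, hxy.symm, false_or]
    · by_cases hy : edge s = y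
      · have hyK : y ∉ K.map edge := hy ▸ hK.1
        rw [if_pos (h1.2 (.inr hy)), if_neg hyK, add_zero, hy, add_comm]
        simp only [List.mem_cons, true_or, if_true, hxy, false_or]
      · rw [if_neg (fun h => by rcases h1.1 h with h | h <;> contradiction), zero_add]
        simp only [List.mem_cons, Ne.symm (Ne.intro hx), Ne.symm (Ne.intro hy), false_or]

open Classical in
/-- A planar and orientable link has a planar oriented model. The vertices of the model are those of
the sphere; vertices of the link where triangles have been pulled apart are distinguished. -/
theorem exists_linkModel {L : List (Gluing d N)} (hV : VerticesDistinct L)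
    (hT : TrianglesDistinct L) (hne : ∀ g ∈ glueSet L, g.i ≠ g.j) (δ : Face L)
    (hδ : Order.height δ + 3 = d) (hO : Orientable (link δ)) (hP : Planar (link δ)) :
    Nonempty (LinkModel (glueSet L) (linkTriangles L δ)) := by
  obtain ⟨Q, _, hQ, φ, hφ, hφ'⟩ := hP
  obtain ⟨o, ho, ho'⟩ := hO
  have : Finite Q := hQ.simplicial.1
  let _ : Fintype Q := Fintype.ofFinite Q
  set C := linkTriangles L δ with hC
  have htri : ∀ s : Side d N, s.tri ∈ C → s.triFace L ∈ link δ := fun s hs =>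
    mem_link_of_mem_linkTriangles hV hs (S := s.verts) subset_rfl
  have hedge : ∀ s : Side d N, s.tri ∈ C → s.edgeFace L ∈ link δ := fun s hs =>
    mem_link_of_mem_linkTriangles hV hs (S := s.ends) (Finset.subset_insert _ _)
  have hclosed : ∀ g ∈ glueSet L, ∀ s : Side d N, s.facet = g.src → s.tri ∈ C →
      (g.map s).tri ∈ C := fun g hg s hs h => map_mem_linkTriangles hg hs h
  have htne : ∀ g ∈ glueSet L, ∀ s : Side d N, s.facet = g.src → s.tri ∈ C →
      s.triFace L ≠ (g.map s).triFace L := by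
    intro g hg s hs h heq
    have h1 := hT δ hδ s (g.map s) h (hclosed g hg s hs h) heq
    have h2 : s.k = g.j := congrArg Prod.fst h1
    have h3 : s.k = g.i := congrArg Prod.fst hs
    exact hne g hg (h3.symm.trans h2)
  have hcommon : ∀ g ∈ glueSet L, ∀ s : Side d N, s.facet = g.src → s.tri ∈ C →
      ∀ x ≤ s.edgeFace L, φ (s.triFace L) x = φ ((g.map s).triFace L) x := by
    intro g hg s hs h
    refine (hφ' _ (htri s h) _ (htri _ (hclosed g hg s hs h)) s.height_triFace
      (Side.height_triFace _) (htne g hg s hs h)).2 _ (hedge s h) s.height_edgeFace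
      s.edgeFace_le ?_
    rw [← Side.edgeFace_map hg hs]
    exact Side.edgeFace_le _
  have hlt : ∀ s : Side d N, s.tri ∈ C → ∀ x y, x < y → y ≤ s.triFace L →
      φ (s.triFace L) x < φ (s.triFace L) y := by
    intro s hs x y hxy hy
    have h1 := (hφ _ (htri s hs) s.height_triFace).2
    rw [lt_iff_le_not_ge, h1 x (hxy.le.trans hy) y hy, h1 y hy x (hxy.le.trans hy)]
    exact ⟨hxy.le, hxy.not_ge⟩
  have hElt : ∀ s : Side d N, s.edgeFace L < s.triFace L := fun s =>
    lt_of_le_of_ne s.edgeFace_le fun h => by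
      have h1 := s.height_edgeFace (L := L)
      rw [h, s.height_triFace] at h1
      exact absurd h1 (by norm_num)
  have hSlt : ∀ s : Side d N, s.startFace L < s.edgeFace L := fun s =>
    lt_of_le_of_ne s.startFace_le fun h => by
      have h1 := s.height_startFace (L := L)
      rw [h, s.height_edgeFace] at h1
      exact absurd h1 (by norm_num)
  let start : Side d N → Q := fun s => φ (s.triFace L) (s.startFace L)
  let E : Side d N → Q := fun s => φ (s.triFace L) (s.edgeFace L)
  let F : Side d N → Q := fun s => φ (s.triFace L) (s.triFace L)
  have hF2 : ∀ s : Side d N, s.tri ∈ C → Order.height (F s) = 2 := fun s hs =>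
    (hφ _ (htri s hs) s.height_triFace).1
  have hEF : ∀ s : Side d N, s.tri ∈ C → E s < F s := fun s hs =>
    hlt s hs _ _ (hElt s) le_rfl
  have hSE : ∀ s : Side d N, s.tri ∈ C → start s < E s := fun s hs =>
    hlt s hs _ _ (hSlt s) s.edgeFace_le
  have hErev : ∀ s : Side d N, E s.rev = E s := fun s => by simp [E]
  have hSE' : ∀ s : Side d N, s.tri ∈ C → start s.rev < E s := fun s hs => by
    rw [← hErev]; exact hSE s.rev (by simpa using hs)
  have hE1 : ∀ s : Side d N, s.tri ∈ C → Order.height (E s) = 1 := fun s hs =>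
    (height_of_lt_of_lt (hSE s hs) (hEF s hs) (hF2 s hs)).2
  have hS0 : ∀ s : Side d N, s.tri ∈ C → Order.height (start s) = 0 := fun s hs =>
    (height_of_lt_of_lt (hSE s hs) (hEF s hs) (hF2 s hs)).1
  have hS0' : ∀ s : Side d N, s.tri ∈ C → Order.height (start s.rev) = 0 := fun s hs =>
    hS0 s.rev (by simpa using hs)
  have hinj : ∀ s : Side d N, s.tri ∈ C → ∀ x y, x ≤ s.triFace L → y ≤ s.triFace L →
      φ (s.triFace L) x = φ (s.triFace L) y → x = y := by
    intro s hs x y hx hy hxy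
    have h1 := (hφ _ (htri s hs) s.height_triFace).2
    exact le_antisymm ((h1 x hx y hy).1 hxy.le) ((h1 y hy x hx).1 hxy.ge)
  have hSne : ∀ s : Side d N, s.tri ∈ C → start s ≠ start s.rev := by
    intro s hs h
    have h' : φ (s.triFace L) (s.startFace L) = φ (s.triFace L) (s.rev.startFace L) := by
      simpa [start] using h
    refine s.startFace_ne hV (hinj s hs _ _ (s.startFace_le.trans s.edgeFace_le) ?_ h')
    rw [← Side.triFace_rev]
    exact s.rev.startFace_le.trans s.rev.edgeFace_le
  refine ⟨⟨Q, start, fun s => o (s.triFace L) (s.startFace L) (s.rev.startFace L), hclosed,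
    ?_, ?_, ?_, ?_, ?_, ?_⟩⟩
  · intro g hg s hs h
    change φ _ _ = φ _ _
    rw [Side.startFace_map hg hs, hcommon g hg s hs h _ s.startFace_le]
  · intro s _
    change φ _ _ = φ _ _
    rw [Side.triFace_rot, Side.triFace_rev]
    rfl
  all_goals
    have hverts : ∀ s : Side d N, ∀ v ∈ s.verts.1, Face.mk L (s.k, vertexSet v) ≤ s.triFace L :=
      fun s v hv => Face.mk_le_mk (by simpa [vertexSet] using hv)
    have hvne : ∀ (k : Fin N) (v w : Fin (d + 1)), v ≠ w →
        Face.mk L (k, vertexSet v) ≠ Face.mk L (k, vertexSet w) :=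
      fun k v w hvw h => hvw (hV _ _ _ (Face.mk_eq_iff.1 h))
    have horient := fun (s : Side d N) (hs : s.tri ∈ C) =>
      ho _ (htri s hs) s.height_triFace (s.startFace L) (s.rev.startFace L)
        (Face.mk L (s.k, vertexSet s.a)) (Face.isMin_vertex _ _) (Face.isMin_vertex _ _)
        (Face.isMin_vertex _ _) (hverts s _ (by simp [Side.verts]))
        (hverts s _ (by simp [Side.verts, Side.rev])) (hverts s _ (by simp [Side.verts]))
        (s.startFace_ne hV) (hvne _ _ _ s.hac.symm) (hvne _ _ _ s.hab.symm)
  · intro s hs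
    rw [Side.triFace_rev, Side.rev_rev]
    have := (horient s hs).1
    tauto
  · intro s hs h
    rw [Side.triFace_rot]
    exact (horient s hs).2 h
  · intro g hg s hs h
    have h1 := ho' _ (htri s h) _ (htri _ (hclosed g hg s hs h)) _ (hedge s h) s.height_triFace
      (Side.height_triFace _) s.height_edgeFace (htne g hg s hs h) s.edgeFace_le
      (by rw [← Side.edgeFace_map hg hs]; exact Side.edgeFace_le _)
      (s.startFace L) (s.rev.startFace L) (Face.isMin_vertex _ _) (Face.isMin_vertex _ _)
      (s.startFace_ne hV) s.startFace_le
      (by rw [← Side.edgeFace_rev]; exact s.rev.startFace_le)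
    have h2 := (horient _ (hclosed g hg s hs h)).1
    rw [Side.startFace_map hg hs, ← Gluing.map_rev, Side.startFace_map (s := s.rev) hg hs] at h2 ⊢
    tauto
  · rintro K hK hnd ⟨p, hp⟩
    -- the walk, as a cycle of edges modulo 2 on the sphere
    let z : Q → ZMod 2 := fun q => (K.map fun s => if E s = q then (1 : ZMod 2) else 0).sum
    have hz : ∀ v : Q, Order.height v = 0 →
        ∑ e ∈ Finset.univ.filter (fun e : Q => Order.height e = 1 ∧ v ≤ e), z e = 0 := by
      intro v hv
      rw [sum_list_sum]
      have h1 : ∀ s ∈ K, (∑ e ∈ Finset.univ.filter (fun e : Q => Order.height e = 1 ∧ v ≤ e),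
          if E s = e then (1 : ZMod 2) else 0) =
          (if start s = v then 1 else 0) + (if start s.rev = v then 1 else 0) := by
        intro s hs
        have hsC := hK s hs
        rw [Finset.sum_ite_eq]
        simp only [Finset.mem_filter, Finset.mem_univ, true_and, hE1 s hsC]
        by_cases hv1 : start s = v
        · rw [if_pos (hv1 ▸ (hSE s hsC).le), if_pos hv1,
            if_neg (fun h => hSne s hsC (hv1.trans h.symm)), add_zero]
        · by_cases hv2 : start s.rev = v
          · rw [if_pos (hv2 ▸ (hSE' s hsC).le), if_pos hv2, if_neg hv1, zero_add]
          · rw [if_neg hv1, if_neg hv2, if_neg, add_zero]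
            intro hve
            rcases hQ.simplicial.eq_or_eq_of_edge (hE1 s hsC) (hSE s hsC).le (hSE' s hsC).le hve
              (hS0 s hsC) (hS0' s hsC) hv (hSne s hsC) with h | h
            · exact hv1 h.symm
            · exact hv2 h.symm
      rw [List.map_congr_left h1, walk_sum hp v, CharTwo.add_self_eq_zero]
    obtain ⟨A, hA⟩ := hQ.exists_filling z hz
    refine ⟨fun t => if h : t.2.Nonempty then
      A (φ (Face.mk L (t.1, ⟨t.2, h⟩)) (Face.mk L (t.1, ⟨t.2, h⟩))) else 0, ?_⟩
    intro g hg s hs h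
    have hAF : ∀ s : Side d N, (if h : s.tri.2.Nonempty then
        A (φ (Face.mk L (s.tri.1, ⟨s.tri.2, h⟩)) (Face.mk L (s.tri.1, ⟨s.tri.2, h⟩))) else 0) =
        A (F s) := fun s => dif_pos s.verts.2
    have hgC := hclosed g hg s hs h
    have hEg : E (g.map s) = E s := by
      change φ _ _ = φ _ _
      rw [Side.edgeFace_map hg hs, hcommon g hg s hs h _ le_rfl]
    have hFne : F s ≠ F (g.map s) := (hφ' _ (htri s h) _ (htri _ hgC) s.height_triFace
      (Side.height_triFace _) (htne g hg s hs h)).1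
    have hFE' : E s ≤ F (g.map s) := hEg ▸ (hEF _ hgC).le
    have hfill := hA (E s) (F s) (F (g.map s)) (hE1 s h) (hF2 s h) (hF2 _ hgC) (hEF s h).le
      hFE' hFne
    have hFinj : ∀ s' s : Side d N, s'.tri ∈ C → s.tri ∈ C → F s' = F s → E s' = E s →
        s'.edge = s.edge := by
      intro s' s hs' hs hF hE
      have h1 : s'.triFace L = s.triFace L := by
        by_contra hne'
        exact (hφ' _ (htri s' hs') _ (htri s hs) s'.height_triFace s.height_triFace hne').1 hF
      have h2 := hT δ hδ s' s hs' hs h1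
      refine Side.edge_eq_of_tri_eq_of_ends_eq h2 ?_
      have h3 : s'.edgeFace L = s.edgeFace L := by
        refine hinj s hs _ _ (h1 ▸ s'.edgeFace_le) s.edgeFace_le ?_
        have h4 : φ (s'.triFace L) (s'.edgeFace L) = φ (s.triFace L) (s.edgeFace L) := hE
        rwa [h1] at h4
      have h5 : s'.k = s.k := congrArg Prod.fst h2
      rw [Side.edgeFace, Side.edgeFace, h5] at h3
      exact hV.face_eq (Face.mk_eq_iff.1 h3)
    -- the edge of the sphere at the glued pair lies in the two triangles of the pair only
    have hcount := sum_ite_eq_of_nodup K E Side.edge (E s) s.edge (g.map s).edge ?_ ?_ hnd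
    · refine Eq.trans ?_ ((hfill.trans hcount).trans ?_)
      · exact congrArg₂ (· + ·) (hAF s) (hAF (g.map s))
      · congr
    · intro h1
      have h2 : s.k = g.j := congrArg Prod.fst h1
      have h3 : s.k = g.i := congrArg Prod.fst hs
      exact hne g hg (h3.symm.trans h2)
    · intro s' hs'
      have hs'C := hK s' hs'
      have hEcongr : ∀ t : Side d N, s'.edge = t.edge → E s' = E t := fun t ht => by
        change φ _ _ = φ _ _
        rw [Side.triFace_congr (Side.tri_eq_of_edge_eq ht), Side.edgeFace_congr ht]
      constructor
      · intro hE
        rcases hQ.eq_or_eq (hE1 s h) (hF2 s h) (hF2 _ hgC) (hF2 s' hs'C) (hEF s h).le hFE'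
          (hE ▸ (hEF s' hs'C).le) hFne with h1 | h1
        · exact .inl (hFinj s' s hs'C h h1 hE)
        · exact .inr (hFinj s' _ hs'C hgC h1 (hE.trans hEg.symm))
      · rintro (h1 | h1)
        · exact hEcongr s h1
        · exact (hEcongr _ h1).trans hEg

end Links

/-! ### Trees of simplices -/

section Trees

variable {d N : ℕ}

/-- A function on a rooted tree can be defined recursively from the root. -/
theorem exists_recursive {ι α : Type} (h : ι → ℕ) (par : ι → ι) (r : ι)
    (hp : ∀ v, v ≠ r → h (par v) < h v) (F : ι → α → α) (a : α) :
    ∃ ρ : ι → α, ρ r = a ∧ ∀ v, v ≠ r → ρ v = F v (ρ (par v)) := by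
  classical
  let ρ : ι → α := (measure h).wf.fix (C := fun _ => α)
    fun v ih => if hv : v = r then a else F v (ih (par v) (hp v hv))
  refine ⟨ρ, ?_, fun v hv => ?_⟩
  · change (measure h).wf.fix _ _ = _
    rw [WellFounded.fix_eq, dif_pos rfl]
  · change (measure h).wf.fix _ _ = _
    rw [WellFounded.fix_eq, dif_neg hv]

/-- In a tree of simplices, every simplex but the root `r` is attached to a parent by a gluing `γ v`
that leads to it, and these are all gluings, as there are only `N - 1` of them. -/
theorem IsTreeOfSimplices.exists_parent {T : List (Gluing d N)} (hT : IsTreeOfSimplices T)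
    (r : Fin N) : ∃ (h : Fin N → ℕ) (γ : Fin N → Gluing d N),
      (∀ v, v ≠ r → γ v ∈ glueSet T ∧ (γ v).j = v ∧ h (γ v).i < h v) ∧
      ∀ g ∈ glueSet T, ∃ v, v ≠ r ∧ (g = γ v ∨ g = (γ v).symm) := by
  classical
  obtain ⟨hlen, -, hconn⟩ := hT
  set Γ := SimpleGraph.fromRel fun k l : Fin N => ∃ g ∈ T, g.i = k ∧ g.j = l with hΓ
  have hex : ∀ v, ∃ g : Gluing d N, v ≠ r → g ∈ glueSet T ∧ g.j = v ∧
      Γ.dist g.i r < Γ.dist v r := by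
    intro v
    by_cases hv : v = r
    · exact ⟨⟨v, v, 0, 1⟩, fun h => absurd hv h⟩
    · obtain ⟨p, hp⟩ := hconn.exists_walk_length_eq_dist v r
      cases p with
      | nil => exact absurd rfl hv
      | cons hadj p =>
        rename_i u
        have hlt : Γ.dist u r < Γ.dist v r := by
          rw [← hp, SimpleGraph.Walk.length_cons]
          exact Nat.lt_succ_of_le (SimpleGraph.dist_le p)
        rw [hΓ, SimpleGraph.fromRel_adj] at hadj
        rcases hadj.2 with ⟨g, hg, h1, h2⟩ | ⟨g, hg, h1, h2⟩
        · exact ⟨g.symm, fun _ => ⟨.inr (by rwa [Gluing.symm_symm]), h1, by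
            rw [show g.symm.i = g.j from rfl, h2]; exact hlt⟩⟩
        · exact ⟨g, fun _ => ⟨.inl hg, h2, by rw [h1]; exact hlt⟩⟩
  choose γ hγ using hex
  refine ⟨fun v => Γ.dist v r, γ, hγ, ?_⟩
  have hτ : ∀ v, ∃ t : Gluing d N, v ≠ r → t ∈ T ∧ (γ v = t ∨ γ v = t.symm) := by
    intro v
    by_cases hv : v = r
    · exact ⟨γ v, fun h => absurd hv h⟩
    · rcases (hγ v hv).1 with h | h
      · exact ⟨γ v, fun _ => ⟨h, .inl rfl⟩⟩
      · exact ⟨(γ v).symm, fun _ => ⟨h, .inr (Gluing.symm_symm _).symm⟩⟩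
  choose τ hτ using hτ
  have hinj : Set.InjOn τ (Finset.univ.erase r : Finset (Fin N)) := by
    intro v hv w hw hvw
    have hv' : v ≠ r := by simpa using hv
    have hw' : w ≠ r := by simpa using hw
    obtain ⟨-, h1, h2⟩ := hγ v hv'
    obtain ⟨-, h3, h4⟩ := hγ w hw'
    have h5 := (hτ v hv').2
    have h6 := (hτ w hw').2
    rw [← hvw] at h6
    have h7 : γ v = γ w ∨ γ v = (γ w).symm := by
      rcases h5 with h5 | h5 <;> rcases h6 with h6 | h6 <;> rw [h5, h6]
      · exact .inl rfl
      · exact .inr (Gluing.symm_symm _).symm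
      · exact .inr rfl
      · exact .inl rfl
    rcases h7 with h7 | h7
    · rw [← h1, ← h3, h7]
    · have h8 : (γ v).i = w := by rw [h7]; exact h3
      have h9 : (γ w).i = v := by
        rw [← h1, h7]; rfl
      rw [h8] at h2
      rw [h9] at h4
      exact absurd h2 h4.not_gt
  -- as there are `N - 1` gluings, each of them leads to some simplex
  have himage : (Finset.univ.erase r : Finset (Fin N)).image τ = T.toFinset := by
    apply Finset.eq_of_subset_of_card_le
    · intro t ht
      obtain ⟨v, hv, rfl⟩ := Finset.mem_image.1 ht
      exact List.mem_toFinset.2 (hτ v (by simpa using hv)).1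
    · rw [Finset.card_image_of_injOn hinj, Finset.card_erase_of_mem (Finset.mem_univ _),
        Finset.card_univ, Fintype.card_fin]
      exact (List.toFinset_card_le T).trans (by omega)
  intro g hg
  have hT' : ∀ t ∈ T, ∃ v, v ≠ r ∧ (t = γ v ∨ t = (γ v).symm) := by
    intro t ht
    rw [← List.mem_toFinset, ← himage] at ht
    obtain ⟨v, hv, rfl⟩ := Finset.mem_image.1 ht
    have hv' : v ≠ r := by simpa using hv
    refine ⟨v, hv', ?_⟩
    rcases (hτ v hv').2 with h | h
    · exact .inl h.symm
    · exact .inr (by rw [h, Gluing.symm_symm])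
  rcases hg with hg | hg
  · exact hT' g hg
  · obtain ⟨v, hv, h | h⟩ := hT' _ hg
    · exact ⟨v, hv, .inr (by rw [← h, Gluing.symm_symm])⟩
    · refine ⟨v, hv, .inl ?_⟩
      rw [← Gluing.symm_symm g, h, Gluing.symm_symm]

theorem IsTreeOfSimplices.root {T : List (Gluing d N)} (hT : IsTreeOfSimplices T) : 0 < N := by
  have := hT.1; omega

theorem IsTreeOfSimplices.ne {T : List (Gluing d N)} (hT : IsTreeOfSimplices T) {g : Gluing d N}
    (hg : g ∈ glueSet T) : g.i ≠ g.j := by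
  obtain ⟨h, γ, hγ, hall⟩ := hT.exists_parent ⟨0, hT.root⟩
  obtain ⟨v, hv, hgv⟩ := hall g hg
  obtain ⟨-, h1, h2⟩ := hγ v hv
  have h3 : (γ v).i ≠ (γ v).j := fun h => by rw [h, h1] at h2; exact lt_irrefl _ h2
  rcases hgv with rfl | rfl
  exacts [h3, h3.symm]

/-- A tree of simplices can be folded onto one simplex, so vertices of one simplex are distinct. -/
theorem IsTreeOfSimplices.verticesDistinct {T : List (Gluing d N)} (hT : IsTreeOfSimplices T) :
    VerticesDistinct T := by
  obtain ⟨h, γ, hγ, hall⟩ := hT.exists_parent ⟨0, hT.root⟩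
  -- the folding map
  obtain ⟨ρ, -, hρ⟩ := exists_recursive h (fun v => (γ v).i) _ (fun v hv => (hγ v hv).2.2)
    (fun v (p : Equiv.Perm (Fin (d + 1))) => p * (γ v).π⁻¹) 1
  have hcompat : ∀ g ∈ T, ∀ v, ρ g.j (g.π v) = ρ g.i v := by
    intro g hg v
    obtain ⟨w, hw, rfl | rfl⟩ := hall g (.inl hg)
    · rw [(hγ w hw).2.1, hρ w hw]; simp
    · change ρ (γ w).i ((γ w).π.symm v) = ρ (γ w).j v
      rw [(hγ w hw).2.1, hρ w hw]; rfl
  have hinv : ∀ x y : RawFace d N, Relation.EqvGen (Step T) x y →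
      x.2.1.map (ρ x.1).toEmbedding = y.2.1.map (ρ y.1).toEmbedding := by
    intro x y hxy
    induction hxy with
    | rel x y hxy =>
      obtain ⟨g, hg, h1, -, h2, h3⟩ := hxy
      rw [h3, h1, h2, Finset.map_map]
      congr 1
      ext v
      simp [hcompat g hg v]
    | refl => rfl
    | symm _ _ _ ih => exact ih.symm
    | trans _ _ _ _ _ ih₁ ih₂ => exact ih₁.trans ih₂
  intro k v w hvw
  have := hinv _ _ hvw
  simpa [vertexSet] using this

/-- If two simplices of a tree share a face, then this face lies in the facet of the first simplex
that leads towards the second. A triangle and the complementary `(d-3)`-face cannot both avoid the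
vertex opposite to this facet, so triangles of one link in different simplices are different. -/
theorem IsTreeOfSimplices.trianglesDistinct {T : List (Gluing d N)} (hT : IsTreeOfSimplices T) :
    TrianglesDistinct T := by
  have hV := hT.verticesDistinct
  rintro δ - s s' ⟨h₁, hs⟩ ⟨h₂, hs'⟩ htri
  by_cases hk : s.k = s'.k
  · have h1 : s.verts = s'.verts := by
      rw [Side.triFace, Side.triFace, hk] at htri
      exact hV.face_eq (Face.mk_eq_iff.1 htri)
    exact Prod.ext hk (congrArg Subtype.val h1)
  exfalso
  obtain ⟨h, γ, hγ, hall⟩ := hT.exists_parent s'.k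
  let R : Fin N → Fin N → Prop := fun v p => v ≠ s'.k ∧ p = (γ v).i
  -- the simplices that are separated from the simplex of `s'` by the simplex of `s`
  let U : Set (Fin N) := {u | Relation.ReflTransGen R u s.k}
  have hU₁ : s.k ∈ U := Relation.ReflTransGen.refl
  have hU₂ : s'.k ∉ U := by
    intro hU
    rcases Relation.ReflTransGen.cases_head hU with h | ⟨c, hc, -⟩
    · exact hk h.symm
    · exact hc.1 rfl
  have hU₃ : ∀ v, v ≠ s'.k → v ≠ s.k → (v ∈ U ↔ (γ v).i ∈ U) := by
    intro v hv hvs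
    constructor
    · intro hU
      rcases Relation.ReflTransGen.cases_head hU with h | ⟨c, hc, h⟩
      · exact absurd h hvs
      · rw [← hc.2]; exact h
    · exact fun hU => Relation.ReflTransGen.head ⟨hv, rfl⟩ hU
  set f := (γ s.k).π (γ s.k).a with hf
  -- identifications between `U` and the rest pass through the facet opposite to `f`
  have key : ∀ x y : RawFace d N, Relation.EqvGen (Step T) x y → (x.1 ∈ U ↔ y.1 ∈ U) ∨
      ∃ F : {S : Finset (Fin (d + 1)) // S.Nonempty}, f ∉ F.1 ∧
        Relation.EqvGen (Step T) x (s.k, F) := by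
    intro x y hxy
    induction hxy with
    | rel x y hxy =>
      obtain ⟨g, hg, h1, h2, h3, h4⟩ := id hxy
      obtain ⟨v, hv, hgv⟩ := hall g (.inl hg)
      obtain ⟨-, h5, -⟩ := hγ v hv
      by_cases hvs : v = s.k
      · right
        subst hvs
        rcases hgv with rfl | rfl
        · refine ⟨y.2, ?_, ?_⟩
          · rw [h4, hf]; simpa using h2
          · have : y = (s.k, y.2) := Prod.ext (h3.trans h5) rfl
            rw [← this]
            exact .rel _ _ hxy
        · refine ⟨x.2, h2, ?_⟩
          have : x = (s.k, x.2) := Prod.ext (h1.trans h5) rfl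
          rw [← this]
          exact .refl _
      · left
        rcases hgv with rfl | rfl
        · rw [h1, h3, h5, hU₃ v hv hvs]
        · rw [h1, h3]
          change (γ v).j ∈ U ↔ (γ v).i ∈ U
          rw [h5, hU₃ v hv hvs]
    | refl => exact .inl Iff.rfl
    | symm x y hxy ih =>
      rcases ih with ih | ⟨F, hF, hxF⟩
      · exact .inl ih.symm
      · exact .inr ⟨F, hF, (hxy.symm).trans _ _ _ hxF⟩
    | trans x y z hxy _ ih₁ ih₂ =>
      rcases ih₁ with ih₁ | ih₁
      · rcases ih₂ with ih₂ | ⟨F, hF, hyF⟩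
        · exact .inl (ih₁.trans ih₂)
        · exact .inr ⟨F, hF, hxy.trans _ _ _ hyF⟩
      · exact .inr ih₁
  have hcross : ∀ S S' : {S : Finset (Fin (d + 1)) // S.Nonempty},
      Face.mk T (s.k, S) = Face.mk T (s'.k, S') → f ∉ S.1 := by
    intro S S' hSS
    rcases key _ _ (Face.mk_eq_iff.1 hSS) with h | ⟨F, hF, hSF⟩
    · exact absurd (h.1 hU₁) hU₂
    · rw [hV.face_eq hSF]; exact hF
  have c₁ := hcross _ _ htri
  have c₂ := hcross ⟨_, h₁⟩ ⟨_, h₂⟩ (hs.trans hs'.symm)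
  exact c₂ (Finset.mem_compl.2 c₁)

end Trees

/-! ### The combinatorial properties of quasimanifolds -/

section Construct

variable {d N : ℕ}

theorem exists_side {k : Fin N} {a : Fin (d + 1)} {S : Finset (Fin (d + 1))}
    (hS : S.card + 2 = d) (ha : a ∉ S) : ∃ s : Side d N, s.facet = (k, a) ∧ s.tri = (k, Sᶜ) := by
  have hc : Sᶜ.card = 3 := by
    rw [Finset.card_compl, Fintype.card_fin]; omega
  have ha' : a ∈ Sᶜ := Finset.mem_compl.2 ha
  have h2 : (Sᶜ.erase a).card = 2 := by rw [Finset.card_erase_of_mem ha', hc]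
  obtain ⟨b, c, hbc, h⟩ := Finset.card_eq_two.1 h2
  have hb : b ∈ Sᶜ.erase a := by rw [h]; simp
  have hc' : c ∈ Sᶜ.erase a := by rw [h]; simp
  refine ⟨⟨k, a, b, c, (Finset.ne_of_mem_erase hb).symm, (Finset.ne_of_mem_erase hc').symm, hbc⟩,
    rfl, ?_⟩
  simp only [Side.tri, Prod.mk.injEq, true_and]
  rw [← h, Finset.insert_erase ha']

/-- If two `(d-3)`-faces are identified, then the complementary triangles are connected within the
link of the resulting face. -/
theorem eqvGen_adj_of_step {L : List (Gluing d N)} {x y : RawFace d N}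
    (h : Relation.EqvGen (Step L) x y) (hx : x.2.1.card + 2 = d) :
    Relation.EqvGen (Adj (glueSet L)) (x.1, x.2.1ᶜ) (y.1, y.2.1ᶜ) := by
  induction h with
  | rel x y h =>
    obtain ⟨g, hg, h1, h2, h3, h4⟩ := h
    obtain ⟨s, hs, ht⟩ := exists_side (k := x.1) hx h2
    refine .rel _ _ ⟨g, .inl hg, s, ?_, ht, ?_⟩
    · rw [hs, h1]; rfl
    · have h5 : ({s.a, s.b, s.c} : Finset (Fin (d + 1))) = x.2.1ᶜ := congrArg Prod.snd ht
      refine Prod.ext h3.symm ?_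
      change ({g.π s.a, g.π s.b, g.π s.c} : Finset (Fin (d + 1))) = _
      rw [h4]
      ext v
      have h6 : g.π.symm v ∈ ({s.a, s.b, s.c} : Finset (Fin (d + 1))) ↔ g.π.symm v ∉ x.2.1 := by
        rw [h5, Finset.mem_compl]
      simpa [Equiv.symm_apply_eq] using h6
  | refl => exact .refl _
  | symm x y h ih => exact (ih ((Face.card_eq h).symm ▸ hx)).symm
  | trans x y z h _ ih₁ ih₂ => exact (ih₁ hx).trans _ _ _ (ih₂ ((Face.card_eq h) ▸ hx))

theorem eqvGen_step_of_vertexStep {L : List (Gluing d N)} {x y : Fin N × Fin (d + 1)}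
    (h : Relation.EqvGen (VertexStep (glueSet L)) x y) :
    Relation.EqvGen (Step L) (x.1, vertexSet x.2) (y.1, vertexSet y.2) := by
  induction h with
  | rel x y h =>
    obtain ⟨g, hg, h1, h2, h3, h4⟩ := h
    rw [h1, h3, ← Face.mk_eq_iff]
    exact (mk_map hg (by simpa [vertexSet] using h2.symm) (by simp [vertexSet, h4])).symm
  | refl => exact .refl _
  | symm _ _ _ ih => exact ih.symm
  | trans _ _ _ _ _ ih₁ ih₂ => exact ih₁.trans _ _ _ ih₂

theorem card_add_two_of_height {L : List (Gluing d N)} {x : RawFace d N}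
    (h : Order.height (Face.mk L x) + 3 = d) : x.2.1.card + 2 = d := by
  rw [Face.height_mk] at h
  have h1 : x.2.1.card - 1 + 3 = d := by exact_mod_cast h
  have h2 := x.2.2.card_pos
  omega

theorem height_of_card_add_two {L : List (Gluing d N)} {x : RawFace d N}
    (h : x.2.1.card + 2 = d) : Order.height (Face.mk L x) + 3 = d := by
  rw [Face.height_mk]
  have h2 := x.2.2.card_pos
  have h1 : x.2.1.card - 1 + 3 = d := by omega
  exact_mod_cast h1

/-- A gluing whose impact is restricted to the boundaries of links keeps the triangles of a link
distinct, as triangles are never boundary faces. -/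
theorem TrianglesDistinct.glue {L : List (Gluing d N)} {g : Gluing d N} (hL : TrianglesDistinct L)
    (hV : VerticesDistinct L) (hg : IsQuasiGluing L g) : TrianglesDistinct (g :: L) := by
  rintro δ hδ s s' ⟨h₁, hs⟩ ⟨h₂, hs'⟩ htri
  have hc₁ : s.tri.2ᶜ.card + 2 = d := card_add_two_of_height (x := (s.tri.1, ⟨_, h₁⟩)) (hs ▸ hδ)
  have hc₂ : s'.tri.2ᶜ.card + 2 = d :=
    card_add_two_of_height (x := (s'.tri.1, ⟨_, h₂⟩)) (hs' ▸ hδ)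
  by_cases heq : (Face.mk L (s.tri.1, ⟨_, h₁⟩), s.triFace L) =
      (Face.mk L (s'.tri.1, ⟨_, h₂⟩), s'.triFace L)
  · rw [Prod.mk.injEq] at heq
    exact hL _ (height_of_card_add_two (x := (s.tri.1, ⟨_, h₁⟩)) hc₁) s s' ⟨h₁, rfl⟩
      ⟨h₂, heq.1.symm⟩ heq.2
  · exfalso
    obtain ⟨⟨e, -, he, he1, -⟩, -⟩ := hg.boundary_only _ _ (s.triFace L) (s'.triFace L)
      (height_of_card_add_two (x := (s.tri.1, ⟨_, h₁⟩)) hc₁)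
      (height_of_card_add_two (x := (s'.tri.1, ⟨_, h₂⟩)) hc₂)
      (mem_link_of_mem_linkTriangles hV ⟨h₁, rfl⟩ (S := s.verts) subset_rfl)
      (mem_link_of_mem_linkTriangles hV ⟨h₂, rfl⟩ (S := s'.verts) subset_rfl)
      (hs.trans hs'.symm) htri heq
    have := Order.height_mono he
    rw [he1, Side.height_triFace] at this
    exact absurd this (by norm_num)

/-- What is known about the complex during its construction. In `model`, only an inclusion
is required of the set `C`, so that it can be kept under gluings that do not involve its
triangles. -/
structure Invariant (T : Set (Gluing d N))
    (M : Fin N × Fin (d + 1) → Option (Finset (Fin (d + 1)))) (L : List (Gluing d N)) : Prop where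
  vertices : VerticesDistinct L
  triangles : TrianglesDistinct L
  ne : ∀ g ∈ glueSet L, g.i ≠ g.j
  src_inj : ∀ g ∈ glueSet L, ∀ h ∈ glueSet L, g.src = h.src → g = h
  tree : T ⊆ glueSet L
  unmarked : ∀ g ∈ T, M g.src = none
  support : ∀ f e, M f = some e → f.2 ∉ e ∧ e.card = 2 ∧ ∃ g ∈ glueSet L, g.src = f
  marked_map : ∀ g ∈ glueSet L, ∀ s : Side d N, s.facet = g.src → Marked M s → Marked M (g.map s)
  model : ∀ s : Side d N, Marked M s → ∃ C δ, s.tri ∈ C ∧ C ⊆ linkTriangles L δ ∧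
    Nonempty (LinkModel (glueSet L) C)
  local_gluing : ∀ 𝒦 ⊆ glueSet L, T ⊆ 𝒦 → (∀ g ∈ 𝒦, g.symm ∈ 𝒦) → 𝒦 ≠ glueSet L →
    ∃ g ∈ glueSet L, g ∉ 𝒦 ∧ ∃ s : Side d N, s.facet = g.src ∧ Marked M s ∧
      Relation.EqvGen (Adj 𝒦) s.tri (g.map s).tri

theorem mem_glueSet_cons {L : List (Gluing d N)} {g f : Gluing d N} :
    f ∈ glueSet (g :: L) ↔ f = g ∨ f = g.symm ∨ f ∈ glueSet L := by
  have h1 : f.symm = g ↔ f = g.symm :=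
    ⟨fun h => by rw [← h, Gluing.symm_symm], fun h => by rw [h, Gluing.symm_symm]⟩
  simp only [glueSet, Set.mem_ofPred_eq, List.mem_cons, h1]
  tauto

theorem glueSet_subset_cons {L : List (Gluing d N)} {g : Gluing d N} :
    glueSet L ⊆ glueSet (g :: L) := fun _ hf => mem_glueSet_cons.2 (.inr (.inr hf))

theorem src_mem_facets (g : Gluing d N) : g.src ∈ g.facets := .inl rfl

theorem symm_src_mem_facets (g : Gluing d N) : g.symm.src ∈ g.facets := .inr rfl

theorem src_ne_of_free {L : List (Gluing d N)} {g : Gluing d N}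
    (h : ∀ f ∈ L, Disjoint g.facets f.facets) {f : Gluing d N} (hf : f ∈ glueSet L) :
    f.src ≠ g.src ∧ f.src ≠ g.symm.src := by
  have key : ∀ f' ∈ L, ∀ x ∈ f'.facets, x ≠ g.src ∧ x ≠ g.symm.src := by
    intro f' hf' x hx
    have := Set.disjoint_left.1 (h f' hf')
    exact ⟨fun he => this (src_mem_facets g) (he ▸ hx),
      fun he => this (symm_src_mem_facets g) (he ▸ hx)⟩
  rcases hf with hf | hf
  · exact key f hf _ (src_mem_facets f)
  · have := key _ hf _ (symm_src_mem_facets f.symm)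
    rwa [Gluing.symm_symm] at this

theorem src_inj_cons {L : List (Gluing d N)} {g : Gluing d N}
    (hL : ∀ f ∈ glueSet L, ∀ h ∈ glueSet L, f.src = h.src → f = h) (hg : g.src ≠ g.symm.src)
    (hfree : ∀ f ∈ L, Disjoint g.facets f.facets) :
    ∀ f ∈ glueSet (g :: L), ∀ h ∈ glueSet (g :: L), f.src = h.src → f = h := by
  intro f hf h hh hfh
  rcases mem_glueSet_cons.1 hf with rfl | rfl | hf' <;>
    rcases mem_glueSet_cons.1 hh with rfl | rfl | hh'
  · rfl
  · exact absurd hfh hg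
  · exact absurd hfh.symm (src_ne_of_free hfree hh').1
  · exact absurd hfh.symm hg
  · rfl
  · exact absurd hfh.symm (src_ne_of_free hfree hh').2
  · exact absurd hfh (src_ne_of_free hfree hf').1
  · exact absurd hfh (src_ne_of_free hfree hf').2
  · exact hL f hf' h hh' hfh

theorem IsTreeOfSimplices.src_inj {T : List (Gluing d N)} (hT : IsTreeOfSimplices T) :
    ∀ f ∈ glueSet T, ∀ h ∈ glueSet T, f.src = h.src → f = h := by
  have key : ∀ L : List (Gluing d N), (∀ g ∈ L, g.src ≠ g.symm.src) →
      L.Pairwise (fun g h => Disjoint g.facets h.facets) →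
      ∀ f ∈ glueSet L, ∀ h ∈ glueSet L, f.src = h.src → f = h := by
    intro L
    induction L with
    | nil => intro _ _ f hf; simp [glueSet] at hf
    | cons g L ih =>
      intro h1 h2
      rw [List.pairwise_cons] at h2
      exact src_inj_cons (ih (fun f hf => h1 f (List.mem_cons_of_mem _ hf)) h2.2)
        (h1 g (List.mem_cons_self ..)) h2.1
  exact key T (fun g hg h => hT.ne (.inl hg) (congrArg Prod.fst h)) hT.2.1

theorem IsTreeOfSimplices.invariant {T : List (Gluing d N)} (hT : IsTreeOfSimplices T) :
    Invariant (glueSet T) (fun _ => none) T where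
  vertices := hT.verticesDistinct
  triangles := hT.trianglesDistinct
  ne _ hg := hT.ne hg
  src_inj := hT.src_inj
  tree := subset_rfl
  unmarked _ _ := rfl
  support _ _ h := by simp at h
  marked_map _ _ _ _ h := by simp [Marked] at h
  model _ h := by simp [Marked] at h
  local_gluing 𝒦 h1 h2 _ h3 := absurd (h1.antisymm h2) h3

/-- A gluing that does not touch a link does not change its model. -/
theorem LinkModel.extend {L : List (Gluing d N)} {g : Gluing d N}
    {C : Set (Fin N × Finset (Fin (d + 1)))} (m : LinkModel (glueSet L) C)
    (h : ∀ s : Side d N, s.tri ∈ C → s.facet ≠ g.src ∧ s.facet ≠ g.symm.src) :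
    Nonempty (LinkModel (glueSet (g :: L)) C) := by
  have hold : ∀ f ∈ glueSet (g :: L), ∀ s : Side d N, s.facet = f.src → s.tri ∈ C →
      f ∈ glueSet L := by
    intro f hf s hs hC
    rcases mem_glueSet_cons.1 hf with rfl | rfl | hf
    exacts [absurd hs (h s hC).1, absurd hs (h s hC).2, hf]
  refine ⟨⟨m.V, m.start, m.sgn, fun f hf s hs hC => m.closed f (hold f hf s hs hC) s hs hC,
    fun f hf s hs hC => m.start_map f (hold f hf s hs hC) s hs hC, m.start_rot, m.sgn_rev,
    m.sgn_rot, fun f hf s hs hC => m.sgn_map f (hold f hf s hs hC) s hs hC, ?_⟩⟩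
  intro K hK hnd hp
  obtain ⟨A, hA⟩ := m.jordan K hK hnd hp
  exact ⟨A, fun f hf s hs hC => hA f (hold f hf s hs hC) s hs hC⟩

open Classical in
/-- A gluing of the construction preserves the invariant, if in its two facets the sides opposite to
a common `(d-3)`-face are marked. -/
theorem Invariant.glue {T : Set (Gluing d N)}
    {M : Fin N × Fin (d + 1) → Option (Finset (Fin (d + 1)))} {L : List (Gluing d N)}
    (h : Invariant T M L) {g : Gluing d N} (hg : IsQuasiGluing L g) :
    ∃ M', Invariant T M' (g :: L) := by
  have hV' : VerticesDistinct (g :: L) :=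
    verticesDistinct_of_isSimplicial hg.pseudomanifold.simplicial
  have hgm : g ∈ glueSet (g :: L) := mem_glueSet_cons.2 (.inl rfl)
  have hsrc : g.src ≠ g.symm.src := hg.ne
  have hfree := fun f (hf : f ∈ glueSet L) => src_ne_of_free hg.free hf
  have hgL : g ∉ glueSet L := fun hL => (hfree g hL).1 rfl
  -- facets of one simplex cannot be glued, as its vertices remain distinct
  have hij : g.i ≠ g.j := by
    intro hij
    have hfix : ∀ v, v ≠ g.a → g.π v = v := by
      intro v hv
      have h1 := mk_map (S := vertexSet v) (T := vertexSet (g.π v)) hgm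
        (by simpa [vertexSet] using hv.symm) (by simp [vertexSet])
      rw [← hij] at h1
      exact hV' _ _ _ (Face.mk_eq_iff.1 h1)
    have ha : g.π g.a = g.a := by
      by_contra hne
      exact hne (g.π.injective (hfix _ hne))
    exact hg.ne (by rw [hij, ha])
  -- the two facets share a `(d-3)`-face, with vertices `S` in the first simplex
  obtain ⟨δ₀, ⟨⟨S, haS, hS⟩, ⟨S', haS', hS'⟩⟩, hδ₀⟩ := hg.meet
  have hcard : S.1.card + 2 = d := card_add_two_of_height (x := (g.i, S)) (hS ▸ hδ₀)
  obtain ⟨s₀, hs₀, ht₀⟩ := exists_side (k := g.i) hcard haS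
  have hSS' : S' = ⟨S.1.map g.π.toEmbedding, S.2.map⟩ := by
    apply hV'.face_eq (k := g.j)
    rw [← Face.mk_eq_iff, mk_map (S := S) (T := ⟨S.1.map g.π.toEmbedding, S.2.map⟩) hgm haS rfl]
    exact congrArg (Face.push g) (hS'.trans hS.symm)
  -- the triangles at the two new marked sides are connected by the earlier gluings
  have hadj₀ : Relation.EqvGen (Adj (glueSet L)) s₀.tri (g.map s₀).tri := by
    have h1 := eqvGen_adj_of_step (Face.mk_eq_iff.1 (hS.trans hS'.symm)) hcard
    have h5 : ({s₀.a, s₀.b, s₀.c} : Finset (Fin (d + 1))) = S.1ᶜ := congrArg Prod.snd ht₀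
    have h7 : (g.map s₀).tri = (g.j, S'.1ᶜ) := by
      refine Prod.ext rfl ?_
      change ({g.π s₀.a, g.π s₀.b, g.π s₀.c} : Finset (Fin (d + 1))) = S'.1ᶜ
      rw [hSS']
      ext v
      have h6 : g.π.symm v ∈ ({s₀.a, s₀.b, s₀.c} : Finset (Fin (d + 1))) ↔
          g.π.symm v ∉ S.1 := by
        rw [h5, Finset.mem_compl]
      simpa [Equiv.symm_apply_eq] using h6
    rw [ht₀, h7]
    exact h1
  let M' : Fin N × Fin (d + 1) → Option (Finset (Fin (d + 1))) := fun f =>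
    if f = g.src then some {s₀.b, s₀.c} else
      if f = g.symm.src then some {(g.map s₀).b, (g.map s₀).c} else M f
  have hM₁ : M' g.src = some {s₀.b, s₀.c} := if_pos rfl
  have hM₂ : M' g.symm.src = some {(g.map s₀).b, (g.map s₀).c} := by
    change (if _ then _ else _) = _
    rw [if_neg hsrc.symm, if_pos rfl]
  have hM₃ : ∀ f, f ≠ g.src → f ≠ g.symm.src → M' f = M f := by
    intro f h1 h2
    change (if _ then _ else _) = _
    rw [if_neg h1, if_neg h2]
  have hm₀ : Marked M' s₀ := by rw [Marked, hs₀]; exact hM₁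
  have hs₀' : (g.map s₀).facet = g.symm.src := Gluing.facet_map hs₀
  have hm₀' : Marked M' (g.map s₀) := by rw [Marked, hs₀']; exact hM₂
  have holdM : ∀ f ∈ glueSet L, ∀ s : Side d N, s.facet = f.src → (Marked M' s ↔ Marked M s) := by
    intro f hf s hs
    rw [Marked, Marked, hs, hM₃ _ (hfree f hf).1 (hfree f hf).2]
  refine ⟨M', hV', h.triangles.glue h.vertices hg, ?_, src_inj_cons h.src_inj hsrc hg.free,
    h.tree.trans glueSet_subset_cons, ?_, ?_, ?_, ?_, ?_⟩
  · intro f hf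
    rcases mem_glueSet_cons.1 hf with rfl | rfl | hf
    exacts [hij, hij.symm, h.ne f hf]
  · intro f hf
    have hf' := h.tree hf
    rw [hM₃ _ (hfree f hf').1 (hfree f hf').2]
    exact h.unmarked f hf
  · intro f e he
    by_cases h1 : f = g.src
    · subst h1
      rw [hM₁, Option.some.injEq] at he
      have h2 : s₀.a = g.a := congrArg Prod.snd hs₀
      refine ⟨?_, ?_, g, hgm, rfl⟩
      · rw [← he]; simp [Gluing.src, ← h2, s₀.hab, s₀.hac]
      · rw [← he]; exact Finset.card_pair s₀.hbc
    by_cases h2 : f = g.symm.src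
    · subst h2
      rw [hM₂, Option.some.injEq] at he
      have h3 : (g.map s₀).a = g.symm.a := congrArg Prod.snd hs₀'
      refine ⟨?_, ?_, g.symm, symm_mem_glueSet hgm, rfl⟩
      · rw [← he]; simp [Gluing.src, ← h3, (g.map s₀).hab, (g.map s₀).hac]
      · rw [← he]; exact Finset.card_pair (g.map s₀).hbc
    · rw [hM₃ f h1 h2] at he
      obtain ⟨h3, h4, f', hf', h5⟩ := h.support f e he
      exact ⟨h3, h4, f', glueSet_subset_cons hf', h5⟩
  · intro f hf s hs hm
    rcases mem_glueSet_cons.1 hf with rfl | rfl | hf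
    · have h1 := edge_eq_of_marked hm hm₀ (hs.trans hs₀.symm)
      exact (marked_congr (Gluing.edge_map_congr h1)).2 hm₀'
    · have h1 := edge_eq_of_marked hm hm₀' (hs.trans hs₀'.symm)
      refine (marked_congr (Gluing.edge_map_congr h1)).2 ?_
      rwa [Gluing.symm_map_map hs₀]
    · rw [holdM f hf s hs] at hm
      rw [holdM f.symm (symm_mem_glueSet hf) _ (Gluing.facet_map hs)]
      exact h.marked_map f hf s hs hm
  · intro s hm
    -- the link of a face touched by the gluing is planar and orientable by assumption
    have htouch : ∀ δ : Face (g :: L), ∀ u : Side d N, u.tri ∈ linkTriangles (g :: L) δ →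
        u.facet = g.src ∨ u.facet = g.symm.src →
          Nonempty (LinkModel (glueSet (g :: L)) (linkTriangles (g :: L) δ)) := by
      have hne' : ∀ f ∈ glueSet (g :: L), f.i ≠ f.j := by
        intro f hf
        rcases mem_glueSet_cons.1 hf with rfl | rfl | hf
        exacts [hij, hij.symm, h.ne f hf]
      have key : ∀ δ : Face (g :: L), ∀ u : Side d N, u.tri ∈ linkTriangles (g :: L) δ →
          u.facet = g.src →
            Nonempty (LinkModel (glueSet (g :: L)) (linkTriangles (g :: L) δ)) := by
        intro δ u hu hf
        obtain ⟨hne, hδ⟩ := id hu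
        have hc : u.tri.2ᶜ.card + 2 = d := by
          have h1 : u.tri.2.card = 3 := u.card_verts
          rw [Finset.card_compl, h1, Fintype.card_fin]
          have := hne.card_pos
          rw [Finset.card_compl, h1, Fintype.card_fin] at this
          omega
        have hht : Order.height δ + 3 = d := by
          rw [← hδ]; exact height_of_card_add_two hc
        have hmem : δ ∈ facetFaces (g :: L) g.i g.a := by
          have hk : u.k = g.i := congrArg Prod.fst hf
          have ha : u.a = g.a := congrArg Prod.snd hf
          refine ⟨⟨u.tri.2ᶜ, hne⟩, ?_, ?_⟩
          · simp [← ha, Side.tri]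
          · rw [← hδ, ← hk]; rfl
        exact exists_linkModel hV' (h.triangles.glue h.vertices hg) hne' δ hht
          (hg.orientable δ hmem hht) (hg.planar δ hmem hht)
      intro δ u hu hf
      rcases hf with hf | hf
      · exact key δ u hu hf
      · refine key δ (g.symm.map u) (map_mem_linkTriangles (symm_mem_glueSet hgm) hf hu) ?_
        have := Gluing.facet_map hf
        rwa [Gluing.symm_symm] at this
    by_cases hs : s.facet = g.src ∨ s.facet = g.symm.src
    · have hne : s.tri.2ᶜ.Nonempty := by
        have h1 : s.tri.2.card = 3 := s.card_verts
        rw [← Finset.card_pos, Finset.card_compl, h1, Fintype.card_fin]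
        have := S.2.card_pos
        omega
      have hsδ : s.tri ∈ linkTriangles (g :: L) (Face.mk (g :: L) (s.tri.1, ⟨_, hne⟩)) :=
        ⟨hne, rfl⟩
      exact ⟨_, _, hsδ, subset_rfl, htouch _ s hsδ hs⟩
    · push Not at hs
      have hm' : Marked M s := by
        rw [Marked, hM₃ _ hs.1 hs.2] at hm; exact hm
      obtain ⟨C, δ, hsC, hCδ, ⟨m⟩⟩ := h.model s hm'
      have hsub : C ⊆ linkTriangles (g :: L) (Face.push g δ) := by
        intro t ht
        obtain ⟨h1, h2⟩ := hCδ ht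
        exact ⟨h1, congrArg (Face.push g) h2⟩
      by_cases hC : ∃ u : Side d N, u.tri ∈ C ∧ (u.facet = g.src ∨ u.facet = g.symm.src)
      · obtain ⟨u, hu, hf⟩ := hC
        exact ⟨_, _, hsub hsC, subset_rfl, htouch _ u (hsub hu) hf⟩
      · push Not at hC
        exact ⟨C, _, hsC, hsub, m.extend hC⟩
  · intro 𝒦 h𝒦 hT hsym hne
    by_cases hL : glueSet L ⊆ 𝒦
    · refine ⟨g, hgm, fun hg𝒦 => hne (h𝒦.antisymm ?_), s₀, hs₀, hm₀, eqvGen_adj_mono hL hadj₀⟩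
      intro f hf
      rcases mem_glueSet_cons.1 hf with rfl | rfl | hf
      exacts [hg𝒦, hsym g hg𝒦, hL hf]
    · obtain ⟨f, hf, hf𝒦, s, hs, hm, hadj⟩ := h.local_gluing (𝒦 ∩ glueSet L)
        Set.inter_subset_right (Set.subset_inter hT h.tree)
        (fun f hf => ⟨hsym f hf.1, symm_mem_glueSet hf.2⟩)
        (fun h => hL (Set.inter_eq_right.1 h))
      exact ⟨f, glueSet_subset_cons hf, fun h => hf𝒦 ⟨h, hf⟩, s, hs, (holdM f hf s hs).2 hm,
        eqvGen_adj_mono Set.inter_subset_left hadj⟩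

theorem Invariant.good {T : Set (Gluing d N)}
    {M : Fin N × Fin (d + 1) → Option (Finset (Fin (d + 1)))} {L : List (Gluing d N)}
    (h : Invariant T M L) : Good T M (glueSet L) where
  symm _ hg := symm_mem_glueSet hg
  src_inj := h.src_inj
  tree := h.tree
  ne := h.ne
  vertex_inj k v w hvw := h.vertices k v w (eqvGen_step_of_vertexStep hvw)
  marked_map := h.marked_map
  model _ _ s _ hm := by
    obtain ⟨C, _, hs, -, hC⟩ := h.model s hm
    exact ⟨C, hs, hC⟩
  local_gluing := h.local_gluing

/-- A 2-LC quasimanifold has the properties that are used for counting. -/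
theorem QuasiConstructible.exists_good {L : List (Gluing d N)} (hL : QuasiConstructible L) :
    ∃ T : List (Gluing d N), IsTreeOfSimplices T ∧ ∃ M, Good (glueSet T) M (glueSet L) ∧
      (∀ g ∈ glueSet T, M g.src = none) ∧ ∀ f e, M f = some e → f.2 ∉ e ∧ e.card = 2 := by
  have key : ∃ T : List (Gluing d N), IsTreeOfSimplices T ∧ ∃ M, Invariant (glueSet T) M L := by
    induction hL with
    | tree hT => exact ⟨_, hT, _, hT.invariant⟩
    | glue _ hg ih =>
      obtain ⟨T, hT, M, hM⟩ := ih
      obtain ⟨M', hM'⟩ := hM.glue hg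
      exact ⟨T, hT, M', hM'⟩
  obtain ⟨T, hT, M, hM⟩ := key
  exact ⟨T, hT, M, hM.good, hM.unmarked, fun f e h => ⟨(hM.support f e h).1,
    (hM.support f e h).2.1⟩⟩

end Construct

/-! ### Relabelling -/

section Relabel

variable {d N : ℕ}

theorem eqvGen_lift {α β : Type} {r : α → α → Prop} {r' : β → β → Prop} (f : α → β)
    (h : ∀ x y, r x y → Relation.EqvGen r' (f x) (f y)) {x y : α} (hxy : Relation.EqvGen r x y) :
    Relation.EqvGen r' (f x) (f y) := by
  induction hxy with
  | rel x y hxy => exact h x y hxy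
  | refl => exact .refl _
  | symm _ _ _ ih => exact ih.symm
  | trans _ _ _ _ _ ih₁ ih₂ => exact ih₁.trans _ _ _ ih₂

theorem eqvGen_of_bijective {α β : Type} {r : α → α → Prop} {r' : β → β → Prop} {f : α → β}
    (hf : Function.Bijective f) (h : ∀ x y, r' (f x) (f y) → Relation.EqvGen r x y) {x y : α}
    (hxy : Relation.EqvGen r' (f x) (f y)) : Relation.EqvGen r x y := by
  obtain ⟨g, hg₁, hg₂⟩ := Function.bijective_iff_has_inverse.1 hf
  have := eqvGen_lift (r := r') (r' := r) g
    (fun u v huv => h _ _ (by rwa [hg₂, hg₂])) hxy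
  rwa [hg₁, hg₁] at this

instance : Finite (Gluing d N) := by
  refine Finite.of_injective
    (fun g : Gluing d N => (g.i, g.j, g.a, g.π)) fun g h hgh => ?_
  cases g; cases h; simp_all

instance : Finite (Side d N) := by
  refine Finite.of_injective
    (fun s : Side d N => (s.k, s.a, s.b, s.c)) fun s t hst => ?_
  simp only [Prod.mk.injEq] at hst
  exact Side.ext hst.1 hst.2.1 hst.2.2.1 hst.2.2.2

/-- A renaming of the simplices, and of the vertices of every simplex. -/
structure Relabelling (d N : ℕ) where
  σ : Equiv.Perm (Fin N)
  τ : Fin N → Equiv.Perm (Fin (d + 1))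

namespace Relabelling

variable (ψ : Relabelling d N)

/-- The action on gluings. -/
def gluing (g : Gluing d N) : Gluing d N :=
  ⟨ψ.σ g.i, ψ.σ g.j, ψ.τ g.i g.a, ((ψ.τ g.i).symm.trans g.π).trans (ψ.τ g.j)⟩

/-- The action on sides. -/
def side (s : Side d N) : Side d N :=
  ⟨ψ.σ s.k, ψ.τ s.k s.a, ψ.τ s.k s.b, ψ.τ s.k s.c, (ψ.τ s.k).injective.ne s.hab,
    (ψ.τ s.k).injective.ne s.hac, (ψ.τ s.k).injective.ne s.hbc⟩

/-- The action on facets, and on vertices. -/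
def facet (f : Fin N × Fin (d + 1)) : Fin N × Fin (d + 1) := (ψ.σ f.1, ψ.τ f.1 f.2)

/-- The action on triangles. -/
def tri (t : Fin N × Finset (Fin (d + 1))) : Fin N × Finset (Fin (d + 1)) :=
  (ψ.σ t.1, t.2.map (ψ.τ t.1).toEmbedding)

/-- The action on faces of simplices. -/
def raw (x : RawFace d N) : RawFace d N :=
  (ψ.σ x.1, ⟨x.2.1.map (ψ.τ x.1).toEmbedding, x.2.2.map⟩)

/-- The action on marks, which is contravariant like the preimage of sets of gluings. -/
def marks (M : Fin N × Fin (d + 1) → Option (Finset (Fin (d + 1)))) :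
    Fin N × Fin (d + 1) → Option (Finset (Fin (d + 1))) :=
  fun f => (M (ψ.facet f)).map fun e => e.map (ψ.τ f.1).symm.toEmbedding

theorem facet_injective : Function.Injective ψ.facet := by
  rintro ⟨k, a⟩ ⟨l, b⟩ h
  simp only [facet, Prod.mk.injEq] at h
  obtain rfl := ψ.σ.injective h.1
  rw [(ψ.τ k).injective h.2]

theorem tri_injective : Function.Injective ψ.tri := by
  rintro ⟨k, a⟩ ⟨l, b⟩ h
  simp only [tri, Prod.mk.injEq] at h
  obtain rfl := ψ.σ.injective h.1
  rw [Finset.map_injective _ h.2]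

theorem raw_injective : Function.Injective ψ.raw := by
  rintro ⟨k, a⟩ ⟨l, b⟩ h
  simp only [raw, Prod.mk.injEq, Subtype.mk.injEq] at h
  obtain rfl := ψ.σ.injective h.1
  rw [Subtype.ext (Finset.map_injective _ h.2)]

theorem side_injective : Function.Injective ψ.side := by
  intro s t h
  simp only [side, Side.mk.injEq] at h
  have hk : s.k = t.k := ψ.σ.injective h.1
  rw [hk] at h
  exact Side.ext hk ((ψ.τ t.k).injective h.2.1) ((ψ.τ t.k).injective h.2.2.1)
    ((ψ.τ t.k).injective h.2.2.2)

theorem gluing_injective : Function.Injective ψ.gluing := by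
  rintro ⟨i, j, a, π⟩ ⟨i', j', a', π'⟩ h
  simp only [gluing, Gluing.mk.injEq] at h
  obtain ⟨h1, h2, h3, h4⟩ := h
  obtain rfl := ψ.σ.injective h1
  obtain rfl := ψ.σ.injective h2
  obtain rfl := (ψ.τ i).injective h3
  have : π = π' := by
    refine Equiv.ext fun v => ?_
    have := congrArg (fun p : Equiv.Perm (Fin (d + 1)) => p (ψ.τ i v)) h4
    simpa using this
  rw [this]

theorem gluing_bijective : Function.Bijective ψ.gluing :=
  Finite.injective_iff_bijective.1 ψ.gluing_injective

theorem side_bijective : Function.Bijective ψ.side :=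
  Finite.injective_iff_bijective.1 ψ.side_injective

theorem tri_bijective : Function.Bijective ψ.tri :=
  Finite.injective_iff_bijective.1 ψ.tri_injective

theorem raw_bijective : Function.Bijective ψ.raw :=
  Finite.injective_iff_bijective.1 ψ.raw_injective

theorem gluing_symm (g : Gluing d N) : ψ.gluing g.symm = (ψ.gluing g).symm := by
  simp only [gluing, Gluing.symm, Gluing.mk.injEq, true_and]
  refine ⟨by simp, ?_⟩
  ext v
  simp

theorem src_gluing (g : Gluing d N) : (ψ.gluing g).src = ψ.facet g.src := rfl

theorem facet_side (s : Side d N) : (ψ.side s).facet = ψ.facet s.facet := rfl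

theorem tri_side (s : Side d N) : (ψ.side s).tri = ψ.tri s.tri := by
  simp [side, Side.tri, tri, Finset.map_insert]

theorem facet_side_eq_src {s : Side d N} {g : Gluing d N} :
    (ψ.side s).facet = (ψ.gluing g).src ↔ s.facet = g.src := by
  rw [facet_side, src_gluing, ψ.facet_injective.eq_iff]

theorem side_map {g : Gluing d N} {s : Side d N} (h : s.facet = g.src) :
    ψ.side (g.map s) = (ψ.gluing g).map (ψ.side s) := by
  have hk : s.k = g.i := congrArg Prod.fst h
  simp [side, gluing, Gluing.map, hk]

theorem edge_side {s t : Side d N} : (ψ.side s).edge = (ψ.side t).edge ↔ s.edge = t.edge := by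
  have : (ψ.side t).rev = ψ.side t.rev := rfl
  rw [Side.edge_eq_iff, Side.edge_eq_iff, this, ψ.side_injective.eq_iff, ψ.side_injective.eq_iff]

theorem edge_side_mem {s : Side d N} {K : List (Side d N)} :
    (ψ.side s).edge ∈ (K.map ψ.side).map Side.edge ↔ s.edge ∈ K.map Side.edge := by
  simp only [List.mem_map, exists_exists_and_eq_and, edge_side]

theorem marked_marks {M : Fin N × Fin (d + 1) → Option (Finset (Fin (d + 1)))} {s : Side d N} :
    Marked (ψ.marks M) s ↔ Marked M (ψ.side s) := by
  rw [Marked, Marked, facet_side, marks]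
  have h1 : ({s.b, s.c} : Finset (Fin (d + 1))) =
      ({(ψ.side s).b, (ψ.side s).c} : Finset (Fin (d + 1))).map
        (ψ.τ s.facet.1).symm.toEmbedding := by
    simp [side, Finset.map_insert, Side.facet]
  rw [h1, Option.map_eq_some_iff]
  constructor
  · rintro ⟨e, he, h⟩
    rw [he, Finset.map_injective _ h]
  · exact fun h => ⟨_, h, rfl⟩

theorem adj_iff {𝒦 : Set (Gluing d N)} {t t' : Fin N × Finset (Fin (d + 1))} :
    Adj 𝒦 (ψ.tri t) (ψ.tri t') ↔ Adj (ψ.gluing ⁻¹' 𝒦) t t' := by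
  constructor
  · rintro ⟨g, hg, s, hs, ht, ht'⟩
    obtain ⟨g, rfl⟩ := ψ.gluing_bijective.2 g
    obtain ⟨s, rfl⟩ := ψ.side_bijective.2 s
    rw [facet_side_eq_src] at hs
    rw [← ψ.side_map hs, tri_side, ψ.tri_injective.eq_iff] at ht'
    rw [tri_side, ψ.tri_injective.eq_iff] at ht
    exact ⟨g, hg, s, hs, ht, ht'⟩
  · rintro ⟨g, hg, s, hs, rfl, rfl⟩
    exact ⟨ψ.gluing g, hg, ψ.side s, ψ.facet_side_eq_src.2 hs, ψ.tri_side s, by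
      rw [← ψ.side_map hs, tri_side]⟩

theorem walk_side {V : Type} {f : Side d N → V} {K : List (Side d N)} {p q : V} :
    Walk (f ∘ ψ.side) p K q → Walk f p (K.map ψ.side) q := by
  induction K generalizing p with
  | nil => exact id
  | cons s K ih => exact fun h => ⟨h.1, ih h.2⟩

open Classical in
/-- Models of links can be relabelled. -/
theorem linkModel {G : Set (Gluing d N)} {C : Set (Fin N × Finset (Fin (d + 1)))}
    (m : LinkModel G C) : Nonempty (LinkModel (ψ.gluing ⁻¹' G) (ψ.tri ⁻¹' C)) := by
  have hC : ∀ s : Side d N, s.tri ∈ ψ.tri ⁻¹' C ↔ (ψ.side s).tri ∈ C := fun s => by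
    rw [tri_side]; rfl
  refine ⟨⟨m.V, m.start ∘ ψ.side, m.sgn ∘ ψ.side, ?_, ?_, ?_, ?_, ?_, ?_, ?_⟩⟩
  · intro g hg s hs h
    rw [hC] at h ⊢
    rw [ψ.side_map hs]
    exact m.closed _ hg _ (ψ.facet_side_eq_src.2 hs) h
  · intro g hg s hs h
    rw [hC] at h
    change m.start _ = m.start _
    rw [ψ.side_map hs]
    exact m.start_map _ hg _ (ψ.facet_side_eq_src.2 hs) h
  · exact fun s h => m.start_rot _ ((hC s).1 h)
  · exact fun s h => m.sgn_rev _ ((hC s).1 h)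
  · exact fun s h => m.sgn_rot _ ((hC s).1 h)
  · intro g hg s hs h
    rw [hC] at h
    change m.sgn _ ↔ ¬ m.sgn _
    rw [ψ.side_map hs]
    exact m.sgn_map _ hg _ (ψ.facet_side_eq_src.2 hs) h
  · rintro K hK hnd ⟨p, hp⟩
    have hnd' : ((K.map ψ.side).map Side.edge).Nodup := by
      rw [List.map_map, List.nodup_map_iff_inj_on (List.Nodup.of_map _ hnd)]
      intro s hs t ht h
      exact List.inj_on_of_nodup_map hnd hs ht (ψ.edge_side.1 h)
    obtain ⟨A, hA⟩ := m.jordan (K.map ψ.side) (by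
      intro s' hs'
      obtain ⟨s, hs, rfl⟩ := List.mem_map.1 hs'
      exact (hC s).1 (hK s hs)) hnd' ⟨p, ψ.walk_side hp⟩
    refine ⟨fun t => A (ψ.tri t), fun g hg s hs h => ?_⟩
    rw [hC] at h
    have h1 := hA _ hg _ (ψ.facet_side_eq_src.2 hs) h
    rw [← ψ.side_map hs, tri_side, tri_side] at h1
    rw [h1]
    congr 1
    · exact if_congr ψ.edge_side_mem rfl rfl
    · exact if_congr ψ.edge_side_mem rfl rfl

/-- The properties used for counting are invariant under relabelling. -/
theorem good {T G : Set (Gluing d N)} {M : Fin N × Fin (d + 1) → Option (Finset (Fin (d + 1)))}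
    (h : Good T M G) : Good (ψ.gluing ⁻¹' T) (ψ.marks M) (ψ.gluing ⁻¹' G) where
  symm g hg := by
    change ψ.gluing g.symm ∈ G
    rw [gluing_symm]
    exact h.symm _ hg
  src_inj g hg f hf hgf := ψ.gluing_injective (h.src_inj _ hg _ hf (by
    rw [src_gluing, src_gluing, hgf]))
  tree := Set.preimage_mono h.tree
  ne g hg he := h.ne _ hg (congrArg ψ.σ he)
  vertex_inj k v w hvw := by
    have h1 := eqvGen_lift (r' := VertexStep G) ψ.facet (fun x y hxy => by
      obtain ⟨g, hg, h1, h2, h3, h4⟩ := hxy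
      refine .rel _ _ ⟨ψ.gluing g, hg, congrArg ψ.σ h1, ?_, congrArg ψ.σ h3, ?_⟩
      · simpa [facet, gluing, h1] using h2
      · simp [facet, gluing, h1, h3, h4]) hvw
    exact (ψ.τ k).injective (h.vertex_inj _ _ _ h1)
  marked_map g hg s hs hm := by
    rw [marked_marks] at hm ⊢
    rw [ψ.side_map hs]
    exact h.marked_map _ hg _ (ψ.facet_side_eq_src.2 hs) hm
  model g hg s hs hm := by
    obtain ⟨C, hC, ⟨m⟩⟩ := h.model _ hg _ (ψ.facet_side_eq_src.2 hs) (ψ.marked_marks.1 hm)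
    refine ⟨ψ.tri ⁻¹' C, ?_, ψ.linkModel m⟩
    rw [tri_side] at hC
    exact hC
  local_gluing 𝒦 h1 h2 h3 h4 := by
    have himage : ψ.gluing ⁻¹' (ψ.gluing '' 𝒦) = 𝒦 :=
      Set.preimage_image_eq 𝒦 ψ.gluing_injective
    obtain ⟨g, hg, hgK, s, hs, hm, hadj⟩ := h.local_gluing (ψ.gluing '' 𝒦)
      (Set.image_subset_iff.2 h1) (by
        intro t ht
        obtain ⟨t, rfl⟩ := ψ.gluing_bijective.2 t
        exact ⟨t, h2 ht, rfl⟩) (by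
        rintro _ ⟨g, hg, rfl⟩
        exact ⟨g.symm, h3 g hg, ψ.gluing_symm g⟩) (fun he => h4 (by rw [← he, himage]))
    obtain ⟨g, rfl⟩ := ψ.gluing_bijective.2 g
    obtain ⟨s, rfl⟩ := ψ.side_bijective.2 s
    rw [facet_side_eq_src] at hs
    refine ⟨g, hg, fun h => hgK ⟨g, h, rfl⟩, s, hs, ψ.marked_marks.2 hm, ?_⟩
    rw [← ψ.side_map hs, tri_side, tri_side] at hadj
    refine eqvGen_of_bijective ψ.tri_bijective (fun t t' htt => ?_) hadj
    rw [adj_iff, himage] at htt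
    exact .rel _ _ htt

/-- The identifications of faces of simplices by a set of gluings. -/
def RawStep (G : Set (Gluing d N)) (x y : RawFace d N) : Prop :=
  ∃ g ∈ G, x.1 = g.i ∧ g.a ∉ x.2.1 ∧ y.1 = g.j ∧ y.2.1 = x.2.1.map g.π.toEmbedding

/-- Relabelling a complex pulls its gluings back. -/
theorem eqvGen_rawStep_iff {L : List (Gluing d N)} {x y : RawFace d N} :
    Relation.EqvGen (Step L) (ψ.raw x) (ψ.raw y) ↔
      Relation.EqvGen (RawStep (ψ.gluing ⁻¹' glueSet L)) x y := by
  constructor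
  · refine eqvGen_of_bijective ψ.raw_bijective ?_
    rintro x y ⟨g, hg, h1, h2, h3, h4⟩
    obtain ⟨g, rfl⟩ := ψ.gluing_bijective.2 g
    have h1' : x.1 = g.i := ψ.σ.injective h1
    have h3' : y.1 = g.j := ψ.σ.injective h3
    refine .rel _ _ ⟨g, .inl hg, h1', ?_, h3', ?_⟩
    · intro ha
      exact h2 (by simpa [raw, gluing, h1'] using ha)
    · simp only [raw, gluing, h1', h3', Finset.map_map] at h4
      apply Finset.map_injective (ψ.τ g.j).toEmbedding
      rw [h4, Finset.map_map]
      congr 1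
      ext v
      simp
  · refine eqvGen_lift ψ.raw ?_
    rintro x y ⟨g, hg, h1, h2, h3, h4⟩
    rw [← Face.mk_eq_iff]
    have h5 := mk_map (S := (ψ.raw x).2) (T := (ψ.raw y).2) hg ?_ ?_
    · have h6 : ψ.raw x = ((ψ.gluing g).i, (ψ.raw x).2) := Prod.ext (congrArg ψ.σ h1) rfl
      have h7 : ψ.raw y = ((ψ.gluing g).j, (ψ.raw y).2) := Prod.ext (congrArg ψ.σ h3) rfl
      rw [h6, h7]
      exact h5.symm
    · simpa [raw, gluing, h1] using h2
    · simp only [raw, gluing, h1, h3, h4, Finset.map_map]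
      congr 1
      ext v
      simp

/-- Complexes whose gluings agree up to relabelling are combinatorially equivalent. -/
theorem nonempty_orderIso {L L' : List (Gluing d N)} {ψ ψ' : Relabelling d N}
    (h : ψ.gluing ⁻¹' glueSet L = ψ'.gluing ⁻¹' glueSet L') : Nonempty (Face L ≃o Face L') := by
  let r := Equiv.ofBijective _ ψ.raw_bijective
  let r' := Equiv.ofBijective _ ψ'.raw_bijective
  have hr : ∀ x y, Relation.EqvGen (Step L) (r x) (r y) ↔
      Relation.EqvGen (Step L') (r' x) (r' y) := fun x y => by
    rw [show r x = ψ.raw x from rfl, show r y = ψ.raw y from rfl, ψ.eqvGen_rawStep_iff, h,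
      ← ψ'.eqvGen_rawStep_iff]
    rfl
  have hrel : ∀ x y, Relation.EqvGen (Step L) x y ↔
      Relation.EqvGen (Step L') ((r.symm.trans r') x) ((r.symm.trans r') y) := fun x y => by
    rw [Equiv.trans_apply, Equiv.trans_apply, ← hr, r.apply_symm_apply, r.apply_symm_apply]
  let e : Face L ≃ Face L' := Quotient.congr (r.symm.trans r') hrel
  have mono : ∀ (L L' : List (Gluing d N)) (ψ ψ' : Relabelling d N) (e : Face L → Face L'),
      (∀ x, e (Face.mk L (ψ.raw x)) = Face.mk L' (ψ'.raw x)) → Monotone e := by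
    rintro L L' ψ ψ' e he x y ⟨k, S, T, hST, rfl, rfl⟩
    obtain ⟨⟨l, S'⟩, hS'⟩ := ψ.raw_bijective.2 (k, S)
    obtain ⟨⟨l', T'⟩, hT'⟩ := ψ.raw_bijective.2 (k, T)
    obtain rfl : l = l' := ψ.σ.injective
      ((congrArg Prod.fst hS').trans (congrArg Prod.fst hT').symm)
    rw [← hS', ← hT', he, he]
    have h1 : S'.1.map (ψ.τ l).toEmbedding = S.1 := congrArg (fun x => x.2.1) hS'
    have h2 : T'.1.map (ψ.τ l).toEmbedding = T.1 := congrArg (fun x => x.2.1) hT'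
    rw [← h1, ← h2, Finset.map_subset_map] at hST
    exact ⟨_, (ψ'.raw (l, S')).2, (ψ'.raw (l, T')).2, Finset.map_subset_map.2 hST, rfl, rfl⟩
  refine ⟨e.toOrderIso (mono L L' ψ ψ' e ?_) (mono L' L ψ' ψ e.symm ?_)⟩
  · intro x
    change Face.mk L' (r' (r.symm (r x))) = _
    rw [r.symm_apply_apply]; rfl
  · intro x
    rw [e.symm_apply_eq]
    change _ = Face.mk L' (r' (r.symm (r x)))
    rw [r.symm_apply_apply]; rfl

end Relabelling

end Relabel

/-! ### Codes of trees -/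

section Codes

variable {d N : ℕ}

/-- The gluing that attaches simplex `r` to the facet `q r` of an earlier simplex, by the
standard identification. -/
def standardGluing (q : Fin N → Fin N × Fin (d + 1)) (r : Fin N) : Gluing d N :=
  ⟨(q r).1, r, (q r).2, Equiv.swap (q r).2 0⟩

/-- The gluings of the tree of simplices given by `q`. Simplex number 0 is the root. -/
def standardTree (q : Fin N → Fin N × Fin (d + 1)) : Set (Gluing d N) :=
  {g | ∃ r : Fin N, r.val ≠ 0 ∧ (g = standardGluing q r ∨ g = (standardGluing q r).symm)}

/-- The simplices of the tree are numbered in the order in which they are attached, breadth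
first, and facet number 0 of a simplex is the one towards the root. -/
structure IsCode (q : Fin N → Fin N × Fin (d + 1)) : Prop where
  strictMono : ∀ r r' : Fin N, r.val ≠ 0 → r < r' → toLex (q r) < toLex (q r')
  free : ∀ r : Fin N, r.val ≠ 0 → ((q r).1.val = 0 ∨ (q r).2 ≠ 0)

open Classical in
/-- The facets of a tree to which simplices are attached. -/
noncomputable def codeSet (q : Fin N → Fin N × Fin (d + 1)) : Finset (Fin N × Fin (d + 1)) :=
  (Finset.univ.filter fun r : Fin N => r.val ≠ 0).image q

/-- The tree can be recovered from the set of facets to which simplices are attached. -/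
theorem IsCode.standardTree_eq {q q' : Fin N → Fin N × Fin (d + 1)} (hq : IsCode q)
    (hq' : IsCode q') (h : codeSet q = codeSet q') : standardTree q = standardTree q' := by
  classical
  let β := {r : Fin N // r.val ≠ 0}
  have hmono : ∀ q : Fin N → Fin N × Fin (d + 1), IsCode q →
      StrictMono fun r : β => toLex (q r.1) := fun q hq r r' hr => hq.strictMono _ _ r.2 hr
  have hrange : ∀ q : Fin N → Fin N × Fin (d + 1), Set.range (fun r : β => toLex (q r.1)) =
      {x | ofLex x ∈ codeSet q} := by
    intro q
    ext x
    simp only [codeSet, Finset.mem_image, Finset.mem_filter, Finset.mem_univ, true_and,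
      Set.mem_range, Set.mem_ofPred_eq]
    constructor
    · rintro ⟨r, rfl⟩
      exact ⟨r.1, r.2, rfl⟩
    · rintro ⟨r, hr, h⟩
      exact ⟨⟨r, hr⟩, congrArg toLex h⟩
  have heq := (StrictMono.range_inj (hmono q hq) (hmono q' hq')).1 (by rw [hrange, hrange, h])
  have hqq : ∀ r : Fin N, r.val ≠ 0 → q r = q' r := fun r hr => congrFun heq ⟨r, hr⟩
  ext g
  constructor
  · rintro ⟨r, hr, hg⟩
    refine ⟨r, hr, ?_⟩
    rwa [standardGluing, ← hqq r hr]
  · rintro ⟨r, hr, hg⟩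
    refine ⟨r, hr, ?_⟩
    rwa [standardGluing, hqq r hr]

theorem symm_mem_standardTree {q : Fin N → Fin N × Fin (d + 1)} {g : Gluing d N}
    (hg : g ∈ standardTree q) : g.symm ∈ standardTree q := by
  obtain ⟨r, hr, rfl | rfl⟩ := hg
  · exact ⟨r, hr, .inr rfl⟩
  · exact ⟨r, hr, .inl (Gluing.symm_symm _)⟩

theorem IsCode.card_codeSet {q : Fin N → Fin N × Fin (d + 1)} (hq : IsCode q) :
    (codeSet q).card = N - 1 := by
  classical
  rw [codeSet, Finset.card_image_of_injOn]
  · rcases Nat.eq_zero_or_pos N with rfl | hN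
    · simp
    · have : (Finset.univ.filter fun r : Fin N => r.val ≠ 0) = Finset.univ.erase ⟨0, hN⟩ := by
        ext r
        simp [Fin.ext_iff]
      rw [this, Finset.card_erase_of_mem (Finset.mem_univ _), Finset.card_univ, Fintype.card_fin]
  · intro r hr r' hr' h
    have h1 : r.val ≠ 0 := by simpa using hr
    have h2 : r'.val ≠ 0 := by simpa using hr'
    rcases lt_trichotomy r r' with hlt | heq | hlt
    · exact absurd (congrArg toLex h) (hq.strictMono r r' h1 hlt).ne
    · exact heq
    · exact absurd (congrArg toLex h).symm (hq.strictMono r' r h2 hlt).ne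

/-- Every tree of simplices can be relabelled so that it is given by a code. The simplices are
numbered by the words of facet labels that lead to them from the root, in the shortlex order, which
is the order of the numbers with these digits in bijective base `d + 2`. -/
theorem IsTreeOfSimplices.exists_code {T : List (Gluing d N)} (hT : IsTreeOfSimplices T) :
    ∃ (ψ : Relabelling d N) (q : Fin N → Fin N × Fin (d + 1)), IsCode q ∧
      ψ.gluing ⁻¹' glueSet T = standardTree q := by
  set r : Fin N := ⟨0, hT.root⟩ with hr
  obtain ⟨h, γ, hγ, hall⟩ := hT.exists_parent r
  -- `τ v` renames the vertices of `v` so that the gluing with the parent becomes standard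
  obtain ⟨τ, hτr, hτ⟩ := exists_recursive h (fun v => (γ v).i) r (fun v hv => (hγ v hv).2.2)
    (fun v (p : Equiv.Perm (Fin (d + 1))) =>
      ((Equiv.swap (p.symm (γ v).a) 0).trans p).trans (γ v).π) 1
  -- the label of the facet of the parent to which `v` is attached
  let b : Fin N → Fin (d + 1) := fun v => (τ (γ v).i).symm (γ v).a
  -- the word of labels, as a number
  obtain ⟨κ, hκr, hκ⟩ := exists_recursive h (fun v => (γ v).i) r (fun v hv => (hγ v hv).2.2)
    (fun v (n : ℕ) => n * (d + 2) + (b v).val + 1) 0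
  have hτ' : ∀ v, v ≠ r → τ v = ((Equiv.swap (b v) 0).trans (τ (γ v).i)).trans (γ v).π := hτ
  have hb : ∀ v, τ (γ v).i (b v) = (γ v).a := fun v => Equiv.apply_symm_apply _ _
  have hτ0 : ∀ v, v ≠ r → τ v 0 = (γ v).π (γ v).a := by
    intro v hv
    rw [hτ' v hv]
    simp [hb]
  have hsrc : ∀ v w, v ≠ r → w ≠ r → (γ v).i = (γ w).i → b v = b w → v = w := by
    intro v w hv hw hi hbb
    have h1 : (γ v).src = (γ w).src := by
      rw [Gluing.src, Gluing.src, ← hb v, ← hb w, hi, hbb]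
    have h2 := hT.src_inj _ (hγ v hv).1 _ (hγ w hw).1 h1
    rw [← (hγ v hv).2.1, ← (hγ w hw).2.1, h2]
  have hκlt : ∀ v w, v ≠ r → w ≠ r → κ v < κ w →
      κ (γ v).i < κ (γ w).i ∨ κ (γ v).i = κ (γ w).i ∧ b v < b w := by
    intro v w hv hw hvw
    rw [hκ v hv, hκ w hw] at hvw
    have h1 := (b v).isLt
    have h2 := (b w).isLt
    rcases lt_trichotomy (κ (γ v).i) (κ (γ w).i) with hlt | heq | hlt
    · exact .inl hlt
    · refine .inr ⟨heq, ?_⟩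
      rw [heq] at hvw
      have : (b v).val < (b w).val := by omega
      exact this
    · exfalso
      have : (κ (γ w).i + 1) * (d + 2) ≤ κ (γ v).i * (d + 2) := Nat.mul_le_mul_right _ hlt
      rw [add_mul, one_mul] at this
      omega
  have hκpos : ∀ v, v ≠ r → 0 < κ v := fun v hv => by rw [hκ v hv]; omega
  have hκinj : Function.Injective κ := by
    intro v w hvw
    induction hn : h v using Nat.strong_induction_on generalizing v w with
    | _ n ih =>
    by_cases hv : v = r
    · by_contra hne
      have := hκpos w (fun hw => hne (hv.trans hw.symm))
      rw [← hvw, hv, hκr] at this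
      exact lt_irrefl _ this
    · have hw : w ≠ r := by
        rintro rfl
        have := hκpos v hv
        rw [hvw, hκr] at this
        exact lt_irrefl _ this
      rw [hκ v hv, hκ w hw] at hvw
      have h1 := (b v).isLt
      have h2 := (b w).isLt
      have h3 : κ (γ v).i = κ (γ w).i := by
        rcases lt_trichotomy (κ (γ v).i) (κ (γ w).i) with hlt | heq | hlt
        · have : (κ (γ v).i + 1) * (d + 2) ≤ κ (γ w).i * (d + 2) := Nat.mul_le_mul_right _ hlt
          rw [add_mul, one_mul] at this
          omega
        · exact heq
        · have : (κ (γ w).i + 1) * (d + 2) ≤ κ (γ v).i * (d + 2) := Nat.mul_le_mul_right _ hlt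
          rw [add_mul, one_mul] at this
          omega
      have h4 : b v = b w := Fin.ext (by rw [h3] at hvw; omega)
      exact hsrc v w hv hw (ih _ (hn ▸ (hγ v hv).2.2) h3 rfl) h4
  set σ : Equiv.Perm (Fin N) := Tuple.sort κ with hσ
  have hσmono : StrictMono (κ ∘ σ) :=
    (Tuple.monotone_sort κ).strictMono_of_injective (hκinj.comp σ.injective)
  have hσlt : ∀ u v, κ u < κ v → σ.symm u < σ.symm v := by
    intro u v huv
    rw [← hσmono.lt_iff_lt]
    simpa using huv
  have hσ0 : ∀ s : Fin N, s.val ≠ 0 ↔ σ s ≠ r := by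
    have h0 : σ r = r := by
      by_contra hne
      have h1 := hκpos _ hne
      have h2 : σ.symm r < r := by
        have := hσlt r (σ r) (by rw [hκr]; exact h1)
        simpa using this
      exact absurd h2 (by simp [hr, Fin.lt_def])
    intro s
    have h1 : s.val ≠ 0 ↔ s ≠ r := by rw [hr]; simp [Fin.ext_iff]
    rw [h1]
    exact not_congr ⟨fun h => by rw [h, h0], fun h => σ.injective (h.trans h0.symm)⟩
  let ψ : Relabelling d N := ⟨σ, fun s => τ (σ s)⟩
  let q : Fin N → Fin N × Fin (d + 1) := fun s => (σ.symm (γ (σ s)).i, b (σ s))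
  have hstd : ∀ s : Fin N, s.val ≠ 0 → ψ.gluing (standardGluing q s) = γ (σ s) := by
    intro s hs
    have hv := (hσ0 s).1 hs
    have h1 := hτ' _ hv
    have h2 := (hγ _ hv).2.1
    have key : ∀ g : Gluing d N, g.i = (γ (σ s)).i → g.j = (γ (σ s)).j → g.a = (γ (σ s)).a →
        g.π = (γ (σ s)).π → g = γ (σ s) := by
      rintro ⟨i, j, a, π⟩ rfl rfl rfl rfl; rfl
    apply key
    · simp [Relabelling.gluing, standardGluing, ψ, q]
    · simp [Relabelling.gluing, standardGluing, ψ, h2]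
    · simp [Relabelling.gluing, standardGluing, ψ, q, hb]
    · refine Equiv.ext fun x => ?_
      simp [Relabelling.gluing, standardGluing, ψ, q, h1]
  refine ⟨ψ, q, ⟨?_, ?_⟩, ?_⟩
  · intro s s' hs hss
    have hs' : s'.val ≠ 0 := by
      have : s.val < s'.val := hss
      omega
    rw [Prod.Lex.toLex_lt_toLex]
    rcases hκlt _ _ ((hσ0 s).1 hs) ((hσ0 s').1 hs') (hσmono hss) with h1 | ⟨h1, h2⟩
    · exact .inl (hσlt _ _ h1)
    · exact .inr ⟨by simp only [q, hκinj h1], h2⟩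
  · intro s hs
    by_contra hcon
    push Not at hcon
    have hv := (hσ0 s).1 hs
    have hp : (γ (σ s)).i ≠ r := by
      have := (hσ0 (q s).1).1 hcon.1
      simpa [q] using this
    have hb0 : b (σ s) = 0 := hcon.2
    have h1 : (γ (σ s)).src = (γ (γ (σ s)).i).symm.src := by
      have h2 : (γ (σ s)).a = (γ (γ (σ s)).i).π (γ (γ (σ s)).i).a := by
        rw [← hτ0 _ hp, ← hb (σ s), hb0]
      rw [Gluing.src, h2]
      exact Prod.ext (hγ _ hp).2.1.symm rfl
    have h2 := hT.src_inj _ (hγ _ hv).1 _ (symm_mem_glueSet (hγ _ hp).1) h1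
    have h3 : σ s = (γ (γ (σ s)).i).i := by
      conv_lhs => rw [← (hγ _ hv).2.1, h2]
      rfl
    have h4 := (hγ _ hp).2.2
    rw [← h3] at h4
    exact absurd (hγ _ hv).2.2 h4.not_gt
  · ext g
    constructor
    · intro hg
      obtain ⟨v, hv, hgv⟩ := hall _ hg
      have hs : (σ.symm v).val ≠ 0 := (hσ0 _).2 (by simpa using hv)
      have h1 := hstd _ hs
      rw [σ.apply_symm_apply] at h1
      refine ⟨σ.symm v, hs, ?_⟩
      rw [← h1] at hgv
      rcases hgv with hgv | hgv
      · exact .inl (ψ.gluing_injective hgv)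
      · rw [← ψ.gluing_symm] at hgv
        exact .inr (ψ.gluing_injective hgv)
    · rintro ⟨s, hs, rfl | rfl⟩
      · change ψ.gluing _ ∈ glueSet T
        rw [hstd s hs]
        exact (hγ _ ((hσ0 s).1 hs)).1
      · change ψ.gluing _ ∈ glueSet T
        rw [ψ.gluing_symm, hstd s hs]
        exact symm_mem_glueSet (hγ _ ((hσ0 s).1 hs)).1

end Codes

/-! ### The number of quasimanifolds -/

section Count

variable {d N : ℕ}

open Classical in
/-- The facets of simplices, other than the root, that are numbered 0. -/
noncomputable def parentFacets (d N : ℕ) : Finset (Fin N × Fin (d + 1)) :=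
  (Finset.univ.filter fun r : Fin N => r.val ≠ 0).image fun r => (r, 0)

theorem card_parentFacets : (parentFacets d N).card = N - 1 := by
  classical
  rw [parentFacets, Finset.card_image_of_injective _ fun r s h => congrArg Prod.fst h]
  rcases Nat.eq_zero_or_pos N with rfl | hN
  · simp
  · have : (Finset.univ.filter fun r : Fin N => r.val ≠ 0) = Finset.univ.erase ⟨0, hN⟩ := by
      ext r
      simp [Fin.ext_iff]
    rw [this, Finset.card_erase_of_mem (Finset.mem_univ _), Finset.card_univ, Fintype.card_fin]

theorem mem_parentFacets {f : Fin N × Fin (d + 1)} :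
    f ∈ parentFacets d N ↔ f.1.val ≠ 0 ∧ f.2 = 0 := by
  classical
  simp only [parentFacets, Finset.mem_image, Finset.mem_filter, Finset.mem_univ, true_and]
  constructor
  · rintro ⟨r, hr, rfl⟩
    exact ⟨hr, rfl⟩
  · rintro ⟨h1, h2⟩
    exact ⟨f.1, h1, Prod.ext rfl h2.symm⟩

theorem IsCode.codeSet_subset {q : Fin N → Fin N × Fin (d + 1)} (hq : IsCode q) :
    codeSet q ⊆ (parentFacets d N)ᶜ := by
  classical
  intro f hf
  simp only [codeSet, Finset.mem_image, Finset.mem_filter, Finset.mem_univ, true_and] at hf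
  obtain ⟨r, hr, rfl⟩ := hf
  rw [Finset.mem_compl, mem_parentFacets]
  rcases hq.free r hr with h | h
  · exact fun h' => h'.1 h
  · exact fun h' => h h'.2

/-- The possible marks: no marks on the facets in `F`, and at most one side of a link triangle on
every other facet. -/
def markings (d N : ℕ) (F : Finset (Fin N × Fin (d + 1))) :
    Finset (Fin N × Fin (d + 1) → Option (Finset (Fin (d + 1)))) :=
  Fintype.piFinset fun f => if f ∈ F then {none} else
    insert none ((((Finset.univ.erase f.2).powersetCard 2)).image some)

/-- The sum over all markings factors over the facets outside of `F`. -/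
theorem sum_markings (F : Finset (Fin N × Fin (d + 1))) :
    ∑ M ∈ markings d N F, 12 ^ (Finset.univ.filter fun f => M f ≠ none).card =
      (1 + 12 * d.choose 2) ^ (N * (d + 1) - F.card) := by
  have h1 : ∀ M : Fin N × Fin (d + 1) → Option (Finset (Fin (d + 1))),
      12 ^ (Finset.univ.filter fun f => M f ≠ none).card =
        ∏ f, if M f ≠ none then 12 else 1 := by
    intro M
    rw [Finset.prod_ite, Finset.prod_const, Finset.prod_const_one, mul_one]
  simp_rw [h1]
  rw [markings, ← Finset.prod_univ_sum (R := ℕ) _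
    (fun f (o : Option (Finset (Fin (d + 1)))) => if o ≠ none then 12 else 1)]
  have h2 : ∀ f : Fin N × Fin (d + 1), (∑ o ∈ (if f ∈ F then {none} else
      insert none ((((Finset.univ.erase f.2).powersetCard 2)).image some)),
      if o ≠ none then 12 else 1) = if f ∈ F then 1 else 1 + 12 * d.choose 2 := by
    intro f
    by_cases hf : f ∈ F
    · simp [hf]
    · rw [if_neg hf, if_neg hf, Finset.sum_insert (by simp), Finset.sum_image (by simp)]
      simp [Finset.card_powersetCard, mul_comm]
  rw [Finset.prod_congr rfl fun f _ => h2 f, Finset.prod_ite, Finset.prod_const_one, one_mul,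
    Finset.prod_const]
  congr 1
  rw [Finset.filter_not, Finset.card_sdiff_of_subset (Finset.filter_subset _ _)]
  simp

open Classical in
/-- The number of 2-LC quasimanifolds is bounded by the number of triples of a tree code, marks and
completions. -/
theorem card_quasimanifoldType_le (d N : ℕ) (hN : 1 ≤ N) :
    Finite (QuasimanifoldType d N) ∧ Nat.card (QuasimanifoldType d N) ≤
      2 ^ (N * d + 1) * (1 + 12 * d.choose 2) ^ (N * (d + 1) - 2 * (N - 1)) := by
  let 𝒞 : Finset (Finset (Fin N × Fin (d + 1))) := ((parentFacets d N)ᶜ).powersetCard (N - 1)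
  -- the tree with a given code set, and the completions of given marks
  let tree : Finset (Fin N × Fin (d + 1)) → Set (Gluing d N) := fun c =>
    if h : ∃ q, IsCode q ∧ codeSet q = c then standardTree h.choose else ∅
  let 𝒢 : Finset (Fin N × Fin (d + 1)) →
      (Fin N × Fin (d + 1) → Option (Finset (Fin (d + 1)))) → Finset (Set (Gluing d N)) :=
    fun c M => (Set.toFinite {G | (∀ g ∈ tree c, M g.src = none) ∧ Good (tree c) M G}).toFinset
  let 𝒮 : Finset ((_ : Finset (Fin N × Fin (d + 1))) ×
      (_ : Fin N × Fin (d + 1) → Option (Finset (Fin (d + 1)))) × Set (Gluing d N)) :=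
    𝒞.sigma fun c => (markings d N (c ∪ parentFacets d N)).sigma fun M => 𝒢 c M
  have hsym : ∀ c, ∀ g ∈ tree c, g.symm ∈ tree c := by
    intro c g hg
    by_cases h : ∃ q, IsCode q ∧ codeSet q = c
    · have h1 : tree c = standardTree h.choose := dif_pos h
      rw [h1] at hg ⊢
      exact symm_mem_standardTree hg
    · have h1 : tree c = ∅ := dif_neg h
      rw [h1] at hg
      exact absurd hg (Set.notMem_empty _)
  have h𝒢 : ∀ c M, (𝒢 c M).card ≤ 12 ^ (Finset.univ.filter fun f => M f ≠ none).card := by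
    intro c M
    rcases (𝒢 c M).eq_empty_or_nonempty with he | ⟨G₀, hG₀⟩
    · rw [he]; simp
    · have hnone := ((Set.Finite.mem_toFinset _).1 hG₀).1
      refine card_good_le (tree c) (hsym c) ?_ _ fun G hG => ((Set.Finite.mem_toFinset _).1 hG).2
      intro g hg s hs hm
      rw [Marked, hs, hnone g hg] at hm
      simp at hm
  have h𝒮 : 𝒮.card ≤ 2 ^ (N * d + 1) *
      (1 + 12 * d.choose 2) ^ (N * (d + 1) - 2 * (N - 1)) := by
    rw [Finset.card_sigma]
    have h1 : ∀ c ∈ 𝒞, ((markings d N (c ∪ parentFacets d N)).sigma fun M => 𝒢 c M).card ≤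
        (1 + 12 * d.choose 2) ^ (N * (d + 1) - 2 * (N - 1)) := by
      intro c hc
      rw [Finset.mem_powersetCard] at hc
      have h2 : (c ∪ parentFacets d N).card = 2 * (N - 1) := by
        rw [Finset.card_union_of_disjoint, hc.2, card_parentFacets, two_mul]
        rw [Finset.disjoint_left]
        exact fun f hf => Finset.mem_compl.1 (hc.1 hf)
      rw [Finset.card_sigma, ← h2, ← sum_markings]
      exact Finset.sum_le_sum fun M _ => h𝒢 c M
    refine (Finset.sum_le_card_nsmul _ _ _ h1).trans ?_
    rw [smul_eq_mul]
    refine Nat.mul_le_mul_right _ ?_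
    calc 𝒞.card ≤ ((parentFacets d N)ᶜ).powerset.card :=
          Finset.card_le_card fun s hs =>
            Finset.mem_powerset.2 (Finset.mem_powersetCard.1 hs).1
      _ = 2 ^ (N * d + 1) := by
        rw [Finset.card_powerset, Finset.card_compl, card_parentFacets]
        congr 1
        simp only [Fintype.card_prod, Fintype.card_fin]
        have : N * (d + 1) = N * d + N := by ring
        omega
  -- every class has a representative with data in `𝒮` from which the class can be recovered
  have hdata : ∀ x : QuasimanifoldType d N, ∃ t ∈ 𝒮, ∃ (L : List (Gluing d N))
      (hL : IsTwoLCQuasimanifold L) (ψ : Relabelling d N),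
      Quotient.mk (combinatorialIso d N) ⟨L, hL⟩ = x ∧ t.2.2 = ψ.gluing ⁻¹' glueSet L := by
    intro x
    obtain ⟨⟨L, hL⟩, rfl⟩ := Quotient.exists_rep x
    obtain ⟨T, hT, M, hgood, hnone, hsupp⟩ := hL.constructible.exists_good
    obtain ⟨ψ, q, hq, htree⟩ := hT.exists_code
    have htreeq : tree (codeSet q) = standardTree q := by
      have h : ∃ q', IsCode q' ∧ codeSet q' = codeSet q := ⟨q, hq, rfl⟩
      have h1 : tree (codeSet q) = standardTree h.choose := dif_pos h
      rw [h1]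
      exact h.choose_spec.1.standardTree_eq hq h.choose_spec.2
    have hgood' := ψ.good hgood
    rw [htree] at hgood'
    have hnone' : ∀ g ∈ standardTree q, ψ.marks M g.src = none := by
      intro g hg
      rw [← htree] at hg
      have := hnone _ hg
      rw [ψ.src_gluing] at this
      rw [Relabelling.marks, this]
      rfl
    refine ⟨⟨codeSet q, ψ.marks M, ψ.gluing ⁻¹' glueSet L⟩, ?_, L, hL, ψ, rfl, rfl⟩
    refine Finset.mem_sigma.2 ⟨Finset.mem_powersetCard.2 ⟨hq.codeSet_subset, hq.card_codeSet⟩,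
      Finset.mem_sigma.2 ⟨?_, ?_⟩⟩
    · rw [markings, Fintype.mem_piFinset]
      intro f
      by_cases hf : f ∈ codeSet q ∪ parentFacets d N
      · rw [if_pos hf, Finset.mem_singleton]
        rcases Finset.mem_union.1 hf with hf | hf
        · simp only [codeSet, Finset.mem_image, Finset.mem_filter, Finset.mem_univ,
            true_and] at hf
          obtain ⟨r, hr, rfl⟩ := hf
          exact hnone' _ ⟨r, hr, .inl rfl⟩
        · rw [mem_parentFacets] at hf
          have h1 := hnone' _ ⟨f.1, hf.1, .inr rfl⟩
          have h2 : (standardGluing q f.1).symm.src = f := by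
            refine Prod.ext rfl ?_
            simp [Gluing.src, Gluing.symm, standardGluing, hf.2]
          rwa [h2] at h1
      · rw [if_neg hf, Finset.mem_insert]
        cases hMf : M (ψ.facet f) with
        | none =>
          left
          change (M (ψ.facet f)).map _ = _
          rw [hMf]
          rfl
        | some e =>
          right
          obtain ⟨h1, h2⟩ := hsupp _ e hMf
          refine Finset.mem_image.2 ⟨e.map (ψ.τ f.1).symm.toEmbedding, ?_, ?_⟩
          · rw [Finset.mem_powersetCard, Finset.card_map]
            refine ⟨fun v hv => Finset.mem_erase.2 ⟨?_, Finset.mem_univ _⟩, h2⟩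
            rintro rfl
            rw [Finset.mem_map_equiv] at hv
            exact h1 (by simpa [Relabelling.facet] using hv)
          · change _ = (M (ψ.facet f)).map _
            rw [hMf]
            rfl
    · refine (Set.Finite.mem_toFinset _).2 ⟨?_, ?_⟩
      · rw [htreeq]; exact hnone'
      · rw [htreeq]; exact hgood'
  choose f hf𝒮 L hL ψ hx hfψ using hdata
  have hinj : Function.Injective fun x => (⟨f x, hf𝒮 x⟩ : 𝒮) := by
    intro x y hxy
    have h1 : f x = f y := congrArg Subtype.val hxy
    have h2 := hfψ x
    rw [h1, hfψ y] at h2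
    rw [← hx x, ← hx y]
    exact Quotient.sound (Relabelling.nonempty_orderIso h2.symm)
  have hfin : Finite (QuasimanifoldType d N) := Finite.of_injective _ hinj
  refine ⟨hfin, le_trans ?_ h𝒮⟩
  have := Nat.card_le_card_of_injective _ hinj
  simpa using this

/-- The bound of the theorem exceeds the number of triples of a tree code, marks and completions. -/
theorem eventually_bound_lt (d : ℕ) (hd : 3 ≤ d) : ∀ᶠ N : ℕ in atTop,
    ((2 ^ (N * d + 1) * (1 + 12 * d.choose 2) ^ (N * (d + 1) - 2 * (N - 1)) : ℕ) : ℝ) <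
      (2 : ℝ) ^ ((d : ℝ) ^ 3 / 2 * (N : ℝ)) := by
  rcases hd.eq_or_lt with rfl | hd
  -- for `d = 3`, squaring removes the half in the exponent: `2 ^ 6 * 37 ^ 4 = 119946304` is less
  -- than `2 ^ 27 = 134217728`
  · have h0 : Tendsto (fun N : ℕ => ((119946304 : ℝ) / 134217728) ^ N) atTop (nhds 0) :=
      tendsto_pow_atTop_nhds_zero_of_lt_one (by norm_num) (by norm_num)
    have h1 : ∀ᶠ N : ℕ in atTop, ((119946304 : ℝ) / 134217728) ^ N < 1 / (4 * 37 ^ 4) :=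
      h0.eventually_lt_const (by norm_num)
    filter_upwards [h1, eventually_ge_atTop 1] with N hN hN1
    have e1 : N * (3 + 1) - 2 * (N - 1) = 2 * N + 2 := by omega
    have e2 : 1 + 12 * Nat.choose 3 2 = 37 := by decide
    rw [e1, e2]
    push_cast
    refine lt_of_pow_lt_pow_left₀ 2 (by positivity) ?_
    have e3 : ((3 : ℝ) ^ 3 / 2 * (N : ℝ) * ((2 : ℕ) : ℝ)) = ((27 * N : ℕ) : ℝ) := by
      push_cast; ring
    have e5 : ((2 : ℝ) ^ ((3 : ℝ) ^ 3 / 2 * (N : ℝ))) ^ 2 = ((2 : ℝ) ^ 27) ^ N := by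
      rw [← Real.rpow_natCast (_ ^ (_ : ℝ)) 2, ← Real.rpow_mul (by norm_num), e3,
        Real.rpow_natCast, pow_mul]
    rw [e5]
    rw [div_pow, div_lt_div_iff₀ (by positivity) (by positivity)] at hN
    have e4 : ((2 : ℝ) ^ (N * 3 + 1) * 37 ^ (2 * N + 2)) ^ 2 =
        119946304 ^ N * (4 * 37 ^ 4) := by
      have : (119946304 : ℝ) = 2 ^ 6 * 37 ^ 4 := by norm_num
      rw [this, mul_pow, mul_pow, ← pow_mul, ← pow_mul, ← pow_mul, ← pow_mul]
      ring
    rw [e4]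
    calc _ < _ := hN
      _ = _ := by norm_num
  -- for `d ≥ 4`, the exponents of 2 can be compared with `1 + 12 * d.choose 2 ≤ 2 ^ (d + 3)`
  · have hd4 : 4 ≤ d := hd
    filter_upwards [eventually_gt_atTop (4 * d + 14)] with N hN
    have hbase : 1 + 12 * d.choose 2 ≤ 2 ^ (d + 3) := by
      have key : ∀ k, 1 + 6 * ((k + 4) * (k + 3)) ≤ 2 ^ (k + 7) := by
        intro k
        induction k with
        | zero => norm_num
        | succ k ih =>
          rw [show k + 1 + 7 = (k + 7) + 1 by ring, pow_succ]
          nlinarith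
      obtain ⟨k, rfl⟩ := Nat.exists_eq_add_of_le hd4
      have h1 := key k
      have h2 : (4 + k).choose 2 * 2 = (4 + k) * (3 + k) := by
        rw [Nat.choose_two_right]
        have h3 : 4 + k - 1 = 3 + k := by omega
        rw [h3]
        exact Nat.div_mul_cancel (by
          have := Nat.even_mul_succ_self (3 + k)
          rw [show (4 + k) * (3 + k) = (3 + k) * (3 + k + 1) by ring]
          exact this.two_dvd)
      rw [show 4 + k + 3 = k + 7 by ring]
      nlinarith
    have hexp : N * (d + 1) - 2 * (N - 1) = N * (d - 1) + 2 := by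
      obtain ⟨k, rfl⟩ := Nat.exists_eq_add_of_le hd4
      have h3 : 4 + k - 1 = 3 + k := by omega
      rw [h3]
      have : N * (4 + k + 1) = N * (3 + k) + 2 * N := by ring
      omega
    rw [hexp]
    have hle : 2 ^ (N * d + 1) * (1 + 12 * d.choose 2) ^ (N * (d - 1) + 2) ≤
        2 ^ (N * d + 1 + (d + 3) * (N * (d - 1) + 2)) := by
      rw [pow_add 2 (N * d + 1), pow_mul]
      exact Nat.mul_le_mul_left _ (Nat.pow_le_pow_left hbase _)
    have hle' : ((2 ^ (N * d + 1) * (1 + 12 * d.choose 2) ^ (N * (d - 1) + 2) : ℕ) : ℝ) ≤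
        ((2 : ℝ) ^ (N * d + 1 + (d + 3) * (N * (d - 1) + 2))) := by
      exact_mod_cast hle
    refine hle'.trans_lt ?_
    rw [← Real.rpow_natCast]
    refine Real.rpow_lt_rpow_of_exponent_lt (by norm_num) ?_
    have hd1 : ((d - 1 : ℕ) : ℝ) = (d : ℝ) - 1 := by
      rw [Nat.cast_sub (by omega)]; simp
    push_cast
    rw [hd1]
    have hN' : 4 * (d : ℝ) + 14 < N := by exact_mod_cast hN
    have hd' : (4 : ℝ) ≤ d := by exact_mod_cast hd4
    have hcoef : (1 : ℝ) ≤ (d : ℝ) ^ 3 - 2 * (d ^ 2 + 3 * d - 3) := by nlinarith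
    have hNpos : (0 : ℝ) ≤ N := Nat.cast_nonneg N
    nlinarith [mul_le_mul_of_nonneg_right hcoef hNpos]

end Count

theorem mainTheorem2 (d : ℕ) (hd : 3 ≤ d) :
    ∀ᶠ N : ℕ in atTop, Finite (QuasimanifoldType d N) ∧
      (Nat.card (QuasimanifoldType d N) : ℝ) < (2 : ℝ) ^ ((d : ℝ) ^ 3 / 2 * (N : ℝ)) := by
  filter_upwards [eventually_bound_lt d hd, eventually_ge_atTop 1] with N hN hN1
  obtain ⟨hfin, hcard⟩ := card_quasimanifoldType_le d N hN1
  exact ⟨hfin, lt_of_le_of_lt (by exact_mod_cast hcard) hN⟩
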